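/- **Actions and expressions.** Fix a set of visible actions $a$; the prioritized actions are $\alpha ::= \tau \mid a$, and all actions are $\gamma ::= \alpha \mid \delta$, with $\delta$ an unprioritized time action. The expressions of the extended discrete time calculus, taken up to renaming of bound variables (with countably many variables $X$), are $$E ::= 0 \mid \underline{0} \mid X \mid \gamma^t.E \mid E +^t E \mid E/L \mid E \parallel_S E \mid \mathrm{rec}X.E \mid \gamma.E \mid E+E \mid \mathrm{pri}(E)\mid \mathrm{vis}(E) \mid E \,\lfloor_S\, E \mid E \mid_S E ,$$ where $L,S$ are sets of visible actions. Processes are closed expressions. *Basic* processes are the closed expressions built from $0$, $X$, $\gamma.E$, $E+E$, $\mathrm{rec}X.E$ only (recursion may be unguarded). **Transitions.** The transitions of processes are given by the following rules (the negative premises only concern $\alpha$-transitions, whose rules have no negative premises, so this is well-defined by stratification): $\gamma.P\xrightarrow{\gamma}P$; $\gamma^t.P\xrightarrow{\gamma}P$; $a^t.P\xrightarrow{\delta}a^t.P$; $\underline0\xrightarrow{\delta}\underline0$; $P+Q$ and $P+^tQ$ have the $\alpha$-transitions of $P$ and of $Q$; $P+Q$ has the $\delta$-transitions of $P$ if $Q\not\xrightarrow{\tau}$,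 and those of $Q$ if $P\not\xrightarrow{\tau}$; $\mathrm{rec}X.E$ has the transitions of $E\{\mathrm{rec}X.E/X\}$; $\mathrm{pri}(P)$ has the $\alpha$-transitions of $P$; if $P\xrightarrow{\delta}P'$ and $Q\xrightarrow{\delta}Q'$ then $P+^tQ\xrightarrow{\delta}P'+^tQ'$, $P\parallel_SQ\xrightarrow{\delta}P'\parallel_SQ'$ and $P\mid_SQ\xrightarrow{\delta}P'\parallel_SQ'$; if $P\xrightarrow{\alpha}P'$ with $\alpha\notin S$ then $P\parallel_SQ\xrightarrow{\alpha}P'\parallel_SQ$, $Q\parallel_SP\xrightarrow{\alpha}Q\parallel_SP'$ and $P\lfloor_SQ\xrightarrow{\alpha}P'\parallel_SQ$; if $P\xrightarrow{a}P'$, $Q\xrightarrow{a}Q'$ and $a\in S$ then $P\parallel_SQ\xrightarrow{a}P'\parallel_SQ'$; $\mathrm{vis}(P)\xrightarrow{a}P'$ if $P\xrightarrow{a}P'$, or if $P\xrightarrow{\tau}P''$ and $\mathrm{vis}(P'')\xrightarrow{a}P'$; if $\mathrm{vis}(P)\xrightarrow{a}P'$, $\mathrm{vis}(Q)\xrightarrow{a}Q'$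 and $a\in S$ then $P\mid_SQ\xrightarrow{a}P'\parallel_SQ'$; if $P\xrightarrow{a}P'$ with $a\in L$ then $P/L\xrightarrow{\tau}P'/L$; if $P\xrightarrow{\alpha}P'$ with $\alpha\notin L$ then $P/L\xrightarrow{\alpha}P'/L$; if $P\xrightarrow{\delta}P'$ and $P\not\xrightarrow{a}$ for all $a\in L$ then $P/L\xrightarrow{\delta}P'/L$. A process is *time-deterministic* if every process reachable from it has at most one outgoing $\delta$-transition. **Equivalence.** Let $\Rightarrow^{\gamma}$ be $(\xrightarrow{\tau})^*\xrightarrow{\gamma}(\xrightarrow{\tau})^*$, and let $\Rightarrow^{\hat\gamma}$ be $\Rightarrow^\gamma$ if $\gamma\ne\tau$ and $(\xrightarrow{\tau})^*$ if $\gamma=\tau$. A relation $\beta$ is a weak bisimulation if $(P,Q)\in\beta$ and $P\xrightarrow{\gamma}P'$ imply $Q\Rightarrow^{\hat\gamma}Q'$ with $(P',Q')\in\beta$ for some $Q'$, and symmetrically for the moves of $Q$; $\approx$ is the union of all weak bisimulations. A relation $\beta$ is a rooted time weak bisimulation if, whenever $(P,Q)\in\beta$: $P\xrightarrow{\alpha}P'$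 implies $Q\Rightarrow^{\alpha}Q'$ with $P'\approx Q'$ for some $Q'$; $P\xrightarrow{\delta}P'$ implies $Q\xrightarrow{\delta}Q'$ with $(P',Q')\in\beta$ for some $Q'$; and symmetrically for the moves of $Q$. Write $P\simeq_TQ$ if $(P,Q)$ is in some rooted time weak bisimulation. **Axioms.** A variable $X$ is *serial* in $E$ if every subexpression of $E$ with a free occurrence of $X$, apart from $X$ itself, has the form $\gamma.F$, $F+G$ or $\mathrm{rec}Y.F$; it is *strongly guarded* in $E$ if each free occurrence of $X$ in $E$ lies within a prefix $\gamma.F$ or $\gamma^t.F$ with $\gamma\neq\tau$. $\mathcal A_{DT}\vdash E=F$ means that $E=F$ is derivable by equational reasoning (equivalence, and congruence for all operators including recursion) from the following axioms, for all expressions $E,F,G$ of the extended calculus (substitution is capture-avoiding). - $E+F=F+E$; $(E+F)+G=E+(F+G)$; $E+E=E$; $E+0=E$. - $\alpha.\tau.E=\alpha.E$; $E+\tau.E=\tau.E$; $\alpha.(E+\tau.F)+\alpha.F=\alpha.(E+\tau.F)$; (Tau4) $\alpha.F\{\delta.\tau.E/X\}=\alpha.F\{\delta.E/X\}$ if $X$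 is serial in $F$. - $\mathrm{pri}(0)=0$; $\mathrm{pri}(\alpha.E)=\alpha.E$; $\mathrm{pri}(\delta.E)=0$; $\mathrm{pri}(E+F)=\mathrm{pri}(E)+\mathrm{pri}(F)$; $\mathrm{pri}(\mathrm{pri}(E))=\mathrm{pri}(E)$; $\tau.E+F=\tau.E+\mathrm{pri}(F)$. - $\mathrm{rec}X.E=E\{\mathrm{rec}X.E/X\}$; from $F=E\{F/X\}$ infer $F=\mathrm{rec}X.E$ if $X$ is serial and strongly guarded in $E$. - $\mathrm{rec}X.(X+E)=\mathrm{rec}X.E$; $\mathrm{rec}X.(\tau.X+E)=\mathrm{rec}X.\tau.\mathrm{pri}(E)$; $\mathrm{rec}X.(\tau.(X+E)+F)=\mathrm{rec}X.(\tau.X+E+F)$; $\mathrm{rec}X.(\tau.(\mathrm{pri}(X)+E)+F)=\mathrm{rec}X.(\tau.X+E+F)$. - $\underline0=\mathrm{rec}X.\delta.X$; $\alpha^t.E=\mathrm{rec}X.(\delta.X+\alpha.E)$ if $X$ is not free in $E$; $\delta^t.E=\delta.E$. - $E+^tF=F+^tE$; $(E+^tF)+^tG=E+^t(F+^tG)$;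 $E+^t\underline0=E$; $\mathrm{pri}(E+^tF)=\mathrm{pri}(E)+\mathrm{pri}(F)$; $\mathrm{pri}(E)+^tF=\mathrm{pri}(E)+\mathrm{pri}(F)$; $\delta.E+^t\delta.F=\delta.(E+^tF)$; $(E+F)+^tG=(E+^tG)+(F+^tG)$. - $0/L=0$; $(\gamma.E)/L=\gamma.(E/L)$ if $\gamma\notin L$; $(a.E)/L=\tau.(E/L)$ if $a\in L$; $(E+F)/L=E/L+F/L$; $(\mathrm{rec}X.E)/L=\mathrm{rec}X.(E/L)$ if $X$ is serial in $E$. - $\mathrm{vis}(0)=0$; $\mathrm{vis}(a.E)=a.E$; $\mathrm{vis}(E+F)=\mathrm{vis}(E)+\mathrm{vis}(F)$. - $E\parallel_SF=E\lfloor_SF+F\lfloor_SE+E\mid_SF$; $0\lfloor_SE=0$; $(\gamma.E)\lfloor_SF=0$ if $\gamma\in S\cup\{\delta\}$; $(\alpha.E)\lfloor_SF=\alpha.(E\parallel_SF)$ if $\alpha\notin S$; $(E+F)\lfloor_SG=E\lfloor_SG+F\lfloor_SG$. - $E\mid_SF=F\mid_SE$; $0\mid_SE=0$; $(\gamma.E)\mid_S(\gamma'.F)=0$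 if $(\gamma\notin S\cup\{\delta\}$ or $\gamma\ne\gamma')$ and $\tau\notin\{\gamma,\gamma'\}$; $(\tau.E)\mid_SF=\mathrm{pri}(E\mid_SF)$; $(\gamma.E)\mid_S(\gamma.F)=\gamma.(E\parallel_SF)$ if $\gamma\in S\cup\{\delta\}$; $(\mathrm{pri}(E)+\mathrm{pri}(F))\mid_SG=\mathrm{pri}(E)\mid_SG+\mathrm{pri}(F)\mid_SG$; $(\delta.E+\mathrm{vis}(F))\mid_SG=\delta.E\mid_SG+\mathrm{vis}(F)\mid_SG$. **Theorem.** Let $P,Q$ be time-deterministic basic processes (possibly with unguarded recursion). If $P\simeq_TQ$ then $\mathcal A_{DT}\vdash P=Q$. -/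

import Mathlib

universe u

namespace DTCalc

/-! ### Actions -/

/-- Prioritized actions `α`: the silent action `τ` and the visible actions `a : A`. -/
inductive PAct (A : Type u) : Type u
  | tau : PAct A
  | vis (a : A) : PAct A

/-- All actions `γ`: the prioritized ones and the unprioritized (time) action `δ`. -/
inductive Act (A : Type u) : Type u
  | std (α : PAct A) : Act A
  | delta : Act A

/-- The silent action, as an element of `Act`. -/
abbrev Act.tau {A : Type u} : Act A := Act.std PAct.tau

/-- `α ∈ S`, for a set `S` of visible actions (`τ` never belongs to it). -/
def PAct.mem {A : Type u} (S : Set A) : PAct A → Prop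
  | .tau => False
  | .vis a => a ∈ S

/-- `γ ∈ S`, for a set `S` of visible actions (`τ` and `δ` never belong to it). -/
def Act.mem {A : Type u} (S : Set A) : Act A → Prop
  | .std α => α.mem S
  | .delta => False

/-! ### Expressions -/

/-- Expressions of the extended discrete time calculus.  They are taken up to a change of bound
variables: variables are de Bruijn indices, and `mu E` is the recursion `rec X . E`, where `X` is
the variable with index `0` in `E`. -/
inductive Expr (A : Type u) : Type u
  /-- the terminated process `0`, which lets no time pass -/
  | nil : Expr A
  /-- the terminated process that lets time pass -/
  | tnil : Expr A
  /-- a variable -/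
  | var (i : ℕ) : Expr A
  /-- the timed prefix `γ^t . E` -/
  | tpre (γ : Act A) (E : Expr A) : Expr A
  /-- the timed choice `E +^t F` -/
  | tplus (E F : Expr A) : Expr A
  /-- hiding `E / L` -/
  | hide (L : Set A) (E : Expr A) : Expr A
  /-- CSP parallel composition `E ∥_S F` -/
  | par (S : Set A) (E F : Expr A) : Expr A
  /-- recursion `rec X . E` -/
  | mu (E : Expr A) : Expr A
  /-- prefix `γ . E` -/
  | pre (γ : Act A) (E : Expr A) : Expr A
  /-- choice `E + F` -/
  | plus (E F : Expr A) : Expr A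
  /-- the auxiliary operator `pri(E)` -/
  | pri (E : Expr A) : Expr A
  /-- the auxiliary operator `vis(E)` -/
  | vis (E : Expr A) : Expr A
  /-- left merge -/
  | lmerge (S : Set A) (E F : Expr A) : Expr A
  /-- synchronization merge -/
  | smerge (S : Set A) (E F : Expr A) : Expr A

namespace Expr

variable {A : Type u}

/-- A renaming of variables, pushed under a binder. -/
def upRen (ρ : ℕ → ℕ) : ℕ → ℕ
  | 0 => 0
  | i + 1 => ρ i + 1

/-- Renaming of the free variables. -/
def rename : (ℕ → ℕ) → Expr A → Expr A
  | _, nil => nil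
  | _, tnil => tnil
  | ρ, var i => var (ρ i)
  | ρ, tpre γ E => tpre γ (rename ρ E)
  | ρ, tplus E F => tplus (rename ρ E) (rename ρ F)
  | ρ, hide L E => hide L (rename ρ E)
  | ρ, par S E F => par S (rename ρ E) (rename ρ F)
  | ρ, mu E => mu (rename (upRen ρ) E)
  | ρ, pre γ E => pre γ (rename ρ E)
  | ρ, plus E F => plus (rename ρ E) (rename ρ F)
  | ρ, pri E => pri (rename ρ E)
  | ρ, vis E => vis (rename ρ E)
  | ρ, lmerge S E F => lmerge S (rename ρ E) (rename ρ F)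
  | ρ, smerge S E F => smerge S (rename ρ E) (rename ρ F)

/-- Weakening: `E` seen in the scope of one more binder, whose variable does not occur in it. -/
def shift (E : Expr A) : Expr A := rename Nat.succ E

/-- A substitution, pushed under a binder. -/
def upSub (σ : ℕ → Expr A) : ℕ → Expr A
  | 0 => var 0
  | i + 1 => shift (σ i)

/-- Simultaneous capture-avoiding substitution for the free variables. -/
def subst : (ℕ → Expr A) → Expr A → Expr A
  | _, nil => nil
  | _, tnil => tnil
  | σ, var i => σ i
  | σ, tpre γ E => tpre γ (subst σ E)
  | σ, tplus E F => tplus (subst σ E) (subst σ F)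
  | σ, hide L E => hide L (subst σ E)
  | σ, par S E F => par S (subst σ E) (subst σ F)
  | σ, mu E => mu (subst (upSub σ) E)
  | σ, pre γ E => pre γ (subst σ E)
  | σ, plus E F => plus (subst σ E) (subst σ F)
  | σ, pri E => pri (subst σ E)
  | σ, vis E => vis (subst σ E)
  | σ, lmerge S E F => lmerge S (subst σ E) (subst σ F)
  | σ, smerge S E F => smerge S (subst σ E) (subst σ F)

/-- The substitution that sends the variable `0` to `F` and lowers all the others by one. -/
def single (F : Expr A) : ℕ → Expr A
  | 0 => F
  | i + 1 => var i

/-- `E {F / X}`, where `X` is the variable `0` of `E`. -/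
def inst (E F : Expr A) : Expr A := subst (single F) E

/-- The variable `i` occurs free in the expression. -/
def Occurs : ℕ → Expr A → Prop
  | _, nil => False
  | _, tnil => False
  | i, var j => i = j
  | i, tpre _ E => Occurs i E
  | i, tplus E F => Occurs i E ∨ Occurs i F
  | i, hide _ E => Occurs i E
  | i, par _ E F => Occurs i E ∨ Occurs i F
  | i, mu E => Occurs (i + 1) E
  | i, pre _ E => Occurs i E
  | i, plus E F => Occurs i E ∨ Occurs i F
  | i, pri E => Occurs i E
  | i, vis E => Occurs i E
  | i, lmerge _ E F => Occurs i E ∨ Occurs i F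
  | i, smerge _ E F => Occurs i E ∨ Occurs i F

/-- Closed expressions, i.e. processes. -/
def Closed (E : Expr A) : Prop := ∀ i, ¬ Occurs i E

/-- Basic expressions: those built from `0`, variables, prefix, choice and recursion only. -/
def IsBasic : Expr A → Prop
  | nil => True
  | var _ => True
  | pre _ E => IsBasic E
  | plus E F => IsBasic E ∧ IsBasic F
  | mu E => IsBasic E
  | _ => False

/-- The variable `i` is strongly guarded: each of its free occurrences lies within a prefix
(`γ . F` or `γ^t . F`) with `γ ≠ τ`. -/
def Guarded : ℕ → Expr A → Prop
  | _, nil => True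
  | _, tnil => True
  | i, var j => i ≠ j
  | i, tpre γ E => γ ≠ Act.tau ∨ Guarded i E
  | i, tplus E F => Guarded i E ∧ Guarded i F
  | i, hide _ E => Guarded i E
  | i, par _ E F => Guarded i E ∧ Guarded i F
  | i, mu E => Guarded (i + 1) E
  | i, pre γ E => γ ≠ Act.tau ∨ Guarded i E
  | i, plus E F => Guarded i E ∧ Guarded i F
  | i, pri E => Guarded i E
  | i, vis E => Guarded i E
  | i, lmerge _ E F => Guarded i E ∧ Guarded i F
  | i, smerge _ E F => Guarded i E ∧ Guarded i F

/-- The variable `i` is serial: each subexpression in which it occurs free is the variable itself,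
a prefix `γ . F`, a choice `F + G` or a recursion. -/
def Serial : ℕ → Expr A → Prop
  | _, var _ => True
  | i, pre _ E => Serial i E
  | i, plus E F => Serial i E ∧ Serial i F
  | i, mu E => Serial (i + 1) E
  | i, E => ¬ Occurs i E

end Expr

open _root_.DTCalc.Expr

variable {A : Type u}

/-! ### Operational semantics

The rules for `δ` have negative premises, which concern transitions with prioritized actions only;
the rules for prioritized actions have no negative premises and no `δ` premises.  So the transition
relation is given by strata: first `PStep`, then `DStep`.  The rules are meant for closed
expressions (a free variable has no transition, and transitions keep expressions closed). -/

/-- Transitions with prioritized actions. -/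
inductive PStep : Expr A → PAct A → Expr A → Prop
  | pre (α : PAct A) (P : Expr A) : PStep (pre (.std α) P) α P
  | plusL {P Q R : Expr A} {α : PAct A} : PStep P α R → PStep (plus P Q) α R
  | plusR {P Q R : Expr A} {α : PAct A} : PStep Q α R → PStep (plus P Q) α R
  | mu {E R : Expr A} {α : PAct A} : PStep (inst E (mu E)) α R → PStep (mu E) α R
  | pri {P R : Expr A} {α : PAct A} : PStep P α R → PStep (pri P) α R
  | tpre (α : PAct A) (P : Expr A) : PStep (tpre (.std α) P) α P
  | tplusL {P Q R : Expr A} {α : PAct A} : PStep P α R → PStep (tplus P Q) α R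
  | tplusR {P Q R : Expr A} {α : PAct A} : PStep Q α R → PStep (tplus P Q) α R
  | parL {S : Set A} {P Q R : Expr A} {α : PAct A} :
      PStep P α R → ¬ α.mem S → PStep (par S P Q) α (par S R Q)
  | parR {S : Set A} {P Q R : Expr A} {α : PAct A} :
      PStep Q α R → ¬ α.mem S → PStep (par S P Q) α (par S P R)
  | parSync {S : Set A} {P Q P₁ Q₁ : Expr A} {a : A} :
      PStep P (.vis a) P₁ → PStep Q (.vis a) Q₁ → a ∈ S →
        PStep (par S P Q) (.vis a) (par S P₁ Q₁)
  | hideIn {L : Set A} {P R : Expr A} {a : A} :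
      PStep P (.vis a) R → a ∈ L → PStep (hide L P) .tau (hide L R)
  | hideOut {L : Set A} {P R : Expr A} {α : PAct A} :
      PStep P α R → ¬ α.mem L → PStep (hide L P) α (hide L R)
  | vis {P R : Expr A} {a : A} : PStep P (.vis a) R → PStep (vis P) (.vis a) R
  | visTau {P Q R : Expr A} {a : A} :
      PStep P .tau Q → PStep (vis Q) (.vis a) R → PStep (vis P) (.vis a) R
  | lmerge {S : Set A} {P Q R : Expr A} {α : PAct A} :
      PStep P α R → ¬ α.mem S → PStep (lmerge S P Q) α (par S R Q)
  | smerge {S : Set A} {P Q P₁ Q₁ : Expr A} {a : A} :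
      PStep (vis P) (.vis a) P₁ → PStep (vis Q) (.vis a) Q₁ → a ∈ S →
        PStep (smerge S P Q) (.vis a) (par S P₁ Q₁)

/-- Transitions with `δ`. -/
inductive DStep : Expr A → Expr A → Prop
  | pre (P : Expr A) : DStep (pre .delta P) P
  | plusL {P Q R : Expr A} : DStep P R → (¬ ∃ T, PStep Q .tau T) → DStep (plus P Q) R
  | plusR {P Q R : Expr A} : DStep Q R → (¬ ∃ T, PStep P .tau T) → DStep (plus P Q) R
  | mu {E R : Expr A} : DStep (inst E (mu E)) R → DStep (mu E) R
  | tnil : DStep tnil tnil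
  | tpreDelta (P : Expr A) : DStep (tpre .delta P) P
  | tpreVis (a : A) (P : Expr A) :
      DStep (tpre (.std (.vis a)) P) (tpre (.std (.vis a)) P)
  | tplus {P Q P₁ Q₁ : Expr A} : DStep P P₁ → DStep Q Q₁ → DStep (tplus P Q) (tplus P₁ Q₁)
  | par {S : Set A} {P Q P₁ Q₁ : Expr A} :
      DStep P P₁ → DStep Q Q₁ → DStep (par S P Q) (par S P₁ Q₁)
  | hide {L : Set A} {P R : Expr A} :
      DStep P R → (¬ ∃ a ∈ L, ∃ T, PStep P (.vis a) T) → DStep (hide L P) (hide L R)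
  | smerge {S : Set A} {P Q P₁ Q₁ : Expr A} :
      DStep P P₁ → DStep Q Q₁ → DStep (smerge S P Q) (par S P₁ Q₁)

/-- The labelled transition relation `P --γ--> Q`. -/
def Step (P : Expr A) (γ : Act A) (Q : Expr A) : Prop :=
  match γ with
  | .std α => PStep P α Q
  | .delta => DStep P Q

/-- Reachability by finitely many transitions. -/
def Reach : Expr A → Expr A → Prop :=
  Relation.ReflTransGen fun P Q => ∃ γ, Step P γ Q

/-- Every state reachable from `P` has at most one outgoing `δ` transition. -/
def TimeDeterministic (P : Expr A) : Prop :=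
  ∀ R, Reach P R → ∀ R₁ R₂, Step R .delta R₁ → Step R .delta R₂ → R₁ = R₂

/-! ### Equivalences -/

/-- Possibly empty sequences of `τ` transitions. -/
def TauStar : Expr A → Expr A → Prop :=
  Relation.ReflTransGen fun P Q => Step P Act.tau Q

/-- The weak transition `τ* γ τ*`. -/
def Weak (P : Expr A) (γ : Act A) (Q : Expr A) : Prop :=
  ∃ P₁ P₂, TauStar P P₁ ∧ Step P₁ γ P₂ ∧ TauStar P₂ Q

/-- `τ* γ τ*` if `γ ≠ τ`, and `τ*` if `γ = τ`. -/
def WeakHat (P : Expr A) (γ : Act A) (Q : Expr A) : Prop :=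
  (γ ≠ Act.tau ∧ Weak P γ Q) ∨ (γ = Act.tau ∧ TauStar P Q)

/-- Weak bisimulations. -/
def IsWeakBisim (β : Expr A → Expr A → Prop) : Prop :=
  ∀ P Q, β P Q →
    (∀ γ P₁, Step P γ P₁ → ∃ Q₁, WeakHat Q γ Q₁ ∧ β P₁ Q₁) ∧
    (∀ γ Q₁, Step Q γ Q₁ → ∃ P₁, WeakHat P γ P₁ ∧ β P₁ Q₁)

/-- Weak bisimilarity `P ≈ Q`. -/
def WeakBisimilar (P Q : Expr A) : Prop :=
  ∃ β : Expr A → Expr A → Prop, IsWeakBisim β ∧ β P Q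

/-- Rooted time weak bisimulations: the root can be left by prioritized actions only. -/
def IsRootedTimeWeakBisim (β : Expr A → Expr A → Prop) : Prop :=
  ∀ P Q, β P Q →
    (∀ (α : PAct A) P₁, Step P (.std α) P₁ → ∃ Q₁, Weak Q (.std α) Q₁ ∧ WeakBisimilar P₁ Q₁) ∧
    (∀ P₁, Step P .delta P₁ → ∃ Q₁, Step Q .delta Q₁ ∧ β P₁ Q₁) ∧
    (∀ (α : PAct A) Q₁, Step Q (.std α) Q₁ → ∃ P₁, Weak P (.std α) P₁ ∧ WeakBisimilar P₁ Q₁) ∧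
    (∀ Q₁, Step Q .delta Q₁ → ∃ P₁, Step P .delta P₁ ∧ β P₁ Q₁)

/-- Time observational congruence `P ≃_T Q` of processes. -/
def TimeCongruent (P Q : Expr A) : Prop :=
  ∃ β : Expr A → Expr A → Prop, IsRootedTimeWeakBisim β ∧ β P Q

/-! ### The axiom system -/

/-- `Provable E F` is `𝒜_DT ⊢ E = F`: equational reasoning (equivalence and congruence with respect
to all operators, including recursion) from the axioms, for all expressions of the extended
calculus. -/
inductive Provable : Expr A → Expr A → Prop
  -- equivalence
  | refl (E : Expr A) : Provable E E
  | symm {E F : Expr A} : Provable E F → Provable F E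
  | trans {E F G : Expr A} : Provable E F → Provable F G → Provable E G
  -- congruence
  | tpre_congr (γ : Act A) {E F : Expr A} : Provable E F → Provable (tpre γ E) (tpre γ F)
  | tplus_congr {E F G H : Expr A} :
      Provable E F → Provable G H → Provable (tplus E G) (tplus F H)
  | hide_congr (L : Set A) {E F : Expr A} : Provable E F → Provable (hide L E) (hide L F)
  | par_congr (S : Set A) {E F G H : Expr A} :
      Provable E F → Provable G H → Provable (par S E G) (par S F H)
  | mu_congr {E F : Expr A} : Provable E F → Provable (mu E) (mu F)
  | pre_congr (γ : Act A) {E F : Expr A} : Provable E F → Provable (pre γ E) (pre γ F)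
  | plus_congr {E F G H : Expr A} :
      Provable E F → Provable G H → Provable (plus E G) (plus F H)
  | pri_congr {E F : Expr A} : Provable E F → Provable (pri E) (pri F)
  | vis_congr {E F : Expr A} : Provable E F → Provable (vis E) (vis F)
  | lmerge_congr (S : Set A) {E F G H : Expr A} :
      Provable E F → Provable G H → Provable (lmerge S E G) (lmerge S F H)
  | smerge_congr (S : Set A) {E F G H : Expr A} :
      Provable E F → Provable G H → Provable (smerge S E G) (smerge S F H)
  -- choice
  | A1 (E F : Expr A) : Provable (plus E F) (plus F E)
  | A2 (E F G : Expr A) : Provable (plus (plus E F) G) (plus E (plus F G))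
  | A3 (E : Expr A) : Provable (plus E E) E
  | A4 (E : Expr A) : Provable (plus E nil) E
  -- silent actions
  | Tau1 (α : PAct A) (E : Expr A) : Provable (pre (.std α) (pre .tau E)) (pre (.std α) E)
  | Tau2 (E : Expr A) : Provable (plus E (pre .tau E)) (pre .tau E)
  | Tau3 (α : PAct A) (E F : Expr A) :
      Provable (plus (pre (.std α) (plus E (pre .tau F))) (pre (.std α) F))
        (pre (.std α) (plus E (pre .tau F)))
  | Tau4 (α : PAct A) (E F : Expr A) : Serial 0 F →
      Provable (pre (.std α) (inst F (pre .delta (pre .tau E))))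
        (pre (.std α) (inst F (pre .delta E)))
  -- priority
  | Pri1 : Provable (pri nil) nil
  | Pri2 (α : PAct A) (E : Expr A) : Provable (pri (pre (.std α) E)) (pre (.std α) E)
  | Pri3 (E : Expr A) : Provable (pri (pre .delta E)) nil
  | Pri4 (E F : Expr A) : Provable (pri (plus E F)) (plus (pri E) (pri F))
  | Pri5 (E : Expr A) : Provable (pri (pri E)) (pri E)
  | Pri6 (E F : Expr A) : Provable (plus (pre .tau E) F) (plus (pre .tau E) (pri F))
  -- recursion
  | Rec1 (E : Expr A) : Provable (mu E) (inst E (mu E))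
  | Rec2 {E F : Expr A} :
      Serial 0 E → Guarded 0 E → Provable F (inst E F) → Provable F (mu E)
  -- unguarded recursion
  | Ung1 (E : Expr A) : Provable (mu (plus (var 0) E)) (mu E)
  | Ung2 (E : Expr A) : Provable (mu (plus (pre .tau (var 0)) E)) (mu (pre .tau (pri E)))
  | Ung3 (E F : Expr A) :
      Provable (mu (plus (pre .tau (plus (var 0) E)) F))
        (mu (plus (plus (pre .tau (var 0)) E) F))
  | Ung4 (E F : Expr A) :
      Provable (mu (plus (pre .tau (plus (pri (var 0)) E)) F))
        (mu (plus (plus (pre .tau (var 0)) E) F))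
  -- timed operators
  | Ter : Provable tnil (mu (pre .delta (var 0)))
  | TPre1 (α : PAct A) (E : Expr A) :
      Provable (tpre (.std α) E) (mu (plus (pre .delta (var 0)) (pre (.std α) (shift E))))
  | TPre2 (E : Expr A) : Provable (tpre .delta E) (pre .delta E)
  | TCh1 (E F : Expr A) : Provable (tplus E F) (tplus F E)
  | TCh2 (E F G : Expr A) : Provable (tplus (tplus E F) G) (tplus E (tplus F G))
  | TCh3 (E : Expr A) : Provable (tplus E tnil) E
  | TCh4 (E F : Expr A) : Provable (pri (tplus E F)) (plus (pri E) (pri F))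
  | TCh5 (E F : Expr A) : Provable (tplus (pri E) F) (plus (pri E) (pri F))
  | TCh6 (E F : Expr A) :
      Provable (tplus (pre .delta E) (pre .delta F)) (pre .delta (tplus E F))
  | TCh7 (E F G : Expr A) :
      Provable (tplus (plus E F) G) (plus (tplus E G) (tplus F G))
  -- hiding
  | Hi1 (L : Set A) : Provable (hide L nil) nil
  | Hi2 (L : Set A) (γ : Act A) (E : Expr A) : ¬ γ.mem L →
      Provable (hide L (pre γ E)) (pre γ (hide L E))
  | Hi3 (L : Set A) (a : A) (E : Expr A) : a ∈ L →
      Provable (hide L (pre (.std (.vis a)) E)) (pre .tau (hide L E))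
  | Hi4 (L : Set A) (E F : Expr A) :
      Provable (hide L (plus E F)) (plus (hide L E) (hide L F))
  | RecHi (L : Set A) (E : Expr A) : Serial 0 E →
      Provable (hide L (mu E)) (mu (hide L E))
  -- the operator `vis`
  | Vis1 : Provable (vis nil) nil
  | Vis2 (a : A) (E : Expr A) :
      Provable (vis (pre (.std (.vis a)) E)) (pre (.std (.vis a)) E)
  | Vis3 (E F : Expr A) : Provable (vis (plus E F)) (plus (vis E) (vis F))
  -- parallel composition and merges
  | Par (S : Set A) (E F : Expr A) :
      Provable (par S E F) (plus (plus (lmerge S E F) (lmerge S F E)) (smerge S E F))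
  | LM1 (S : Set A) (E : Expr A) : Provable (lmerge S nil E) nil
  | LM2 (S : Set A) (γ : Act A) (E F : Expr A) : (γ.mem S ∨ γ = .delta) →
      Provable (lmerge S (pre γ E) F) nil
  | LM3 (S : Set A) (α : PAct A) (E F : Expr A) : ¬ α.mem S →
      Provable (lmerge S (pre (.std α) E) F) (pre (.std α) (par S E F))
  | LM4 (S : Set A) (E F G : Expr A) :
      Provable (lmerge S (plus E F) G) (plus (lmerge S E G) (lmerge S F G))
  | SM1 (S : Set A) (E F : Expr A) : Provable (smerge S E F) (smerge S F E)
  | SM2 (S : Set A) (E : Expr A) : Provable (smerge S nil E) nil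
  | SM3 (S : Set A) (γ γ₁ : Act A) (E F : Expr A) :
      (¬ (γ.mem S ∨ γ = .delta) ∨ γ ≠ γ₁) → γ ≠ .tau → γ₁ ≠ .tau →
      Provable (smerge S (pre γ E) (pre γ₁ F)) nil
  | SM4 (S : Set A) (E F : Expr A) :
      Provable (smerge S (pre .tau E) F) (pri (smerge S E F))
  | SM5 (S : Set A) (γ : Act A) (E F : Expr A) : (γ.mem S ∨ γ = .delta) →
      Provable (smerge S (pre γ E) (pre γ F)) (pre γ (par S E F))
  | SM6 (S : Set A) (E F G : Expr A) :
      Provable (smerge S (plus (pri E) (pri F)) G)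
        (plus (smerge S (pri E) G) (smerge S (pri F) G))
  | SM7 (S : Set A) (E F G : Expr A) :
      Provable (smerge S (plus (pre .delta E) (vis F)) G)
        (plus (smerge S (pre .delta E) G) (smerge S (vis F) G))

end DTCalc

/-! The proof is completeness by canonical forms. A basic process has finitely many derivatives.
Each bisimilarity class of these states receives one canonical expression, a component of a solution
of a finite system of equations, and every process is shown provably equal to the canonical
expression of its class. Congruent processes share that expression.

Time-determinism enters only in the semantic part. For such processes weak bisimilarity coincides on
the matching of time with the stricter `StrictBisim`, in which a time step is answered by τ* δ with
no silent steps afterwards (`WeakBisimilar.delta_strict`). Hence congruent processes are related by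
`RootedBisim`, and the rest of the argument needs no determinism.

Two families of canonical expressions are used: `K` for strict bisimilarity, without silent steps
inside a class, and `R` for rooted bisimilarity, where time steps stay in the rooted world and
prioritized steps lead to `K`. Their link is that `α.R x = α.K x` is derivable
(`IsRootedCanonical.pre_eq`): `τ.R` and `τ.K` solve the same guarded system once `Tau4` has inserted
a τ after each δ.

The equation between `E` and `R E` is proved by structural induction on open expressions whose
variables stand for states (`IsRootedCanonical.provable`). For a recursion, `R` of the process is
shown to solve the equation of a guarded body, and `Rec2` concludes. If the variable is exposed only
at the top, `Ung1` produces that body. If it is exposed after silent steps, the whole silent loop is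
collapsed to τ followed by the sum of the exits of the loop (`provable_mu_of_loop`). Time steps on
the loop disappear by maximal progress, and other variables survive only under `pri`. Nested
recursions may put further silent cycles on such a loop; `Resolved` records that they have already
been collapsed, and `Resolved.of_isBasic` gives this for all basic expressions. -/

namespace DTCalc

open _root_.DTCalc.Expr

variable {A : Type u}

/-! ### Substitution calculus -/

namespace Expr

/-- The substitution sending the variable `0` to `F` and `i + 1` to `σ i`. -/
def scons (F : Expr A) (σ : ℕ → Expr A) : ℕ → Expr A
  | 0 => F
  | i + 1 => σ i

@[simp] theorem scons_zero (F : Expr A) (σ : ℕ → Expr A) : scons F σ 0 = F := rfl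

@[simp] theorem scons_succ (F : Expr A) (σ : ℕ → Expr A) (i : ℕ) :
    scons F σ (i + 1) = σ i := rfl

theorem single_eq_scons (F : Expr A) : single F = scons F var := by
  funext i; cases i <;> rfl

theorem upRen_comp (ρ ρ' : ℕ → ℕ) : upRen ρ ∘ upRen ρ' = upRen (ρ ∘ ρ') := by
  funext i; cases i <;> rfl

theorem rename_rename (ρ ρ' : ℕ → ℕ) (E : Expr A) :
    rename ρ (rename ρ' E) = rename (ρ ∘ ρ') E := by
  induction E generalizing ρ ρ' <;> simp_all [rename, upRen_comp]

theorem upSub_comp_upRen (σ : ℕ → Expr A) (ρ : ℕ → ℕ) :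
    upSub σ ∘ upRen ρ = upSub (σ ∘ ρ) := by
  funext i; cases i <;> rfl

theorem subst_rename (σ : ℕ → Expr A) (ρ : ℕ → ℕ) (E : Expr A) :
    subst σ (rename ρ E) = subst (σ ∘ ρ) E := by
  induction E generalizing σ ρ <;> simp_all [rename, subst, upSub_comp_upRen]

theorem rename_comp_upSub (ρ : ℕ → ℕ) (σ : ℕ → Expr A) :
    rename (upRen ρ) ∘ upSub σ = upSub (rename ρ ∘ σ) := by
  funext i
  cases i with
  | zero => rfl
  | succ i => simp only [Function.comp, upSub, shift, rename_rename]; rfl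

theorem rename_subst (ρ : ℕ → ℕ) (σ : ℕ → Expr A) (E : Expr A) :
    rename ρ (subst σ E) = subst (rename ρ ∘ σ) E := by
  induction E generalizing σ ρ <;> simp_all [rename, subst, rename_comp_upSub]

theorem subst_shift (σ : ℕ → Expr A) (E : Expr A) :
    subst (upSub σ) (shift E) = shift (subst σ E) := by
  simp only [shift, subst_rename, rename_subst]; rfl

theorem upSub_comp (σ σ' : ℕ → Expr A) :
    (fun i => subst (upSub σ) (upSub σ' i)) = upSub (fun i => subst σ (σ' i)) := by
  funext i
  cases i with
  | zero => rfl
  | succ i => exact subst_shift σ (σ' i)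

theorem subst_subst (σ σ' : ℕ → Expr A) (E : Expr A) :
    subst σ (subst σ' E) = subst (fun i => subst σ (σ' i)) E := by
  induction E generalizing σ σ' <;> simp_all [subst, upSub_comp]

theorem upSub_var : upSub (var : ℕ → Expr A) = var := by
  funext i; cases i <;> rfl

@[simp] theorem subst_var (E : Expr A) : subst var E = E := by
  induction E <;> simp_all [subst, upSub_var]

theorem upSub_var_comp (ρ : ℕ → ℕ) :
    upSub (fun i => (var (ρ i) : Expr A)) = fun i => var (upRen ρ i) := by
  funext i; cases i <;> rfl

theorem rename_eq_subst (ρ : ℕ → ℕ) (E : Expr A) :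
    rename ρ E = subst (fun i => var (ρ i)) E := by
  induction E generalizing ρ <;> simp_all [rename, subst, upSub_var_comp]

@[simp] theorem subst_scons_shift (F : Expr A) (σ : ℕ → Expr A) (E : Expr A) :
    subst (scons F σ) (shift E) = subst σ E := by
  rw [shift, subst_rename]; rfl

@[simp] theorem inst_shift (E F : Expr A) : inst (shift E) F = E := by
  rw [inst, single_eq_scons, subst_scons_shift, subst_var]

theorem subst_inst (σ : ℕ → Expr A) (E F : Expr A) :
    subst σ (inst E F) = subst (scons (subst σ F) σ) E := by
  rw [inst, subst_subst]
  congr 1; funext i; cases i <;> rfl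

theorem inst_subst_upSub (σ : ℕ → Expr A) (E F : Expr A) :
    inst (subst (upSub σ) E) F = subst (scons F σ) E := by
  rw [inst, single_eq_scons, subst_subst]
  congr 1; funext i
  cases i with
  | zero => rfl
  | succ i => simp [upSub]

theorem subst_inst' (σ : ℕ → Expr A) (E F : Expr A) :
    subst σ (inst E F) = inst (subst (upSub σ) E) (subst σ F) := by
  rw [subst_inst, inst_subst_upSub]

theorem subst_congr_occurs {σ σ' : ℕ → Expr A} {E : Expr A}
    (h : ∀ k, Occurs k E → σ k = σ' k) : subst σ E = subst σ' E := by
  induction E generalizing σ σ' with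
  | mu E ih =>
    simp only [subst]; congr 1
    apply ih
    intro k hk
    cases k with
    | zero => rfl
    | succ k => simp only [upSub]; rw [h k hk]
  | var i => exact h i rfl
  | nil => rfl
  | tnil => rfl
  | tplus E F ihE ihF =>
    simp only [subst]; rw [ihE fun k hk => h k (.inl hk), ihF fun k hk => h k (.inr hk)]
  | par S E F ihE ihF =>
    simp only [subst]; rw [ihE fun k hk => h k (.inl hk), ihF fun k hk => h k (.inr hk)]
  | plus E F ihE ihF =>
    simp only [subst]; rw [ihE fun k hk => h k (.inl hk), ihF fun k hk => h k (.inr hk)]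
  | lmerge S E F ihE ihF =>
    simp only [subst]; rw [ihE fun k hk => h k (.inl hk), ihF fun k hk => h k (.inr hk)]
  | smerge S E F ihE ihF =>
    simp only [subst]; rw [ihE fun k hk => h k (.inl hk), ihF fun k hk => h k (.inr hk)]
  | tpre γ E ih => simp only [subst]; rw [ih h]
  | hide L E ih => simp only [subst]; rw [ih h]
  | pre γ E ih => simp only [subst]; rw [ih h]
  | pri E ih => simp only [subst]; rw [ih h]
  | vis E ih => simp only [subst]; rw [ih h]

theorem Closed.subst_eq {E : Expr A} (h : Closed E) (σ : ℕ → Expr A) : subst σ E = E := by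
  rw [subst_congr_occurs (σ' := var) fun k hk => (h k hk).elim, subst_var]

/-! ### Occurrence, seriality and guardedness under renaming and substitution. -/

theorem occurs_rename {ρ : ℕ → ℕ} {E : Expr A} {j : ℕ} :
    Occurs j (rename ρ E) → ∃ k, Occurs k E ∧ j = ρ k := by
  induction E generalizing ρ j with
  | mu E ih =>
    intro h
    obtain ⟨k, hk, e⟩ := ih (ρ := upRen ρ) (j := j + 1) h
    cases k with
    | zero => simp [upRen] at e
    | succ k => exact ⟨k, hk, by simpa [upRen] using e⟩
  | var i => intro h; exact ⟨i, rfl, h⟩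
  | _ => simp only [rename, Occurs] at *; grind

theorem occurs_subst {σ : ℕ → Expr A} {E : Expr A} {j : ℕ} :
    Occurs j (subst σ E) → ∃ k, Occurs k E ∧ Occurs j (σ k) := by
  induction E generalizing σ j with
  | mu E ih =>
    intro h
    obtain ⟨k, hk, e⟩ := ih (σ := upSub σ) (j := j + 1) h
    cases k with
    | zero => simp [upSub, Occurs] at e
    | succ k =>
      obtain ⟨i, hi, e⟩ := occurs_rename (show Occurs (j + 1) (shift (σ k)) from e)
      cases e
      exact ⟨k, hk, hi⟩
  | var i => intro h; exact ⟨i, rfl, h⟩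
  | _ => simp only [subst, Occurs] at *; grind

theorem not_occurs_zero_shift (E : Expr A) : ¬ Occurs 0 (shift E) := by
  intro h
  obtain ⟨k, _, e⟩ := occurs_rename h
  cases e

theorem Serial.of_not_occurs {E : Expr A} {i : ℕ} (h : ¬ Occurs i E) : Serial i E := by
  induction E generalizing i with
  | mu E ih => exact ih h
  | var j => trivial
  | pre γ E ih => exact ih h
  | plus E F ihE ihF => exact ⟨ihE fun h' => h (.inl h'), ihF fun h' => h (.inr h')⟩
  | _ => simpa only [Serial] using h

theorem Guarded.of_not_occurs {E : Expr A} {i : ℕ} (h : ¬ Occurs i E) : Guarded i E := by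
  induction E generalizing i <;> simp only [Guarded, Occurs] at * <;> grind

theorem Serial.rename {ρ : ℕ → ℕ} (hρ : ∀ a b, ρ a = ρ b → a = b) {E : Expr A} {i : ℕ}
    (h : Serial i E) : Serial (ρ i) (rename ρ E) := by
  induction E generalizing ρ i with
  | mu E ih =>
    apply ih (ρ := upRen ρ) (i := i + 1) _ h
    intro a b; cases a <;> cases b <;> simp [upRen]; exact hρ _ _
  | var j => trivial
  | pre γ E ih => exact ih hρ h
  | plus E F ihE ihF => exact ⟨ihE hρ h.1, ihF hρ h.2⟩
  | _ =>
    apply Serial.of_not_occurs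
    intro ho
    obtain ⟨k, hk, e⟩ := occurs_rename ho
    rw [hρ _ _ e] at h
    exact h hk

theorem Serial.subst {σ : ℕ → Expr A} {E : Expr A} {j : ℕ}
    (h : ∀ k, Occurs j (σ k) → Serial k E ∧ Serial j (σ k)) : Serial j (subst σ E) := by
  induction E generalizing σ j with
  | mu E ih =>
    apply ih (σ := upSub σ) (j := j + 1)
    intro k hk
    cases k with
    | zero => simp [upSub, Occurs] at hk
    | succ k =>
      obtain ⟨i, hi, e⟩ := occurs_rename (show Occurs (j + 1) (shift (σ k)) from hk)
      cases e
      exact ⟨(h k hi).1, Serial.rename (fun a b h => Nat.succ.inj h) (h k hi).2⟩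
  | var i =>
    by_cases ho : Occurs j (σ i)
    · exact (h i ho).2
    · exact Serial.of_not_occurs ho
  | pre γ E ih => exact ih (fun k hk => h k hk)
  | plus E F ihE ihF =>
    exact ⟨ihE (fun k hk => ⟨(h k hk).1.1, (h k hk).2⟩),
      ihF (fun k hk => ⟨(h k hk).1.2, (h k hk).2⟩)⟩
  | _ =>
    apply Serial.of_not_occurs
    intro ho
    obtain ⟨k, hk, ho⟩ := occurs_subst ho
    exact (h k ho).1 hk

theorem Guarded.rename {ρ : ℕ → ℕ} {E : Expr A} {j : ℕ} (h : ∀ k, ρ k = j → Guarded k E) :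
    Guarded j (rename ρ E) := by
  induction E generalizing ρ j with
  | mu E ih =>
    apply ih (ρ := upRen ρ) (j := j + 1)
    intro k hk
    cases k with
    | zero => cases hk
    | succ k => exact h k (by simpa [upRen] using hk)
  | var i => intro e; exact h i e.symm rfl
  | tpre γ E ih =>
    by_cases hγ : γ = Act.tau
    · exact .inr (ih fun k hk => (h k hk).resolve_left (fun h' => h' hγ))
    · exact .inl hγ
  | pre γ E ih =>
    by_cases hγ : γ = Act.tau
    · exact .inr (ih fun k hk => (h k hk).resolve_left (fun h' => h' hγ))
    · exact .inl hγ
  | _ => simp only [Expr.rename, Guarded] at * <;> grind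

theorem Guarded.subst {σ : ℕ → Expr A} {E : Expr A} {j : ℕ}
    (h : ∀ k, ¬ Guarded j (σ k) → Guarded k E) : Guarded j (subst σ E) := by
  induction E generalizing σ j with
  | mu E ih =>
    apply ih (σ := upSub σ) (j := j + 1)
    intro k hk
    cases k with
    | zero => simp [upSub, Guarded] at hk
    | succ k =>
      apply h k
      intro hg
      apply hk
      apply Guarded.rename
      intro i hi
      cases hi
      exact hg
  | var i =>
    by_contra hg
    exact h i hg rfl
  | tpre γ E ih =>
    by_cases hγ : γ = Act.tau
    · exact .inr (ih fun k hk => (h k hk).resolve_left (fun h' => h' hγ))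
    · exact .inl hγ
  | pre γ E ih =>
    by_cases hγ : γ = Act.tau
    · exact .inr (ih fun k hk => (h k hk).resolve_left (fun h' => h' hγ))
    · exact .inl hγ
  | _ => simp only [Expr.subst, Guarded] at * <;> grind

theorem Serial.subst_upSub {E : Expr A} (h : Serial 0 E) (σ : ℕ → Expr A) :
    Serial 0 (Expr.subst (upSub σ) E) := by
  apply Serial.subst
  intro k hk
  cases k with
  | zero => exact ⟨h, trivial⟩
  | succ k => exact (not_occurs_zero_shift _ hk).elim

theorem Guarded.subst_upSub {E : Expr A} (h : Guarded 0 E) (σ : ℕ → Expr A) :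
    Guarded 0 (Expr.subst (upSub σ) E) := by
  apply Guarded.subst
  intro k hk
  cases k with
  | zero => exact h
  | succ k => exact (hk (Guarded.of_not_occurs (not_occurs_zero_shift _))).elim

end Expr

/-! ### Substitution in derivations -/

/-- The axioms are schematic, so only binders and side conditions need care: `Serial` and `Guarded`
for the bound variable survive because a substitution pushed under a binder never introduces that
variable. The lemma lets equations between open bodies be instantiated by canonical expressions. -/
theorem Provable.subst {E F : Expr A} (h : Provable E F) (σ : ℕ → Expr A) :
    Provable (Expr.subst σ E) (Expr.subst σ F) := by
  induction h generalizing σ with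
  | refl => exact .refl _
  | symm _ ih => exact (ih σ).symm
  | trans _ _ ih₁ ih₂ => exact (ih₁ σ).trans (ih₂ σ)
  | tpre_congr γ _ ih => exact .tpre_congr γ (ih σ)
  | tplus_congr _ _ ih₁ ih₂ => exact .tplus_congr (ih₁ σ) (ih₂ σ)
  | hide_congr L _ ih => exact .hide_congr L (ih σ)
  | par_congr S _ _ ih₁ ih₂ => exact .par_congr S (ih₁ σ) (ih₂ σ)
  | mu_congr _ ih => exact .mu_congr (ih (upSub σ))
  | pre_congr γ _ ih => exact .pre_congr γ (ih σ)
  | plus_congr _ _ ih₁ ih₂ => exact .plus_congr (ih₁ σ) (ih₂ σ)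
  | pri_congr _ ih => exact .pri_congr (ih σ)
  | vis_congr _ ih => exact .vis_congr (ih σ)
  | lmerge_congr S _ _ ih₁ ih₂ => exact .lmerge_congr S (ih₁ σ) (ih₂ σ)
  | smerge_congr S _ _ ih₁ ih₂ => exact .smerge_congr S (ih₁ σ) (ih₂ σ)
  | Tau4 α E F hF =>
    simp only [Expr.subst, subst_inst']
    exact .Tau4 α _ _ (hF.subst_upSub σ)
  | Rec1 E => rw [subst_inst']; exact .Rec1 _
  | Rec2 hs hg _ ih =>
    apply Provable.Rec2 (hs.subst_upSub σ) (hg.subst_upSub σ)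
    rw [← subst_inst']; exact ih σ
  | TPre1 α E =>
    simp only [Expr.subst, subst_shift]
    exact .TPre1 α _
  | RecHi L E hE => exact .RecHi L _ (hE.subst_upSub σ)
  | Hi2 L γ E h => exact .Hi2 L γ _ h
  | Hi3 L γ E h => exact .Hi3 L γ _ h
  | LM2 S γ E F h => exact .LM2 S γ _ _ h
  | LM3 S γ E F h => exact .LM3 S γ _ _ h
  | SM3 S γ γ₁ E F h h₁ h₂ => exact .SM3 S γ γ₁ _ _ h h₁ h₂
  | SM5 S γ E F h => exact .SM5 S γ _ _ h
  | _ =>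
    first
      | apply Provable.A1 | apply Provable.A2 | apply Provable.A3 | apply Provable.A4
      | apply Provable.Tau1 | apply Provable.Tau2 | apply Provable.Tau3 | apply Provable.Pri1
      | apply Provable.Pri2 | apply Provable.Pri3 | apply Provable.Pri4 | apply Provable.Pri5
      | apply Provable.Pri6 | apply Provable.Ung1 | apply Provable.Ung2 | apply Provable.Ung3
      | apply Provable.Ung4 | apply Provable.Ter | apply Provable.TPre2 | apply Provable.TCh1
      | apply Provable.TCh2 | apply Provable.TCh3 | apply Provable.TCh4 | apply Provable.TCh5
      | apply Provable.TCh6 | apply Provable.TCh7 | apply Provable.Hi1 | apply Provable.Hi4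
      | apply Provable.Vis1 | apply Provable.Vis2 | apply Provable.Vis3 | apply Provable.Par
      | apply Provable.LM1 | apply Provable.LM4 | apply Provable.SM1 | apply Provable.SM2
      | apply Provable.SM4 | apply Provable.SM6 | apply Provable.SM7

theorem Provable.shift {E F : Expr A} (h : Provable E F) : Provable (shift E) (shift F) := by
  simp only [Expr.shift, rename_eq_subst]; exact h.subst _

theorem Provable.subst_congr {σ σ' : ℕ → Expr A} (h : ∀ k, Provable (σ k) (σ' k)) (E : Expr A) :
    Provable (Expr.subst σ E) (Expr.subst σ' E) := by
  induction E generalizing σ σ' with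
  | nil => exact .refl _
  | tnil => exact .refl _
  | var i => exact h i
  | tpre γ _ ih => exact .tpre_congr γ (ih h)
  | tplus _ _ ih₁ ih₂ => exact .tplus_congr (ih₁ h) (ih₂ h)
  | hide L _ ih => exact .hide_congr L (ih h)
  | par S _ _ ih₁ ih₂ => exact .par_congr S (ih₁ h) (ih₂ h)
  | mu _ ih =>
    refine .mu_congr (ih fun k => ?_)
    cases k with
    | zero => exact .refl _
    | succ k => exact (h k).shift
  | pre γ _ ih => exact .pre_congr γ (ih h)
  | plus _ _ ih₁ ih₂ => exact .plus_congr (ih₁ h) (ih₂ h)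
  | pri _ ih => exact .pri_congr (ih h)
  | vis _ ih => exact .vis_congr (ih h)
  | lmerge S _ _ ih₁ ih₂ => exact .lmerge_congr S (ih₁ h) (ih₂ h)
  | smerge S _ _ ih₁ ih₂ => exact .smerge_congr S (ih₁ h) (ih₂ h)

theorem Provable.inst_congr {F F' : Expr A} (h : Provable F F') (E : Expr A) :
    Provable (inst E F) (inst E F') := by
  apply Provable.subst_congr
  intro k
  cases k with
  | zero => exact h
  | succ k => exact .refl _

/-! ### Absorption -/

/-- `E` is provably absorbed by `F` as a summand. -/
def Below (E F : Expr A) : Prop := Provable (plus F E) F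

namespace Below

theorem refl (E : Expr A) : Below E E := .A3 E

theorem trans {E F G : Expr A} (h : Below E F) (h' : Below F G) : Below E G :=
  have e : Provable (plus G E) (plus (plus G F) E) := .plus_congr h'.symm (.refl E)
  e.trans ((Provable.A2 G F E).trans ((Provable.plus_congr (.refl G) h).trans h'))

/-- `Below` is thus an order modulo provable equality; equations between sums are proved by two
inclusions, summand by summand. -/
theorem antisymm {E F : Expr A} (h : Below E F) (h' : Below F E) : Provable E F :=
  h'.symm.trans ((Provable.A1 E F).trans h)

theorem of_provable {E F : Expr A} (h : Provable E F) : Below E F :=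
  (Provable.plus_congr (.refl F) h).trans (.A3 F)

theorem nil (F : Expr A) : Below nil F := .A4 F

theorem plus {E E' F : Expr A} (h : Below E F) (h' : Below E' F) : Below (plus E E') F :=
  (Provable.A2 F E E').symm.trans ((Provable.plus_congr h (.refl E')).trans h')

theorem left (E F : Expr A) : Below E (Expr.plus E F) :=
  (Provable.A1 _ _).trans ((Provable.A2 E E F).symm.trans (.plus_congr (.A3 E) (.refl F)))

theorem right (E F : Expr A) : Below F (Expr.plus E F) :=
  (Provable.A2 E F F).trans (.plus_congr (.refl E) (.A3 F))

theorem subst {E F : Expr A} (h : Below E F) (σ : ℕ → Expr A) :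
    Below (Expr.subst σ E) (Expr.subst σ F) := Provable.subst h σ

theorem tau (E : Expr A) : Below E (pre .tau E) := (Provable.A1 _ _).trans (.Tau2 E)

/-- This is `Tau3` in order form, applied after the summand `τ.F` has been made explicit in `E`. -/
theorem pre_std {E F : Expr A} (h : Below (pre .tau F) E) (α : PAct A) :
    Below (pre (.std α) F) (pre (.std α) E) :=
  have e : Provable (pre (.std α) E) (pre (.std α) (Expr.plus E (pre .tau F))) :=
    .pre_congr _ h.symm
  (Provable.plus_congr e (.refl _)).trans ((Provable.Tau3 α E F).trans e.symm)

/-- Maximal progress in the axioms: beside a silent prefix `Pri6` puts the time prefix under `pri`,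
where `Pri3` erases it. -/
theorem delta_tau (E G : Expr A) : Below (pre .delta G) (pre .tau E) :=
  (Provable.Pri6 _ _).trans ((Provable.plus_congr (.refl _) (.Pri3 G)).trans (.A4 _))

theorem delta {E F : Expr A} (h : Below (pre .tau E) F) (G : Expr A) :
    Below (pre .delta G) F := (delta_tau E G).trans h

/-- Beside a silent summand `Pri6` adds or removes `pri` freely. -/
theorem pri_iff_tau {E F G : Expr A} (h : Below (pre .tau E) F) :
    Below (pri G) F ↔ Below G F := by
  have e : ∀ H : Expr A, Provable (Expr.plus F H) (Expr.plus F (Expr.plus (pre .tau E) H)) :=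
    fun H => (Provable.plus_congr h.symm (.refl H)).trans (.A2 _ _ _)
  have e' : Provable (Expr.plus F G) (Expr.plus F (pri G)) :=
    (e G).trans ((Provable.plus_congr (.refl F) (.Pri6 E G)).trans (e (pri G)).symm)
  exact ⟨fun h' => e'.trans h', fun h' => e'.symm.trans h'⟩

end Below

/-- The sum of a list of expressions. -/
def sum (l : List (Expr A)) : Expr A := l.foldr plus nil

theorem sum_below {l : List (Expr A)} {F : Expr A} (h : ∀ E ∈ l, Below E F) :
    Below (sum l) F := by
  induction l with
  | nil => exact .nil F
  | cons E l ih => exact .plus (h E (by simp)) (ih fun E' hE' => h E' (by simp [hE']))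

theorem below_sum {l : List (Expr A)} {E : Expr A} (h : E ∈ l) : Below E (sum l) := by
  induction l with
  | nil => simp at h
  | cons E' l ih =>
    rcases List.mem_cons.1 h with rfl | h
    · exact .left _ _
    · exact (ih h).trans (.right _ _)

theorem subst_sum (σ : ℕ → Expr A) (l : List (Expr A)) :
    subst σ (sum l) = sum (l.map (subst σ)) := by
  induction l with
  | nil => rfl
  | cons E l ih => simpa [sum, subst] using ih

theorem sum_serial {l : List (Expr A)} {i : ℕ} (h : ∀ E ∈ l, Serial i E) : Serial i (sum l) := by
  induction l with
  | nil => exact id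
  | cons E l ih => exact ⟨h E (by simp), ih fun E' hE' => h E' (by simp [hE'])⟩

theorem sum_guarded {l : List (Expr A)} {i : ℕ} (h : ∀ E ∈ l, Guarded i E) :
    Guarded i (sum l) := by
  induction l with
  | nil => trivial
  | cons E l ih => exact ⟨h E (by simp), ih fun E' hE' => h E' (by simp [hE'])⟩

theorem occurs_sum {l : List (Expr A)} {i : ℕ} (h : Occurs i (sum l)) : ∃ E ∈ l, Occurs i E := by
  induction l with
  | nil => exact h.elim
  | cons E l ih =>
    rcases h with h | h
    · exact ⟨E, by simp, h⟩
    · obtain ⟨E', hE', h⟩ := ih h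
      exact ⟨E', by simp [hE'], h⟩

/-! ### Raw transitions and exposed variables of open expressions -/

/-- The transitions of a basic expression, without the restriction of maximal progress. -/
def outs : Expr A → List (Act A × Expr A)
  | pre γ E => [(γ, E)]
  | plus E F => outs E ++ outs F
  | mu E => (outs E).map fun o => (o.1, inst o.2 (mu E))
  | _ => []

/-- The variables that occur in a basic expression outside of all prefixes. -/
def exps : Expr A → List ℕ
  | var k => [k]
  | plus E F => exps E ++ exps F
  | mu E => (exps E).filterMap fun k => k.casesOn none some
  | _ => []

theorem mem_exps_mu {E : Expr A} {k : ℕ} : k ∈ exps (mu E) ↔ k + 1 ∈ exps E := by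
  simp only [exps, List.mem_filterMap]
  constructor
  · rintro ⟨_ | j, hj, e⟩
    · cases e
    · cases e; exact hj
  · exact fun h => ⟨k + 1, h, rfl⟩

theorem mem_outs_mu {E : Expr A} {γ : Act A} {G : Expr A} :
    (γ, G) ∈ outs (mu E) ↔ ∃ G₀, (γ, G₀) ∈ outs E ∧ G = inst G₀ (mu E) := by
  simp only [outs, List.mem_map, Prod.exists, Prod.mk.injEq]
  constructor
  · rintro ⟨_, G₀, h, rfl, rfl⟩; exact ⟨G₀, h, rfl⟩
  · rintro ⟨G₀, h, rfl⟩; exact ⟨_, G₀, h, rfl, rfl⟩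

theorem inst_rename (ρ : ℕ → ℕ) (E F : Expr A) :
    rename ρ (inst E F) = inst (rename (upRen ρ) E) (rename ρ F) := by
  have h : upSub (fun i => (var (ρ i) : Expr A)) = fun i => var (upRen ρ i) := upSub_var_comp ρ
  simp only [rename_eq_subst, subst_inst', h]

theorem outs_rename (ρ : ℕ → ℕ) (E : Expr A) :
    outs (rename ρ E) = (outs E).map fun o => (o.1, rename ρ o.2) := by
  induction E generalizing ρ with
  | mu E ih =>
    simp only [rename, outs, ih, List.map_map]
    apply List.map_congr_left
    intro o _
    simp [inst_rename, rename]
  | _ => simp_all [rename, outs]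

theorem exps_rename (ρ : ℕ → ℕ) (E : Expr A) (k : ℕ) :
    k ∈ exps (rename ρ E) ↔ ∃ j ∈ exps E, k = ρ j := by
  induction E generalizing ρ k with
  | mu E ih =>
    rw [rename, mem_exps_mu, ih]
    constructor
    · rintro ⟨_ | j, hj, e⟩
      · cases e
      · exact ⟨j, mem_exps_mu.2 hj, by simpa [upRen] using e⟩
    · rintro ⟨j, hj, rfl⟩
      exact ⟨j + 1, mem_exps_mu.1 hj, rfl⟩
  | plus E F ihE ihF => simp only [rename, exps, List.mem_append, ihE, ihF]; grind
  | _ => simp [rename, exps]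

theorem mem_exps_subst {σ : ℕ → Expr A} {E : Expr A} {k : ℕ} :
    k ∈ exps (subst σ E) ↔ ∃ j ∈ exps E, k ∈ exps (σ j) := by
  induction E generalizing σ k with
  | mu E ih =>
    rw [subst, mem_exps_mu, ih]
    constructor
    · rintro ⟨_ | j, hj, e⟩
      · simp [upSub, exps] at e
      · obtain ⟨i, hi, e⟩ := (exps_rename _ _ _).1 (show k + 1 ∈ exps (shift (σ j)) from e)
        cases e
        exact ⟨j, mem_exps_mu.2 hj, hi⟩
    · rintro ⟨j, hj, h⟩
      exact ⟨j + 1, mem_exps_mu.1 hj, (exps_rename _ _ _).2 ⟨k, h, rfl⟩⟩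
  | plus E F ihE ihF => simp only [subst, exps, List.mem_append, ihE, ihF]; grind
  | var i => simp [subst, exps]
  | _ => simp [subst, exps]

theorem mem_outs_subst {σ : ℕ → Expr A} {E : Expr A} {γ : Act A} {G : Expr A} :
    (γ, G) ∈ outs (subst σ E) ↔
      (∃ G₀, (γ, G₀) ∈ outs E ∧ G = subst σ G₀) ∨ ∃ k ∈ exps E, (γ, G) ∈ outs (σ k) := by
  induction E generalizing σ G with
  | mu E ih =>
    rw [subst, mem_outs_mu]
    simp only [ih, mem_outs_mu]
    constructor
    · rintro ⟨G₀, ⟨G₁, h, rfl⟩ | ⟨_ | k, hk, h⟩, rfl⟩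
      · exact .inl ⟨_, ⟨G₁, h, rfl⟩, by rw [subst_inst']; rfl⟩
      · simp [upSub, outs] at h
      · right
        refine ⟨k, mem_exps_mu.2 hk, ?_⟩
        simp only [upSub, shift, outs_rename, List.mem_map, Prod.mk.injEq] at h
        obtain ⟨⟨γ', G₂⟩, h, rfl, rfl⟩ := h
        rw [← shift, inst_shift]; exact h
    · rintro (⟨_, ⟨G₁, h, rfl⟩, rfl⟩ | ⟨k, hk, h⟩)
      · exact ⟨_, .inl ⟨G₁, h, rfl⟩, by rw [subst_inst']; rfl⟩
      · refine ⟨shift G, .inr ⟨k + 1, mem_exps_mu.1 hk, ?_⟩, by simp⟩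
        simp only [upSub, shift, outs_rename, List.mem_map, Prod.mk.injEq]
        exact ⟨(γ, G), h, rfl, rfl⟩
  | plus E F ihE ihF => simp only [subst, outs, exps, List.mem_append, ihE, ihF]; grind
  | var i => simp [subst, outs, exps]
  | pre γ' E ih => simp [subst, outs, exps]
  | _ => simp [subst, outs, exps]

theorem mem_outs_inst {E F : Expr A} {γ : Act A} {G : Expr A} :
    (γ, G) ∈ outs (inst E F) ↔
      (∃ G₀, (γ, G₀) ∈ outs E ∧ G = inst G₀ F) ∨ (0 ∈ exps E ∧ (γ, G) ∈ outs F) := by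
  rw [inst, mem_outs_subst]
  constructor
  · rintro (h | ⟨_ | k, hk, h⟩)
    · exact .inl h
    · exact .inr ⟨hk, h⟩
    · simp [single, outs] at h
  · rintro (h | ⟨h0, h⟩)
    · exact .inl h
    · exact .inr ⟨0, h0, h⟩

theorem mem_exps_inst_mu {E F : Expr A} {k : ℕ} :
    k ∈ exps (inst E (mu F)) ↔ k + 1 ∈ exps E ∨ (0 ∈ exps E ∧ k + 1 ∈ exps F) := by
  rw [inst, mem_exps_subst]
  constructor
  · rintro ⟨_ | j, hj, h⟩
    · exact .inr ⟨hj, mem_exps_mu.1 h⟩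
    · simp only [single, exps, List.mem_singleton] at h; exact .inl (h ▸ hj)
  · rintro (h | ⟨h0, h⟩)
    · exact ⟨k + 1, h, by simp [single, exps]⟩
    · exact ⟨0, h0, mem_exps_mu.2 h⟩

/-! ### Basic expressions and their normal form as sums. -/

theorem Expr.IsBasic.rename {E : Expr A} (h : IsBasic E) (ρ : ℕ → ℕ) : IsBasic (rename ρ E) := by
  induction E generalizing ρ with
  | mu E ih => exact ih h _
  | pre γ E ih => exact ih h _
  | plus E F ihE ihF => exact ⟨ihE h.1 _, ihF h.2 _⟩
  | _ => exact h

theorem Expr.IsBasic.subst {E : Expr A} (h : IsBasic E) {σ : ℕ → Expr A} (hσ : ∀ k, IsBasic (σ k)) :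
    IsBasic (subst σ E) := by
  induction E generalizing σ with
  | mu E ih =>
    apply ih h
    rintro (_ | k)
    · trivial
    · exact (hσ k).rename _
  | pre γ E ih => exact ih h hσ
  | plus E F ihE ihF => exact ⟨ihE h.1 hσ, ihF h.2 hσ⟩
  | var i => exact hσ i
  | _ => exact h

theorem Expr.IsBasic.inst {E F : Expr A} (h : IsBasic E) (h' : IsBasic F) : IsBasic (inst E F) := by
  apply h.subst
  rintro (_ | k)
  · exact h'
  · trivial

theorem Expr.IsBasic.serial {E : Expr A} (h : IsBasic E) (i : ℕ) : Serial i E := by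
  induction E generalizing i with
  | mu E ih => exact ih h _
  | pre γ E ih => exact ih h _
  | plus E F ihE ihF => exact ⟨ihE h.1 _, ihF h.2 _⟩
  | var j => trivial
  | _ => simp_all [IsBasic, Serial, Occurs]

theorem Expr.IsBasic.of_mem_outs {E : Expr A} (h : IsBasic E) {γ : Act A} {G : Expr A}
    (hG : (γ, G) ∈ outs E) : IsBasic G := by
  induction E generalizing G with
  | mu E ih =>
    obtain ⟨G₀, h₀, rfl⟩ := mem_outs_mu.1 hG
    exact (ih h h₀).inst h
  | pre γ E ih => simp only [outs, List.mem_singleton, Prod.mk.injEq] at hG; exact hG.2 ▸ h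
  | plus E F ihE ihF => exact (List.mem_append.1 hG).elim (ihE h.1) (ihF h.2)
  | _ => simp [outs] at hG

/-- The sum of the prefixed expressions in a list. -/
def preSum (l : List (Act A × Expr A)) : Expr A := sum (l.map fun o => pre o.1 o.2)

/-- The sum of the variables in a list. -/
def varSum (l : List ℕ) : Expr A := sum (l.map var)

theorem preSum_below {l : List (Act A × Expr A)} {F : Expr A}
    (h : ∀ γ G, (γ, G) ∈ l → Below (pre γ G) F) : Below (preSum l) F := by
  apply sum_below
  intro E hE
  obtain ⟨⟨γ, G⟩, ho, rfl⟩ := List.mem_map.1 hE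
  exact h _ _ ho

theorem below_preSum {l : List (Act A × Expr A)} {γ : Act A} {G : Expr A} (h : (γ, G) ∈ l) :
    Below (pre γ G) (preSum l) := below_sum (List.mem_map.2 ⟨_, h, rfl⟩)

theorem varSum_below {l : List ℕ} {F : Expr A} (h : ∀ k ∈ l, Below (var k) F) :
    Below (varSum l) F := by
  apply sum_below
  intro E hE
  obtain ⟨k, hk, rfl⟩ := List.mem_map.1 hE
  exact h _ hk

theorem below_varSum {l : List ℕ} {k : ℕ} (h : k ∈ l) :
    Below (var k : Expr A) (varSum l) := below_sum (List.mem_map.2 ⟨_, h, rfl⟩)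

/-- Replacing the variable `0` by `F` in the summands of an expression. -/
theorem inst_preSum (l : List (Act A × Expr A)) (F : Expr A) :
    inst (preSum l) F = preSum (l.map fun o => (o.1, inst o.2 F)) := by
  simp only [inst, preSum, subst_sum, List.map_map]; rfl

/-- A recursion does not depend on an unguarded occurrence of its variable as a summand. -/
theorem mu_congr_of_below {E F : Expr A} (h : Provable E (plus (var 0) F)) :
    Provable (mu E) (mu F) := (Provable.mu_congr h).trans (.Ung1 F)

/-- Every basic expression is the sum of its transitions and of its exposed variables. -/
theorem provable_body {E : Expr A} (hE : IsBasic E) :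
    Provable E (plus (preSum (outs E)) (varSum (exps E))) := by
  induction E with
  | nil => exact (Provable.A4 nil).symm
  | var k =>
    exact (Below.trans (.left _ nil) (.right nil _)).antisymm
      (.plus (.nil _) (.plus (.refl _) (.nil _)))
  | pre γ E _ =>
    exact (Below.trans (.left _ nil) (.left _ nil)).antisymm
      (.plus (.plus (.refl _) (.nil _)) (.nil _))
  | plus E F ihE ihF =>
    have hE' := ihE hE.1
    have hF' := ihF hE.2
    apply Below.antisymm
    · refine .plus ((Below.of_provable hE').trans ?_) ((Below.of_provable hF').trans ?_)
      · refine .plus (preSum_below fun γ G h => ?_) (varSum_below fun k h => ?_)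
        · exact (below_preSum (List.mem_append_left _ h)).trans (.left _ _)
        · exact (below_varSum (List.mem_append_left _ h)).trans (.right _ _)
      · refine .plus (preSum_below fun γ G h => ?_) (varSum_below fun k h => ?_)
        · exact (below_preSum (List.mem_append_right _ h)).trans (.left _ _)
        · exact (below_varSum (List.mem_append_right _ h)).trans (.right _ _)
    · refine .plus (preSum_below fun γ G h => ?_) (varSum_below fun k h => ?_)
      · rcases List.mem_append.1 h with h | h
        · exact ((below_preSum h).trans (.left _ _)).trans
            ((Below.of_provable hE'.symm).trans (.left _ _))
        · exact ((below_preSum h).trans (.left _ _)).trans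
            ((Below.of_provable hF'.symm).trans (.right _ _))
      · rcases List.mem_append.1 h with h | h
        · exact ((below_varSum h).trans (.right _ _)).trans
            ((Below.of_provable hE'.symm).trans (.left _ _))
        · exact ((below_varSum h).trans (.right _ _)).trans
            ((Below.of_provable hF'.symm).trans (.right _ _))
  | mu E ih =>
    have hE' := ih hE
    -- The body without its exposed variable 0, which `Ung1` discards. Unfolding `b` once, rather
    -- than `E`, gives literally the sum of transitions and variables of `mu E`.
    set b : Expr A := plus (preSum (outs E)) (sum ((exps (mu E)).map fun k => var (k + 1)))
    have hb : Provable (mu E) (mu b) := by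
      by_cases h0 : 0 ∈ exps E
      · apply mu_congr_of_below
        apply hE'.trans
        apply Below.antisymm
        · refine .plus ((Below.left _ _).trans (.right _ _)) (varSum_below fun k hk => ?_)
          cases k with
          | zero => exact .left _ _
          | succ k =>
            exact (below_sum (List.mem_map.2 ⟨k, mem_exps_mu.2 hk, rfl⟩)).trans
              ((Below.right _ _).trans (.right _ _))
        · refine .plus ((below_varSum h0).trans (.right _ _)) (.plus (.left _ _) ?_)
          apply sum_below
          intro F hF
          obtain ⟨k, hk, rfl⟩ := List.mem_map.1 hF
          exact (below_varSum (mem_exps_mu.1 hk)).trans (.right _ _)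
      · apply Provable.mu_congr
        apply hE'.trans
        apply Below.antisymm
        · refine .plus (.left _ _) (varSum_below fun k hk => ?_)
          cases k with
          | zero => exact (h0 hk).elim
          | succ k =>
            exact (below_sum (List.mem_map.2 ⟨k, mem_exps_mu.2 hk, rfl⟩)).trans (.right _ _)
        · refine .plus (.left _ _) ?_
          apply sum_below
          intro F hF
          obtain ⟨k, hk, rfl⟩ := List.mem_map.1 hF
          exact (below_varSum (mem_exps_mu.1 hk)).trans (.right _ _)
    have e : inst b (mu E) = plus (preSum (outs (mu E))) (varSum (exps (mu E))) := by
      have : inst b (mu E) = plus (inst (preSum (outs E)) (mu E))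
        (inst (sum ((exps (mu E)).map fun k => var (k + 1))) (mu E)) := rfl
      rw [this, inst_preSum]
      congr 1
      simp only [inst, subst_sum, List.map_map]; rfl
    rw [← e]
    exact hb.trans ((Provable.Rec1 b).trans (Provable.inst_congr hb.symm b))
  | _ => exact hE.elim

/-- Sequences of raw silent transitions. -/
def TauReach : Expr A → Expr A → Prop :=
  Relation.ReflTransGen fun e f => (Act.tau, f) ∈ outs e

/-- The variable `k` is exposed after some raw silent transitions. -/
def WeaklyExposes (k : ℕ) (e : Expr A) : Prop := ∃ f, TauReach e f ∧ k ∈ exps f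

theorem Expr.IsBasic.of_tauReach {e f : Expr A} (h : IsBasic e) (hf : TauReach e f) : IsBasic f := by
  induction hf with
  | refl => exact h
  | tail _ h' ih => exact ih.of_mem_outs h'

theorem below_of_mem_outs {e : Expr A} (h : IsBasic e) {γ : Act A} {f : Expr A}
    (hf : (γ, f) ∈ outs e) : Below (pre γ f) e :=
  ((below_preSum hf).trans (.left _ _)).trans (.of_provable (provable_body h).symm)

theorem below_of_mem_exps {e : Expr A} (h : IsBasic e) {k : ℕ} (hk : k ∈ exps e) :
    Below (var k) e :=
  ((below_varSum hk).trans (.right _ _)).trans (.of_provable (provable_body h).symm)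

/-- By `Tau2` a process is absorbed by its own silent prefix, and that prefix is a summand of the
predecessor on the path. -/
theorem below_of_tauReach {e f : Expr A} (h : IsBasic e) (hf : TauReach e f) : Below f e := by
  induction hf with
  | refl => exact .refl _
  | tail h₁ h₂ ih =>
    exact ((Below.tau _).trans (below_of_mem_outs (h.of_tauReach h₁) h₂)).trans ih

theorem below_of_weaklyExposes {e : Expr A} (h : IsBasic e) {k : ℕ} (hk : WeaklyExposes k e) :
    Below (var k) e := by
  obtain ⟨f, hf, hk⟩ := hk
  exact (below_of_mem_exps (h.of_tauReach hf) hk).trans (below_of_tauReach h hf)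

/-- A variable that is not exposed after silent transitions is strongly guarded. -/
theorem guarded_of_not_weaklyExposes {e : Expr A} {k : ℕ} (h : ¬ WeaklyExposes k e)
    (he : IsBasic e) : Guarded k e := by
  induction e generalizing k with
  | var i =>
    rintro rfl
    exact h ⟨_, .refl, by simp [exps]⟩
  | pre γ E ih =>
    by_cases hγ : γ = .tau
    · subst hγ
      refine .inr (ih ?_ he)
      rintro ⟨f, hf, hk⟩
      exact h ⟨f, .head (by simp [outs]) hf, hk⟩
    · exact .inl hγ
  | plus E F ihE ihF =>
    have key : ∀ (E' : Expr A), (∀ o ∈ outs E', o ∈ outs (plus E F)) →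
        (∀ k ∈ exps E', k ∈ exps (plus E F)) → ¬ WeaklyExposes k E' := by
      rintro E' ho hx ⟨f, hf, hk⟩
      rcases Relation.ReflTransGen.cases_head hf with rfl | ⟨g, hg, hf⟩
      · exact h ⟨_, .refl, hx _ hk⟩
      · exact h ⟨f, .head (ho _ hg) hf, hk⟩
    exact ⟨ihE (key E (by simp [outs]; grind) (by simp [exps]; grind)) he.1,
      ihF (key F (by simp [outs]; grind) (by simp [exps]; grind)) he.2⟩
  | mu E ih =>
    refine ih ?_ he
    rintro ⟨f, hf, hk⟩
    apply h
    -- A silent path of the body remains one after the recursion has been unfolded.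
    have lift : ∀ g, TauReach g f → WeaklyExposes k (inst g (mu E)) := by
      intro g hg
      induction hg using Relation.ReflTransGen.head_induction_on with
      | refl => exact ⟨_, .refl, mem_exps_inst_mu.2 (.inl hk)⟩
      | head h₁ _ ih =>
        obtain ⟨f', hf', hk'⟩ := ih
        exact ⟨f', .head (mem_outs_inst.2 (.inl ⟨_, h₁, rfl⟩)) hf', hk'⟩
    rcases Relation.ReflTransGen.cases_head hf with rfl | ⟨g, hg, hf⟩
    · exact ⟨_, .refl, mem_exps_mu.2 hk⟩
    · obtain ⟨f', hf', hk'⟩ := lift g hf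
      exact ⟨f', .head (mem_outs_mu.2 ⟨g, hg, rfl⟩) hf', hk'⟩
  | _ => trivial

/-! ### Elimination of silent cycles -/

/-- A sum of expressions with prefixes `α . G` and of variables within `pri`. -/
def atomSum (lo : List (PAct A × Expr A)) (lk : List ℕ) : Expr A :=
  plus (preSum (lo.map fun o => (Act.std o.1, o.2))) (sum (lk.map fun k => pri (var k)))

theorem atomSum_below {lo : List (PAct A × Expr A)} {lk : List ℕ} {F : Expr A}
    (ho : ∀ α G, (α, G) ∈ lo → Below (pre (.std α) G) F) (hk : ∀ k ∈ lk, Below (pri (var k)) F) :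
    Below (atomSum lo lk) F := by
  refine .plus (preSum_below fun γ G h => ?_) (sum_below fun E h => ?_)
  · obtain ⟨⟨α, G'⟩, h', e⟩ := List.mem_map.1 h
    cases e
    exact ho _ _ h'
  · obtain ⟨k, h', rfl⟩ := List.mem_map.1 h
    exact hk k h'

theorem pre_below_atomSum {lo : List (PAct A × Expr A)} {α : PAct A} {G : Expr A}
    (h : (α, G) ∈ lo) (lk : List ℕ) : Below (pre (.std α) G) (atomSum lo lk) :=
  (below_preSum (List.mem_map.2 ⟨_, h, rfl⟩)).trans (.left _ _)

theorem pri_below_atomSum (lo : List (PAct A × Expr A)) {lk : List ℕ} {k : ℕ} (h : k ∈ lk) :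
    Below (pri (var k)) (atomSum lo lk) :=
  (below_sum (List.mem_map.2 ⟨_, h, rfl⟩)).trans (.right _ _)

theorem pri_sum {l : List (Expr A)} (h : ∀ E ∈ l, Provable (pri E) E) :
    Provable (pri (sum l)) (sum l) := by
  induction l with
  | nil => exact .Pri1
  | cons E l ih =>
    exact (Provable.Pri4 _ _).trans
      (.plus_congr (h E (by simp)) (ih fun E' hE' => h E' (by simp [hE'])))

theorem pri_atomSum (lo : List (PAct A × Expr A)) (lk : List ℕ) :
    Provable (pri (atomSum lo lk)) (atomSum lo lk) := by
  refine (Provable.Pri4 _ _).trans (.plus_congr (pri_sum ?_) (pri_sum ?_))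
  · simp only [List.map_map, List.mem_map]
    rintro _ ⟨o, -, rfl⟩
    exact .Pri2 _ _
  · simp only [List.mem_map]
    rintro _ ⟨k, -, rfl⟩
    exact .Pri5 _

theorem subst_atomSum (lo : List (PAct A × Expr A)) (lk : List ℕ) (σ : ℕ → Expr A) :
    subst σ (atomSum lo lk) = plus (preSum (lo.map fun o => (Act.std o.1, subst σ o.2)))
      (sum (lk.map fun k => pri (σ k))) := by
  simp only [atomSum, preSum, subst, subst_sum, List.map_map]; rfl

theorem inst_atomSum (lo : List (PAct A × Expr A)) {lk : List ℕ} (h : 0 ∉ lk) (P : Expr A) :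
    inst (atomSum lo lk) P =
      atomSum (lo.map fun o => (o.1, inst o.2 P)) (lk.map Nat.pred) := by
  rw [inst, subst_atomSum, atomSum]
  congr 2
  · simp only [List.map_map]; rfl
  · rw [List.map_map]
    apply List.map_congr_left
    rintro (_ | k) hk
    · exact (h hk).elim
    · rfl

/-- Equality as summands of a recursion with a silent loop. -/
def FlatEq (F G : Expr A) : Prop :=
  ∀ W, Provable (mu (plus (plus (pre .tau (var 0)) F) W))
    (mu (plus (plus (pre .tau (var 0)) G) W))

namespace FlatEq

theorem trans {F G H : Expr A} (h : FlatEq F G) (h' : FlatEq G H) : FlatEq F H :=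
  fun W => (h W).trans (h' W)

theorem of_tau_plus {F G : Expr A}
    (h : Provable (plus (pre .tau (var 0)) F) (plus (pre .tau (var 0)) G)) : FlatEq F G :=
  fun _ => .mu_congr (.plus_congr h (.refl _))

theorem of_provable {F G : Expr A} (h : Provable F G) : FlatEq F G :=
  of_tau_plus (.plus_congr (.refl _) h)

/-- The quantified context `W` makes this work: while one summand is rewritten, the other is moved
into the context. -/
theorem plus {F F' G G' : Expr A} (h : FlatEq F F') (h' : FlatEq G G') :
    FlatEq (plus F G) (Expr.plus F' G') := by
  intro W
  have e : ∀ T F G W : Expr A, Provable (Expr.plus (Expr.plus T (Expr.plus F G)) W)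
      (Expr.plus (Expr.plus T F) (Expr.plus G W)) := fun T F G W =>
    (Provable.plus_congr (Provable.A2 T F G).symm (.refl W)).trans (.A2 _ _ _)
  have e' : ∀ T F G W : Expr A, Provable (Expr.plus (Expr.plus T F) (Expr.plus G W))
      (Expr.plus (Expr.plus T G) (Expr.plus F W)) := fun T F G W =>
    (e T F G W).symm.trans
      ((Provable.plus_congr (.plus_congr (.refl T) (.A1 F G)) (.refl W)).trans (e T G F W))
  refine (Provable.mu_congr (e _ F G W)).trans ((h _).trans ?_)
  refine (Provable.mu_congr (e' _ F' G W)).trans ((h' _).trans ?_)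
  exact (Provable.mu_congr ((e' _ G' F' W).trans (e _ F' G' W).symm))

/-- The context keeps its own copy of the silent loop. Applied to `K`, `Ung3` or `Ung4` creates a
second copy, which idempotence removes. -/
theorem tau_aux (F W : Expr A) (K : Expr A)
    (h : Provable (mu (Expr.plus K (Expr.plus (pre .tau (var 0)) W)))
      (mu (Expr.plus (Expr.plus (pre .tau (var 0)) F) (Expr.plus (pre .tau (var 0)) W)))) :
    Provable (mu (Expr.plus (Expr.plus (pre .tau (var 0)) K) W))
      (mu (Expr.plus (Expr.plus (pre .tau (var 0)) F) W)) := by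
  refine (Provable.mu_congr ?_).trans (h.trans (.mu_congr ?_))
  · exact (Provable.plus_congr (.A1 _ _) (.refl _)).trans (.A2 _ _ _)
  · exact Below.antisymm
      (.plus (.left _ _) (.plus ((Below.left _ _).trans (.left _ _)) (.right _ _)))
      (.plus (.left _ _) ((Below.right _ _).trans (.right _ _)))

/-- Since `F` absorbs the variable, `τ.F` has the shape required by `Ung3`: a silent step to a point
from which the loop can be re-entered. -/
theorem tau {F : Expr A} (h : Below (var 0) F) : FlatEq (pre .tau F) F := by
  intro W
  apply tau_aux
  refine (Provable.mu_congr (.plus_congr (.pre_congr _ ?_) (.refl _))).trans (.Ung3 F _)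
  exact h.symm.trans (.A1 _ _)

theorem tau_pri {F : Expr A} (h : Below (pri (var 0)) F) : FlatEq (pre .tau F) F := by
  intro W
  apply tau_aux
  refine (Provable.mu_congr (.plus_congr (.pre_congr _ ?_) (.refl _))).trans (.Ung4 F _)
  exact h.symm.trans (.A1 _ _)

theorem of_below {F G : Expr A} (h : Below F (Expr.plus (pre .tau (var 0)) G))
    (h' : Below G (Expr.plus (pre .tau (var 0)) F)) : FlatEq F G :=
  of_tau_plus (Below.antisymm (.plus (.left _ _) h) (.plus (.left _ _) h'))

/-- The loop variable is below its own silent prefix by `Tau2`, and beside that prefix `pri` makes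
no difference; so variable 0 can be dropped. -/
theorem priVars (l : List ℕ) : FlatEq (sum (l.map fun k => pri (var k) : List (Expr A)))
    (sum ((l.filter (· ≠ 0)).map fun k => pri (var k))) := by
  apply of_below
  · apply sum_below
    simp only [List.mem_map]
    rintro _ ⟨_ | k, hk, rfl⟩
    · exact (Below.pri_iff_tau (.left _ _)).2 ((Below.tau _).trans (.left _ _))
    · exact (below_sum (List.mem_map.2 ⟨k + 1, by simp [hk], rfl⟩)).trans (.right _ _)
  · apply sum_below
    simp only [List.mem_map, List.mem_filter]
    rintro _ ⟨k, hk, rfl⟩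
    exact (below_sum (List.mem_map.2 ⟨k, hk.1, rfl⟩)).trans (.right _ _)

theorem vars (l : List ℕ) : FlatEq (varSum l : Expr A)
    (sum ((l.filter (· ≠ 0)).map fun k => pri (var k))) := by
  refine trans (of_below ?_ ?_) (priVars l)
  · refine varSum_below fun k hk => (Below.pri_iff_tau (.left _ _)).1 ?_
    exact (below_sum (List.mem_map.2 ⟨k, hk, rfl⟩)).trans (.right _ _)
  · apply sum_below
    simp only [List.mem_map]
    rintro _ ⟨k, hk, rfl⟩
    exact (Below.pri_iff_tau (.left _ _)).2 ((below_varSum hk).trans (.right _ _))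

end FlatEq

/-- The expressions whose silent transitions can be unfolded into a finite tree, after silent
cycles have been replaced by the sum of the transitions that leave them. -/
inductive Resolved : Expr A → Prop
  | step {e : Expr A} : (∀ g, (Act.tau, g) ∈ outs e → Resolved g) → Resolved e
  -- `N` holds of nodes that silently return to `e`; every prioritized move of a node is listed in
  -- `lo` or is silent and stays in `N`, and `lk` contains the variables exposed at nodes. The
  -- listed moves and variables must occur at states silently reachable from `e`. Only the silent
  -- moves in `lo` are unfolded further, which keeps the tree finite.
  | loop {e : Expr A} (N : Expr A → Prop) (lo : List (PAct A × Expr A)) (lk : List ℕ) :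
      N e → (∀ f, N f → TauReach f e) → Provable e (pre .tau (atomSum lo lk)) →
      (∀ f, N f → ∀ α g, (Act.std α, g) ∈ outs f → (α, g) ∈ lo ∨ (α = .tau ∧ N g)) →
      (∀ f, N f → ∀ k ∈ exps f, k ∈ lk) →
      (∀ α g, (α, g) ∈ lo → ∃ f, TauReach e f ∧ (Act.std α, g) ∈ outs f) →
      (∀ k ∈ lk, ∃ f, TauReach e f ∧ k ∈ exps f) →
      (∀ g, (PAct.tau, g) ∈ lo → Resolved g) → Resolved e

/-- `e` can be replaced by a sum of transitions that leave the silent loops through the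
variable `0`. -/
structure Flattens (e : Expr A) (lo : List (PAct A × Expr A)) (lk : List ℕ) : Prop where
  eq : FlatEq e (atomSum lo lk)
  sound : ∀ α g, (α, g) ∈ lo → (∃ f, TauReach e f ∧ (Act.std α, g) ∈ outs f) ∧
    (α = .tau → ¬ WeaklyExposes 0 g)
  soundVar : ∀ k ∈ lk, k ≠ 0 ∧ ∃ f, TauReach e f ∧ k ∈ exps f
  -- States that no longer silently expose variable 0 have left the loop, so their moves need not be
  -- listed.
  complete : ∀ f, TauReach e f → WeaklyExposes 0 f → ∀ α g, (Act.std α, g) ∈ outs f →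
    (α, g) ∈ lo ∨ (α = .tau ∧ WeaklyExposes 0 g)
  completeVar : ∀ f, TauReach e f → WeaklyExposes 0 f → ∀ k ∈ exps f, k = 0 ∨ k ∈ lk

/-- `Flattens` for the sum of the prefixed expressions in a list. -/
structure FlattensList (os : List (Act A × Expr A)) (lo : List (PAct A × Expr A))
    (lk : List ℕ) : Prop where
  eq : FlatEq (preSum os) (atomSum lo lk)
  sound : ∀ α g, (α, g) ∈ lo → (α = .tau → ¬ WeaklyExposes 0 g) ∧ ((Act.std α, g) ∈ os ∨
    ∃ h, (Act.tau, h) ∈ os ∧ ∃ f, TauReach h f ∧ (Act.std α, g) ∈ outs f)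
  soundVar : ∀ k ∈ lk, k ≠ 0 ∧ ∃ h, (Act.tau, h) ∈ os ∧ ∃ f, TauReach h f ∧ k ∈ exps f
  head : ∀ α g, (Act.std α, g) ∈ os → (α, g) ∈ lo ∨ (α = .tau ∧ WeaklyExposes 0 g)
  complete : ∀ h, (Act.tau, h) ∈ os → ∀ f, TauReach h f → WeaklyExposes 0 f →
    (∀ α g, (Act.std α, g) ∈ outs f → (α, g) ∈ lo ∨ (α = .tau ∧ WeaklyExposes 0 g)) ∧
      ∀ k ∈ exps f, k = 0 ∨ k ∈ lk

/-- Each summand is treated separately. A time prefix is absorbed by the silent loop; a silent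
prefix whose target still exposes variable 0 is replaced by the flattening of its target; any other
prefix is an exit and is kept. -/
theorem flattens_list (os : List (Act A × Expr A)) (hb : ∀ g, (Act.tau, g) ∈ os → IsBasic g)
    (h : ∀ g, (Act.tau, g) ∈ os → WeaklyExposes 0 g → ∃ lo lk, Flattens g lo lk) :
    ∃ lo lk, FlattensList os lo lk := by
  induction os with
  | nil =>
    refine ⟨[], [], .of_provable ?_, by simp, by simp, by simp, by simp⟩
    exact Below.antisymm (.nil _) (atomSum_below (by simp) (by simp))
  | cons o os ih =>
    obtain ⟨lo, lk, h₁, h₂, h₃, h₄, h₅⟩ := ih (fun g hg => hb g (by simp [hg]))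
      fun g hg => h g (by simp [hg])
    obtain ⟨γ, g⟩ := o
    have keep : ∀ α : PAct A, γ = .std α → (α = .tau → ¬ WeaklyExposes 0 g) →
        ∃ lo lk, FlattensList ((γ, g) :: os) lo lk := by
      rintro α rfl hα
      refine ⟨(α, g) :: lo, lk, (FlatEq.plus (F' := pre (.std α) g)
        (.of_provable (.refl _)) h₁).trans (.of_provable (.symm (.A2 _ _ _))), ?_, ?_, ?_, ?_⟩
      · intro β f hf
        rcases List.mem_cons.1 hf with e | hf
        · cases e; exact ⟨hα, .inl (by simp)⟩
        · refine ⟨(h₂ β f hf).1, (h₂ β f hf).2.imp (fun h => by simp [h]) ?_⟩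
          rintro ⟨h, hh, hf⟩
          exact ⟨h, by simp [hh], hf⟩
      · intro k hk
        obtain ⟨hk, h, hh, hf⟩ := h₃ k hk
        exact ⟨hk, h, by simp [hh], hf⟩
      · intro β f hf
        rcases List.mem_cons.1 hf with e | hf
        · cases e; exact .inl (by simp)
        · exact (h₄ β f hf).imp_left fun h => by simp [h]
      · intro h hh f hf hw
        rcases List.mem_cons.1 hh with e | hh
        · cases e
          obtain ⟨f', hf', hk⟩ := hw
          exact (hα rfl ⟨f', hf.trans hf', hk⟩).elim
        · obtain ⟨h₆, h₇⟩ := h₅ h hh f hf hw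
          exact ⟨fun β f hf => (h₆ β f hf).imp_left fun h => by simp [h], h₇⟩
    rcases γ with α | _
    · by_cases hα : α = .tau ∧ WeaklyExposes 0 g
      · obtain ⟨rfl, hw⟩ := hα
        obtain ⟨lo', lk', hF⟩ := h g (by simp) hw
        refine ⟨lo' ++ lo, lk' ++ lk, ?_, ?_, ?_, ?_, ?_⟩
        · have e := (FlatEq.tau (below_of_weaklyExposes (hb g (by simp)) hw)).trans hF.eq
          refine (FlatEq.plus (F := pre .tau g) e h₁).trans (.of_provable ?_)
          apply Below.antisymm
          · refine .plus (atomSum_below ?_ ?_) (atomSum_below ?_ ?_)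
            · exact fun α G h => pre_below_atomSum (by simp [h]) _
            · exact fun k h => pri_below_atomSum _ (by simp [h])
            · exact fun α G h => pre_below_atomSum (by simp [h]) _
            · exact fun k h => pri_below_atomSum _ (by simp [h])
          · refine atomSum_below (fun α G h => ?_) fun k h => ?_
            · rcases List.mem_append.1 h with h | h
              · exact (pre_below_atomSum h _).trans (.left _ _)
              · exact (pre_below_atomSum h _).trans (.right _ _)
            · rcases List.mem_append.1 h with h | h
              · exact (pri_below_atomSum _ h).trans (.left _ _)
              · exact (pri_below_atomSum _ h).trans (.right _ _)
        · intro β f hf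
          rcases List.mem_append.1 hf with hf | hf
          · exact ⟨(hF.sound β f hf).2, .inr ⟨g, by simp, (hF.sound β f hf).1⟩⟩
          · refine ⟨(h₂ β f hf).1, (h₂ β f hf).2.imp (fun h => by simp [h]) ?_⟩
            rintro ⟨h, hh, hf⟩
            exact ⟨h, by simp [hh], hf⟩
        · intro k hk
          rcases List.mem_append.1 hk with hk | hk
          · exact ⟨(hF.soundVar k hk).1, g, by simp, (hF.soundVar k hk).2⟩
          · obtain ⟨hk, h, hh, hf⟩ := h₃ k hk
            exact ⟨hk, h, by simp [hh], hf⟩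
        · intro β f hf
          rcases List.mem_cons.1 hf with e | hf
          · cases e; exact .inr ⟨rfl, hw⟩
          · exact (h₄ β f hf).imp_left fun h => by simp [h]
        · intro h hh f hf hw'
          rcases List.mem_cons.1 hh with e | hh
          · cases e
            exact ⟨fun β f' hf' => (hF.complete f hf hw' β f' hf').imp_left
                fun h => by simp [h],
              fun k hk => (hF.completeVar f hf hw' k hk).imp_right fun h => by simp [h]⟩
          · obtain ⟨h₆, h₇⟩ := h₅ h hh f hf hw'
            exact ⟨fun β f hf => (h₆ β f hf).imp_left fun h => by simp [h],
              fun k hk => (h₇ k hk).imp_right fun h => by simp [h]⟩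
      · exact keep α rfl fun e hw => hα ⟨e, hw⟩
    · refine ⟨lo, lk, FlatEq.trans (.of_below ?_ ?_) h₁, ?_, ?_, ?_, ?_⟩
      · exact .plus (.delta (.left _ _) _) (.right _ _)
      · exact (Below.right (pre .delta g) (preSum os)).trans (.right _ _)
      · intro β f hf
        refine ⟨(h₂ β f hf).1, (h₂ β f hf).2.imp (fun h => by simp [h]) ?_⟩
        rintro ⟨h, hh, hf⟩
        exact ⟨h, by simp [hh], hf⟩
      · intro k hk
        obtain ⟨hk, h, hh, hf⟩ := h₃ k hk
        exact ⟨hk, h, by simp [hh], hf⟩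
      · intro β f hf
        rcases List.mem_cons.1 hf with e | hf
        · cases e
        · exact h₄ β f hf
      · intro h hh f hf hw
        rcases List.mem_cons.1 hh with e | hh
        · cases e
        · exact h₅ h hh f hf hw

/-- Induction on the finite unfolding. At a plain node the list of transitions is flattened; at a
collapsed inner cycle the list of its exits is. -/
theorem Resolved.flattens {e : Expr A} (hr : Resolved e) (hb : IsBasic e)
    (hw : WeaklyExposes 0 e) : ∃ lo lk, Flattens e lo lk := by
  induction hr with
  | @step e hs ih =>
    obtain ⟨lo, lk, h₁, h₂, h₃, h₄, h₅⟩ := flattens_list (outs e)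
      (fun g hg => hb.of_mem_outs hg) fun g hg => ih g hg (hb.of_mem_outs hg)
    refine ⟨lo, (exps e).filter (· ≠ 0) ++ lk, ?_, ?_, ?_, ?_, ?_⟩
    · refine (FlatEq.of_provable (provable_body hb)).trans
        ((FlatEq.plus h₁ (.vars _)).trans (.of_provable ?_))
      apply Below.antisymm
      · refine .plus (atomSum_below ?_ ?_) (sum_below ?_)
        · exact fun α G h => pre_below_atomSum (by simp [h]) _
        · exact fun k h => pri_below_atomSum _ (by simp [h])
        · intro E hE
          obtain ⟨k, hk, rfl⟩ := List.mem_map.1 hE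
          exact pri_below_atomSum _ (List.mem_append_left _ hk)
      · refine atomSum_below (fun α G h => ?_) fun k h => ?_
        · exact (pre_below_atomSum h _).trans (.left _ _)
        · rcases List.mem_append.1 h with h | h
          · exact (below_sum (List.mem_map.2 ⟨k, h, rfl⟩)).trans (.right _ _)
          · exact (pri_below_atomSum _ h).trans (.left _ _)
    · intro α g hg
      obtain ⟨hα, h | ⟨h, hh, f, hf, hg⟩⟩ := h₂ α g hg
      · exact ⟨⟨e, .refl, h⟩, hα⟩
      · exact ⟨⟨f, .head hh hf, hg⟩, hα⟩
    · intro k hk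
      rcases List.mem_append.1 hk with hk | hk
      · simp only [List.mem_filter, decide_eq_true_eq] at hk
        exact ⟨hk.2, e, .refl, hk.1⟩
      · obtain ⟨hk, h, hh, f, hf, hk'⟩ := h₃ k hk
        exact ⟨hk, f, .head hh hf, hk'⟩
    · intro f hf hw' α g hg
      rcases Relation.ReflTransGen.cases_head hf with rfl | ⟨h, hh, hf⟩
      · exact h₄ α g hg
      · exact (h₅ h hh f hf hw').1 α g hg
    · intro f hf hw' k hk
      rcases Relation.ReflTransGen.cases_head hf with rfl | ⟨h, hh, hf⟩
      · by_cases h0 : k = 0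
        · exact .inl h0
        · exact .inr (List.mem_append_left _ (by simp [hk, h0]))
      · exact ((h₅ h hh f hf hw').2 k hk).imp_right (List.mem_append_right _)
  | @loop e N lo lk hN hN' he hc hcv hs hsv hr ih =>
    have basic : ∀ g, (PAct.tau, g) ∈ lo → IsBasic g := fun g hg => by
      obtain ⟨f, hf, hg⟩ := hs _ _ hg
      exact (hb.of_tauReach hf).of_mem_outs hg
    have mem : ∀ α g, (Act.std α, g) ∈ lo.map (fun o => (Act.std o.1, o.2)) ↔ (α, g) ∈ lo := by
      intro α g
      simp only [List.mem_map, Prod.exists, Prod.mk.injEq, Act.std.injEq]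
      grind
    -- A silent path either stays on the inner cycle or passes through one of its silent exits.
    have cases_node : ∀ f, TauReach e f → N f ∨ ∃ g, (PAct.tau, g) ∈ lo ∧ TauReach g f := by
      intro f hf
      induction hf with
      | refl => exact .inl hN
      | @tail f f' _ hf ih =>
        rcases ih with ih | ⟨g, hg, ih⟩
        · rcases hc f ih _ _ hf with h | ⟨_, h⟩
          · exact .inr ⟨_, h, .refl⟩
          · exact .inl h
        · exact .inr ⟨g, hg, ih.tail hf⟩
    obtain ⟨lo', lk', h₁, h₂, h₃, h₄, h₅⟩ := flattens_list
      (lo.map fun o => (Act.std o.1, o.2))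
      (fun g hg => basic g ((mem _ _).1 hg))
      fun g hg => ih g ((mem _ _).1 hg) (basic g ((mem _ _).1 hg))
    have step : ∀ g, (PAct.tau, g) ∈ lo → TauReach e g := fun g hg => by
      obtain ⟨f, hf, hg⟩ := hs _ _ hg
      exact hf.tail hg
    refine ⟨lo', lk.filter (· ≠ 0) ++ lk', ?_, ?_, ?_, ?_, ?_⟩
    -- The τ in front of the collapsed cycle must go. If variable 0 is exposed at a node, it is a
    -- summand under `pri`, which is the case for `Ung4`; otherwise it is exposed behind a silent
    -- exit, hence absorbed by the sum, and `Ung3` applies.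
    · have e₁ : FlatEq (pre .tau (atomSum lo lk)) (atomSum lo lk) := by
        obtain ⟨f, hf, h0⟩ := hw
        rcases cases_node f hf with h | ⟨g, hg, hgf⟩
        · exact .tau_pri (pri_below_atomSum _ (hcv f h 0 h0))
        · exact .tau ((below_of_weaklyExposes (basic g hg) ⟨f, hgf, h0⟩).trans
            ((Below.tau g).trans (pre_below_atomSum hg _)))
      refine (FlatEq.of_provable he).trans (e₁.trans
        ((FlatEq.plus h₁ (.priVars _)).trans (.of_provable ?_)))
      apply Below.antisymm
      · refine .plus (atomSum_below ?_ ?_) (sum_below ?_)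
        · exact fun α G h => pre_below_atomSum (by simp [h]) _
        · exact fun k h => pri_below_atomSum _ (by simp [h])
        · intro E hE
          obtain ⟨k, hk, rfl⟩ := List.mem_map.1 hE
          exact pri_below_atomSum _ (List.mem_append_left _ hk)
      · refine atomSum_below (fun α G h => ?_) fun k h => ?_
        · exact (pre_below_atomSum h _).trans (.left _ _)
        · rcases List.mem_append.1 h with h | h
          · exact (below_sum (List.mem_map.2 ⟨k, h, rfl⟩)).trans (.right _ _)
          · exact (pri_below_atomSum _ h).trans (.left _ _)
    · intro α g hg
      obtain ⟨hα, h | ⟨h, hh, f, hf, hg⟩⟩ := h₂ α g hg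
      · exact ⟨hs _ _ ((mem _ _).1 h), hα⟩
      · exact ⟨⟨f, (step h ((mem _ _).1 hh)).trans hf, hg⟩, hα⟩
    · intro k hk
      rcases List.mem_append.1 hk with hk | hk
      · simp only [List.mem_filter, decide_eq_true_eq] at hk
        exact ⟨hk.2, hsv k hk.1⟩
      · obtain ⟨hk, h, hh, f, hf, hk'⟩ := h₃ k hk
        exact ⟨hk, f, (step h ((mem _ _).1 hh)).trans hf, hk'⟩
    · intro f hf hw' α g hg
      rcases cases_node f hf with hf | ⟨h, hh, hf⟩
      · rcases hc f hf α g hg with h | ⟨rfl, h⟩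
        · exact h₄ α g ((mem _ _).2 h)
        · obtain ⟨x, hx, h0⟩ := hw
          exact .inr ⟨rfl, x, (hN' g h).trans hx, h0⟩
      · exact (h₅ h ((mem _ _).2 hh) f hf hw').1 α g hg
    · intro f hf hw' k hk
      rcases cases_node f hf with hf | ⟨h, hh, hf⟩
      · by_cases h0 : k = 0
        · exact .inl h0
        · exact .inr (List.mem_append_left _ (by simp [hcv f hf k hk, h0]))
      · exact ((h₅ h ((mem _ _).2 hh) f hf hw').2 k hk).imp_right (List.mem_append_right _)

theorem TauReach.subst {e f : Expr A} (h : TauReach e f) (σ : ℕ → Expr A) :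
    TauReach (Expr.subst σ e) (Expr.subst σ f) := by
  induction h with
  | refl => exact .refl
  | tail _ h ih => exact ih.tail (mem_outs_subst.2 (.inl ⟨_, h, rfl⟩))

theorem WeaklyExposes.of_tauReach {e f : Expr A} {k : ℕ} (h : TauReach e f)
    (hf : WeaklyExposes k f) : WeaklyExposes k e := by
  obtain ⟨g, hg, hk⟩ := hf
  exact ⟨g, h.trans hg, hk⟩

/-- No silent path meets variable 0, so instantiating it relabels the silent graph without adding
silent transitions. -/
theorem Resolved.inst {g : Expr A} (h : Resolved g) (hw : ¬ WeaklyExposes 0 g) (E : Expr A) :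
    Resolved (inst g (mu E)) := by
  induction h with
  | @step g _ ih =>
    refine .step fun x hx => ?_
    rcases mem_outs_inst.1 hx with ⟨g₀, h₀, rfl⟩ | ⟨h0, _⟩
    · exact ih g₀ h₀ fun h => hw (.of_tauReach (.single h₀) h)
    · exact (hw ⟨_, .refl, h0⟩).elim
  | @loop g N lo lk hN hN' he hc hcv hs hsv _ ih =>
    have h0 : 0 ∉ lk := fun h => by
      obtain ⟨f, hf, h⟩ := hsv 0 h
      exact hw ⟨f, hf, h⟩
    have key : ∀ f, TauReach g f → 0 ∉ exps f := fun f hf h => hw ⟨f, hf, h⟩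
    -- As `0 ∉ lk`, `Nat.pred` is exactly the lowering of indices performed by `inst`.
    refine .loop (fun x => ∃ f, N f ∧ TauReach g f ∧ x = Expr.inst f (mu E))
      (lo.map fun o => (o.1, Expr.inst o.2 (mu E))) (lk.map Nat.pred)
      ⟨g, hN, .refl, rfl⟩ ?_ ?_ ?_ ?_ ?_ ?_ ?_
    · rintro _ ⟨f, hf, -, rfl⟩
      exact (hN' f hf).subst _
    · have := he.subst (single (mu E))
      rwa [← inst_atomSum lo h0]
    · rintro _ ⟨f, hf, hgf, rfl⟩ α x hx
      rcases mem_outs_inst.1 hx with ⟨g₀, h₀, rfl⟩ | ⟨h0, _⟩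
      · rcases hc f hf α g₀ h₀ with h | ⟨rfl, h⟩
        · exact .inl (List.mem_map.2 ⟨_, h, rfl⟩)
        · exact .inr ⟨rfl, g₀, h, hgf.tail h₀, rfl⟩
      · exact (key f hgf h0).elim
    · rintro _ ⟨f, hf, hgf, rfl⟩ k hk
      rcases mem_exps_inst_mu.1 hk with h | ⟨h, _⟩
      · exact List.mem_map.2 ⟨_, hcv f hf _ h, rfl⟩
      · exact (key f hgf h).elim
    · intro α x hx
      obtain ⟨⟨β, g₀⟩, h₀, e⟩ := List.mem_map.1 hx
      cases e
      obtain ⟨f, hf, h⟩ := hs _ _ h₀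
      exact ⟨_, hf.subst _, mem_outs_inst.2 (.inl ⟨_, h, rfl⟩)⟩
    · intro k hk
      obtain ⟨_ | j, hj, rfl⟩ := List.mem_map.1 hk
      · exact (h0 hj).elim
      · obtain ⟨f, hf, h⟩ := hsv _ hj
        exact ⟨_, hf.subst _, mem_exps_inst_mu.2 (.inl h)⟩
    · intro x hx
      obtain ⟨⟨β, g₀⟩, h₀, e⟩ := List.mem_map.1 hx
      cases e
      refine ih g₀ h₀ fun h => ?_
      obtain ⟨f, hf, hg⟩ := hs _ _ h₀
      exact hw (.of_tauReach (hf.tail hg) h)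

/-- A recursion with a silent loop through its variable is a silent prefix followed by the
transitions that leave the loop. -/
theorem provable_mu_of_loop {E h : Expr A} (hb : IsBasic E) (hr : Resolved E)
    (hh : (Act.tau, h) ∈ outs E) (hw : WeaklyExposes 0 h) :
    ∃ lo lk, Flattens E lo lk ∧ Provable (mu E) (mu (pre .tau (atomSum lo lk))) := by
  obtain ⟨lo, lk, hF⟩ := hr.flattens hb (.of_tauReach (.single hh) hw)
  refine ⟨lo, lk, hF, ?_⟩
  -- The target `h` absorbs variable 0, so the summand `τ.h` can be written with the variable
  -- explicit; `Ung3` then produces the silent loop on which `Flattens` operates.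
  have e₁ : Provable E (plus (pre .tau (plus (var 0) h)) E) :=
    ((below_of_mem_outs hb hh).symm.trans (Provable.A1 _ _)).trans (.plus_congr (.pre_congr _
      ((below_of_weaklyExposes (hb.of_mem_outs hh) hw).symm.trans (.A1 _ _))) (.refl _))
  have e₂ : Provable (plus (plus (pre .tau (var 0)) h) E)
      (plus (plus (pre .tau (var 0)) E) nil) :=
    Below.antisymm (.plus (.plus ((Below.left _ _).trans (.left _ _))
        ((below_of_tauReach hb (.single hh)).trans ((Below.right _ _).trans (.left _ _))))
        ((Below.right _ _).trans (.left _ _)))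
      (.plus (.plus ((Below.left _ _).trans (.left _ _)) (.right _ _)) (.nil _))
  refine (Provable.mu_congr e₁).trans ((Provable.Ung3 h E).trans ?_)
  refine (Provable.mu_congr e₂).trans ((hF.eq nil).trans ?_)
  -- `Ung2` trades the loop for a single τ and puts the rest under `pri`, which does not change a
  -- sum of exits.
  refine (Provable.mu_congr (.A4 _)).trans ((Provable.Ung2 _).trans (.mu_congr ?_))
  exact .pre_congr _ (pri_atomSum lo lk)

/-- All expressions that a basic expression reaches by silent transitions are resolved. -/
theorem Resolved.of_isBasic {E : Expr A} (hE : IsBasic E) {e : Expr A} (he : TauReach E e) :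
    Resolved e := by
  induction E generalizing e with
  | pre γ E ih =>
    have key : ∀ g, (Act.tau, g) ∈ outs (pre γ E) → g = E := by
      intro g hg
      simp only [outs, List.mem_singleton, Prod.mk.injEq] at hg
      exact hg.2
    rcases Relation.ReflTransGen.cases_head he with rfl | ⟨g, hg, he⟩
    · exact .step fun g hg => key g hg ▸ ih hE .refl
    · cases key g hg
      exact ih hE he
  | plus E F ihE ihF =>
    rcases Relation.ReflTransGen.cases_head he with rfl | ⟨g, hg, he⟩
    · refine .step fun g hg => ?_
      exact (List.mem_append.1 hg).elim (fun h => ihE hE.1 (.single h))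
        fun h => ihF hE.2 (.single h)
    · exact (List.mem_append.1 hg).elim (fun h => ihE hE.1 (.head h he))
        fun h => ihF hE.2 (.head h he)
  | mu E ih =>
    have hb : IsBasic E := hE
    have main : ∀ h, (Act.tau, h) ∈ outs E → ∀ e₀, TauReach h e₀ →
        Resolved (Expr.inst e₀ (mu E)) := by
      intro h hh e₀ he₀
      by_cases hw : WeaklyExposes 0 e₀
      swap
      · exact (ih hb (.head hh he₀)).inst hw E
      obtain ⟨lo, lk, hF, hP⟩ :=
        provable_mu_of_loop hb (ih hb .refl) hh (.of_tauReach he₀ hw)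
      have h0 : 0 ∉ lk := fun h => (hF.soundVar 0 h).1 rfl
      have reach : ∀ f, WeaklyExposes 0 f → ∀ h, (Act.tau, h) ∈ outs E → ∀ e, TauReach h e →
          TauReach (Expr.inst f (mu E)) (Expr.inst e (mu E)) := by
        rintro f ⟨x, hx, h0⟩ h hh e he
        refine (hx.subst _).trans (.head ?_ (he.subst _))
        exact mem_outs_inst.2 (.inr ⟨h0, mem_outs_mu.2 ⟨h, hh, rfl⟩⟩)
      have hb₀ : IsBasic e₀ := (hb.of_mem_outs hh).of_tauReach he₀
      have hP' : Provable (mu E) (pre .tau (Expr.inst (atomSum lo lk) (mu E))) :=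
        (hP.trans (.Rec1 _)).trans (.pre_congr _ (Provable.inst_congr hP.symm _))
      -- The two absorb each other: `mu E` silently reaches this state, and `e₀` absorbs the
      -- variable that now stands for `mu E`.
      have he : Provable (Expr.inst e₀ (mu E)) (mu E) := by
        apply Below.antisymm
        · refine below_of_tauReach hE (.head (mem_outs_mu.2 ⟨h, hh, rfl⟩) (he₀.subst _))
        · exact (below_of_weaklyExposes hb₀ hw).subst (single (mu E))
      -- The nodes are the instances of all silent derivatives of the body, after at least one step,
      -- that still expose variable 0. Each returns to `mu E` and from there reaches the others.
      refine .loop (fun x => ∃ f, (∃ h, (Act.tau, h) ∈ outs E ∧ TauReach h f) ∧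
          WeaklyExposes 0 f ∧ x = Expr.inst f (mu E))
        (lo.map fun o => (o.1, Expr.inst o.2 (mu E))) (lk.map Nat.pred)
        ⟨e₀, ⟨h, hh, he₀⟩, hw, rfl⟩ ?_ ?_ ?_ ?_ ?_ ?_ ?_
      · rintro _ ⟨f, -, hf, rfl⟩
        exact reach f hf h hh e₀ he₀
      · rw [← inst_atomSum lo h0]
        exact he.trans hP'
      · rintro _ ⟨f, ⟨h', hh', hf'⟩, hf, rfl⟩ α x hx
        rcases mem_outs_inst.1 hx with ⟨g₀, h₀, rfl⟩ | ⟨-, hx⟩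
        · rcases hF.complete f (.head hh' hf') hf α g₀ h₀ with h | ⟨rfl, h⟩
          · exact .inl (List.mem_map.2 ⟨_, h, rfl⟩)
          · exact .inr ⟨rfl, g₀, ⟨h', hh', hf'.tail h₀⟩, h, rfl⟩
        · obtain ⟨g₀, h₀, rfl⟩ := mem_outs_mu.1 hx
          rcases hF.complete E .refl (.of_tauReach (.head hh he₀) hw) α g₀ h₀ with h | ⟨rfl, h⟩
          · exact .inl (List.mem_map.2 ⟨_, h, rfl⟩)
          · exact .inr ⟨rfl, g₀, ⟨g₀, h₀, .refl⟩, h, rfl⟩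
      · rintro _ ⟨f, ⟨h', hh', hf'⟩, hf, rfl⟩ k hk
        rcases mem_exps_inst_mu.1 hk with hk | ⟨-, hk⟩
        · have := (hF.completeVar f (.head hh' hf') hf _ hk).resolve_left (by simp)
          exact List.mem_map.2 ⟨_, this, rfl⟩
        · have := (hF.completeVar E .refl (.of_tauReach (.head hh he₀) hw) _ hk).resolve_left
            (by simp)
          exact List.mem_map.2 ⟨_, this, rfl⟩
      · intro α x hx
        obtain ⟨⟨β, g₀⟩, h₀, e⟩ := List.mem_map.1 hx
        cases e
        obtain ⟨⟨f, hf, hg⟩, -⟩ := hF.sound _ _ h₀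
        rcases Relation.ReflTransGen.cases_head hf with rfl | ⟨h', hh', hf⟩
        · obtain ⟨x, hx, hx0⟩ := hw
          exact ⟨_, hx.subst _, mem_outs_inst.2 (.inr ⟨hx0, mem_outs_mu.2 ⟨_, hg, rfl⟩⟩)⟩
        · exact ⟨_, reach e₀ hw h' hh' f hf, mem_outs_inst.2 (.inl ⟨_, hg, rfl⟩)⟩
      · intro k hk
        obtain ⟨_ | j, hj, rfl⟩ := List.mem_map.1 hk
        · exact (h0 hj).elim
        obtain ⟨-, f, hf, hg⟩ := hF.soundVar _ hj
        rcases Relation.ReflTransGen.cases_head hf with rfl | ⟨h', hh', hf⟩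
        · obtain ⟨x, hx, hx0⟩ := hw
          exact ⟨_, hx.subst _, mem_exps_inst_mu.2 (.inr ⟨hx0, hg⟩)⟩
        · exact ⟨_, reach e₀ hw h' hh' f hf, mem_exps_inst_mu.2 (.inl hg)⟩
      · intro x hx
        obtain ⟨⟨β, g₀⟩, h₀, e⟩ := List.mem_map.1 hx
        cases e
        obtain ⟨⟨f, hf, hg⟩, hwg⟩ := hF.sound _ _ h₀
        exact (ih hb (hf.tail hg)).inst (hwg rfl) E
    have tails : ∀ x, TauReach (mu E) x → x = mu E ∨ ∃ h, (Act.tau, h) ∈ outs E ∧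
        ∃ e₀, TauReach h e₀ ∧ x = Expr.inst e₀ (mu E) := by
      intro x hx
      induction hx with
      | refl => exact .inl rfl
      | tail _ hx ih =>
        have start : ∀ {x}, (Act.tau, x) ∈ outs (mu E) → ∃ h, (Act.tau, h) ∈ outs E ∧
            ∃ e₀, TauReach h e₀ ∧ x = Expr.inst e₀ (mu E) := fun hx => by
          obtain ⟨g₀, h₀, rfl⟩ := mem_outs_mu.1 hx
          exact ⟨g₀, h₀, g₀, .refl, rfl⟩
        rcases ih with rfl | ⟨h, hh, e₀, he₀, rfl⟩
        · exact .inr (start hx)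
        · rcases mem_outs_inst.1 hx with ⟨g₀, h₀, rfl⟩ | ⟨-, hx⟩
          · exact .inr ⟨h, hh, g₀, he₀.tail h₀, rfl⟩
          · exact .inr (start hx)
    rcases tails e he with rfl | ⟨h, hh, e₀, he₀, rfl⟩
    · refine .step fun x hx => ?_
      obtain ⟨g₀, h₀, rfl⟩ := mem_outs_mu.1 hx
      exact main g₀ h₀ g₀ .refl
    · exact main h hh e₀ he₀
  | _ =>
    rcases Relation.ReflTransGen.cases_head he with rfl | ⟨g, hg, _⟩
    · exact .step fun g hg => by simp [outs] at hg
    · simp [outs] at hg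

/-! ### Systems of recursive equations -/

theorem occurs_inst {E F : Expr A} {j : ℕ} (h : Occurs j (inst E F)) :
    Occurs (j + 1) E ∨ (Occurs 0 E ∧ Occurs j F) := by
  obtain ⟨_ | k, hk, h⟩ := occurs_subst h
  · exact .inr ⟨hk, h⟩
  · cases (show j = k from h)
    exact .inl hk

/-- A finite system of equations has closed solutions. -/
theorem exists_solution (n : ℕ) (H : ℕ → Expr A) (hH : ∀ i < n, ∀ k, Occurs k (H i) → k < n) :
    ∃ K : ℕ → Expr A, (∀ i < n, Closed (K i)) ∧ ∀ i < n, Provable (K i) (subst K (H i)) := by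
  induction n generalizing H with
  | zero => exact ⟨fun _ => nil, by simp, by simp⟩
  | succ n ih =>
    have hM : ∀ k, Occurs k (mu (H 0)) → k < n := fun k hk =>
      Nat.succ_lt_succ_iff.1 (hH 0 (by omega) (k + 1) hk)
    -- Elimination of one unknown: unknown 0 is solved by a recursion with the others as parameters,
    -- and this solution is substituted into the remaining equations.
    obtain ⟨K, hc, hK⟩ := ih (fun i => inst (H (i + 1)) (mu (H 0))) fun i hi k hk => by
      rcases occurs_inst hk with h | ⟨_, h⟩
      · exact Nat.succ_lt_succ_iff.1 (hH (i + 1) (by omega) (k + 1) h)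
      · exact hM k h
    refine ⟨scons (subst K (mu (H 0))) K, ?_, ?_⟩
    · rintro (_ | i) hi
      · intro k hk
        obtain ⟨j, hj, hk⟩ := occurs_subst hk
        exact hc j (hM j hj) k hk
      · exact hc i (by omega)
    · rintro (_ | i) hi
      · rw [← subst_inst]
        exact (Provable.Rec1 _).subst K
      · rw [← subst_inst]
        exact hK i (by omega)

/-- A finite system of serial and strongly guarded equations has at most one solution. -/
theorem solution_unique (n : ℕ) (H F G : ℕ → Expr A)
    (hs : ∀ i j, Serial j (H i)) (hg : ∀ i j, Guarded j (H i))
    (hH : ∀ i < n, ∀ k, Occurs k (H i) → k < n)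
    (hF : ∀ i < n, Provable (F i) (subst F (H i)))
    (hG : ∀ i < n, Provable (G i) (subst G (H i))) : ∀ i < n, Provable (F i) (G i) := by
  induction n generalizing H F G with
  | zero => simp
  | succ n ih =>
    have hM : ∀ k, Occurs k (mu (H 0)) → k < n := fun k hk =>
      Nat.succ_lt_succ_iff.1 (hH 0 (by omega) (k + 1) hk)
    have split : ∀ F : ℕ → Expr A, scons (F 0) (fun i => F (i + 1)) = F := by
      intro F; funext i; cases i <;> rfl
    -- `Rec2` forces the value of unknown 0 in terms of the other values.
    have zero : ∀ F : ℕ → Expr A, Provable (F 0) (subst F (H 0)) →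
        Provable (F 0) (subst (fun i => F (i + 1)) (mu (H 0))) := by
      intro F h
      refine .Rec2 ((hs 0 0).subst_upSub _) ((hg 0 0).subst_upSub _) ?_
      rw [inst_subst_upSub, split]
      exact h
    have succ : ∀ F : ℕ → Expr A, (∀ i < n + 1, Provable (F i) (subst F (H i))) →
        ∀ i < n, Provable (F (i + 1))
          (subst (fun i => F (i + 1)) (inst (H (i + 1)) (mu (H 0)))) := by
      intro F h i hi
      rw [subst_inst]
      refine (h (i + 1) (by omega)).trans ?_
      conv_lhs => rw [← split F]
      apply Provable.subst_congr
      rintro (_ | k)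
      · exact zero F (h 0 (by omega))
      · exact .refl _
    have key := ih (fun i => inst (H (i + 1)) (mu (H 0))) (fun i => F (i + 1))
      (fun i => G (i + 1)) ?_ ?_ ?_ (succ F hF) (succ G hG)
    · rintro (_ | i) hi
      · refine (zero F (hF 0 hi)).trans (.trans ?_ (zero G (hG 0 hi)).symm)
        -- The two solutions need not agree outside the system. Variables from there do not occur,
        -- so their values are reset to `nil`.
        rw [subst_congr_occurs (σ' := fun i => if i < n then F (i + 1) else nil)
            fun k hk => by simp [hM k hk],
          subst_congr_occurs (σ := fun i => G (i + 1))
            (σ' := fun i => if i < n then G (i + 1) else nil) fun k hk => by simp [hM k hk]]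
        apply Provable.subst_congr
        intro k
        by_cases hk : k < n
        · simpa [hk] using key k hk
        · simpa [hk] using Provable.refl _
      · exact key i (by omega)
    · intro i j
      apply Serial.subst
      rintro (_ | k) hk
      · exact ⟨hs _ _, hs 0 (j + 1)⟩
      · exact ⟨hs _ _, trivial⟩
    · intro i j
      apply Guarded.subst
      exact fun k _ => hg _ _
    · intro i hi k hk
      rcases occurs_inst hk with h | ⟨_, h⟩
      · exact Nat.succ_lt_succ_iff.1 (hH (i + 1) (by omega) (k + 1) h)
      · exact hM k h

/-- A finite system of equations over a finite type of unknowns, given by sums of prefixes. -/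
theorem exists_solution_of_finite {I : Type*} [Finite I] (W : I → Set (Act A × I))
    (hW : ∀ i, (W i).Finite) (C : I → Expr A) (hC : ∀ i, Closed (C i)) :
    ∃ K : I → Expr A, (∀ i, Closed (K i)) ∧ (∀ i, Below (C i) (K i)) ∧
      (∀ i γ j, (γ, j) ∈ W i → Below (pre γ (K j)) (K i)) ∧
      ∀ i F, Below (C i) F → (∀ γ j, (γ, j) ∈ W i → Below (pre γ (K j)) F) → Below (K i) F := by
  classical
  obtain ⟨n, ⟨e⟩⟩ := Finite.exists_equiv_fin I
  let H' : I → Expr A := fun i => plus (C i)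
    (sum ((hW i).toFinset.toList.map fun o => pre o.1 (var (e o.2))))
  let H : ℕ → Expr A := fun m => if h : m < n then H' (e.symm ⟨m, h⟩) else nil
  have hH' : ∀ i k, Occurs k (H' i) → k < n := by
    intro i k hk
    rcases hk with hk | hk
    · exact (hC i k hk).elim
    · obtain ⟨E, hE, hk⟩ := occurs_sum hk
      obtain ⟨o, -, rfl⟩ := List.mem_map.1 hE
      cases (show k = e o.2 from hk)
      exact (e o.2).2
  obtain ⟨K, hc, hK⟩ := exists_solution n H fun m hm k hk => by
    simp only [H, hm, dif_pos] at hk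
    exact hH' _ _ hk
  have hK' : ∀ i, Provable (K (e i)) (plus (C i)
      (sum ((hW i).toFinset.toList.map fun o => pre o.1 (K (e o.2))))) := by
    intro i
    have := hK (e i) (e i).2
    simp only [H, (e i).2, dif_pos, Fin.eta, Equiv.symm_apply_apply, H', subst,
      (hC i).subst_eq, subst_sum, List.map_map] at this
    exact this
  refine ⟨fun i => K (e i), fun i => hc _ (e i).2, fun i => ?_, fun i γ j h => ?_,
    fun i F h h' => ?_⟩
  · exact (Below.left _ _).trans (.of_provable (hK' i).symm)
  · refine (Below.trans (below_sum ?_) (.right _ _)).trans (.of_provable (hK' i).symm)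
    exact List.mem_map.2 ⟨(γ, j), by simpa using h, rfl⟩
  · refine (Below.of_provable (hK' i)).trans (.plus h (sum_below fun E hE => ?_))
    obtain ⟨⟨γ, j⟩, ho, rfl⟩ := List.mem_map.1 hE
    exact h' γ j (by simpa using ho)

/-! ### Bisimilarity with strict time steps -/

/-- Time transitions under maximal progress. -/
def DeltaStep (x y : Expr A) : Prop :=
  (Act.delta, y) ∈ outs x ∧ ∀ z, (Act.tau, z) ∉ outs x

/-- Weak prioritized transitions. -/
def WeakStep (x : Expr A) (α : PAct A) (y : Expr A) : Prop :=
  ∃ x₁ x₂, TauReach x x₁ ∧ (Act.std α, x₂) ∈ outs x₁ ∧ TauReach x₂ y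

namespace WeakStep

theorem trans_left {x y z : Expr A} {α : PAct A} (h : TauReach x y) (h' : WeakStep y α z) :
    WeakStep x α z := by
  obtain ⟨y₁, y₂, h₁, h₂, h₃⟩ := h'
  exact ⟨y₁, y₂, h.trans h₁, h₂, h₃⟩

theorem trans_right {x y z : Expr A} {α : PAct A} (h : WeakStep x α y) (h' : TauReach y z) :
    WeakStep x α z := by
  obtain ⟨x₁, x₂, h₁, h₂, h₃⟩ := h
  exact ⟨x₁, x₂, h₁, h₂, h₃.trans h'⟩

theorem single {x y : Expr A} {α : PAct A} (h : (Act.std α, y) ∈ outs x) : WeakStep x α y :=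
  ⟨x, y, .refl, h, .refl⟩

theorem tauReach {x y : Expr A} (h : WeakStep x .tau y) : TauReach x y := by
  obtain ⟨x₁, x₂, h₁, h₂, h₃⟩ := h
  exact h₁.trans (.head h₂ h₃)

theorem cases_head {x y : Expr A} {α : PAct A} (h : WeakStep x α y) :
    (∃ z, (Act.std α, z) ∈ outs x ∧ TauReach z y) ∨
      ∃ z, (Act.tau, z) ∈ outs x ∧ WeakStep z α y := by
  obtain ⟨x₁, x₂, h₁, h₂, h₃⟩ := h
  rcases Relation.ReflTransGen.cases_head h₁ with rfl | ⟨z, hz, h₁⟩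
  · exact .inl ⟨x₂, h₂, h₃⟩
  · exact .inr ⟨z, hz, x₁, x₂, h₁, h₂, h₃⟩

theorem exists_tau {x y : Expr A} (h : WeakStep x .tau y) : ∃ z, (Act.tau, z) ∈ outs x := by
  rcases h.cases_head with ⟨z, hz, _⟩ | ⟨z, hz, _⟩ <;> exact ⟨z, hz⟩

theorem of_tauReach {x y : Expr A} (h : TauReach x y) : x = y ∨ WeakStep x .tau y := by
  rcases Relation.ReflTransGen.cases_head h with rfl | ⟨z, hz, h⟩
  · exact .inl rfl
  · exact .inr ⟨x, z, .refl, hz, h⟩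

end WeakStep

theorem TauReach.eq_of_stable {x y : Expr A} (h : TauReach x y)
    (hx : ∀ z, (Act.tau, z) ∉ outs x) : x = y := by
  rcases Relation.ReflTransGen.cases_head h with rfl | ⟨z, hz, _⟩
  · rfl
  · exact (hx z hz).elim

/-- Weak bisimulations in which time steps are not followed by silent transitions. -/
structure IsStrictBisim (β : Expr A → Expr A → Prop) : Prop where
  symm : ∀ {x y}, β x y → β y x
  tau : ∀ {x y x'}, β x y → (Act.tau, x') ∈ outs x → ∃ y', TauReach y y' ∧ β x' y'
  std : ∀ {x y x' α}, β x y → (Act.std α, x') ∈ outs x → α ≠ .tau →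
    ∃ y', WeakStep y α y' ∧ β x' y'
  delta : ∀ {x y x'}, β x y → DeltaStep x x' →
    ∃ y₁ y', TauReach y y₁ ∧ DeltaStep y₁ y' ∧ β x' y'

/-- The largest weak bisimulation with strict time steps. -/
def StrictBisim (x y : Expr A) : Prop := ∃ β, IsStrictBisim β ∧ β x y

theorem isStrictBisim : IsStrictBisim (StrictBisim (A := A)) where
  symm := fun ⟨β, h, hxy⟩ => ⟨β, h, h.symm hxy⟩
  tau := fun ⟨β, h, hxy⟩ hx => by
    obtain ⟨y', h₁, h₂⟩ := h.tau hxy hx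
    exact ⟨y', h₁, β, h, h₂⟩
  std := fun ⟨β, h, hxy⟩ hx hα => by
    obtain ⟨y', h₁, h₂⟩ := h.std hxy hx hα
    exact ⟨y', h₁, β, h, h₂⟩
  delta := fun ⟨β, h, hxy⟩ hx => by
    obtain ⟨y₁, y', h₁, h₂, h₃⟩ := h.delta hxy hx
    exact ⟨y₁, y', h₁, h₂, β, h, h₃⟩

namespace StrictBisim

theorem refl (x : Expr A) : StrictBisim x x := by
  refine ⟨Eq, ⟨Eq.symm, ?_, ?_, ?_⟩, rfl⟩
  · rintro x _ x' rfl h; exact ⟨x', .single h, rfl⟩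
  · rintro x _ x' α rfl h _; exact ⟨x', .single h, rfl⟩
  · rintro x _ x' rfl h; exact ⟨x, x', .refl, h, rfl⟩

theorem symm {x y : Expr A} (h : StrictBisim x y) : StrictBisim y x := isStrictBisim.symm h

theorem tauReach {x y x' : Expr A} (h : StrictBisim x y) (hx : TauReach x x') :
    ∃ y', TauReach y y' ∧ StrictBisim x' y' := by
  induction hx with
  | refl => exact ⟨y, .refl, h⟩
  | tail _ hx ih =>
    obtain ⟨y₁, h₁, h₂⟩ := ih
    obtain ⟨y', h₃, h₄⟩ := isStrictBisim.tau h₂ hx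
    exact ⟨y', h₁.trans h₃, h₄⟩

theorem weakStep {x y x' : Expr A} {α : PAct A} (h : StrictBisim x y) (hx : WeakStep x α x') :
    (∃ y', WeakStep y α y' ∧ StrictBisim x' y') ∨ (α = .tau ∧ StrictBisim x' y) := by
  by_cases hα : α = .tau
  · subst hα
    obtain ⟨y', h₁, h₂⟩ := h.tauReach hx.tauReach
    rcases WeakStep.of_tauReach h₁ with rfl | h₁
    · exact .inr ⟨rfl, h₂⟩
    · exact .inl ⟨y', h₁, h₂⟩
  · obtain ⟨x₁, x₂, h₁, h₂, h₃⟩ := hx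
    obtain ⟨y₁, h₄, h₅⟩ := h.tauReach h₁
    obtain ⟨y₂, h₆, h₇⟩ := isStrictBisim.std h₅ h₂ hα
    obtain ⟨y', h₈, h₉⟩ := h₇.tauReach h₃
    exact .inl ⟨y', .trans_left h₄ (h₆.trans_right h₈), h₉⟩

theorem trans {x y z : Expr A} (h : StrictBisim x y) (h' : StrictBisim y z) :
    StrictBisim x z := by
  refine ⟨fun x z => ∃ y, StrictBisim x y ∧ StrictBisim y z, ⟨?_, ?_, ?_, ?_⟩, y, h, h'⟩
  · rintro x z ⟨y, h, h'⟩; exact ⟨y, h'.symm, h.symm⟩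
  · rintro x z x' ⟨y, h, h'⟩ hx
    obtain ⟨y', h₁, h₂⟩ := isStrictBisim.tau h hx
    obtain ⟨z', h₃, h₄⟩ := h'.tauReach h₁
    exact ⟨z', h₃, y', h₂, h₄⟩
  · rintro x z x' α ⟨y, h, h'⟩ hx hα
    obtain ⟨y', h₁, h₂⟩ := isStrictBisim.std h hx hα
    obtain ⟨z', h₃, h₄⟩ := (h'.weakStep h₁).resolve_right fun h => hα h.1
    exact ⟨z', h₃, y', h₂, h₄⟩
  · rintro x z x' ⟨y, h, h'⟩ hx
    obtain ⟨y₁, y', h₁, h₂, h₃⟩ := isStrictBisim.delta h hx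
    obtain ⟨z₁, h₄, h₅⟩ := h'.tauReach h₁
    obtain ⟨z₂, z', h₆, h₇, h₈⟩ := isStrictBisim.delta h₅ h₂
    exact ⟨z₂, z', h₄.trans h₆, h₇, y', h₃, h₈⟩

end StrictBisim

/-- Rooted bisimulations: initial time steps are matched by time steps. -/
structure IsRootedBisim (ρ : Expr A → Expr A → Prop) : Prop where
  symm : ∀ {x y}, ρ x y → ρ y x
  std : ∀ {x y x' α}, ρ x y → (Act.std α, x') ∈ outs x →
    ∃ y', WeakStep y α y' ∧ StrictBisim x' y'
  delta : ∀ {x y x'}, ρ x y → DeltaStep x x' → ∃ y', DeltaStep y y' ∧ ρ x' y'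

/-- The largest rooted bisimulation. -/
def RootedBisim (x y : Expr A) : Prop := ∃ ρ, IsRootedBisim ρ ∧ ρ x y

theorem isRootedBisim : IsRootedBisim (RootedBisim (A := A)) where
  symm := fun ⟨ρ, h, hxy⟩ => ⟨ρ, h, h.symm hxy⟩
  std := fun ⟨_, h, hxy⟩ hx => h.std hxy hx
  delta := fun ⟨ρ, h, hxy⟩ hx => by
    obtain ⟨y', h₁, h₂⟩ := h.delta hxy hx
    exact ⟨y', h₁, ρ, h, h₂⟩

namespace RootedBisim

theorem refl (x : Expr A) : RootedBisim x x := by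
  refine ⟨Eq, ⟨Eq.symm, ?_, ?_⟩, rfl⟩
  · rintro x _ x' α rfl h; exact ⟨x', .single h, .refl _⟩
  · rintro x _ x' rfl h; exact ⟨x', h, rfl⟩

theorem symm {x y : Expr A} (h : RootedBisim x y) : RootedBisim y x := isRootedBisim.symm h

/-- The root condition forces a genuine step in answer to the first one; later silent steps may be
answered by standing still. -/
theorem weakStep {x y x' : Expr A} {α : PAct A} (h : RootedBisim x y) (hx : WeakStep x α x') :
    ∃ y', WeakStep y α y' ∧ StrictBisim x' y' := by
  rcases hx.cases_head with ⟨z, hz, hx⟩ | ⟨z, hz, hx⟩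
  · obtain ⟨y₁, h₁, h₂⟩ := isRootedBisim.std h hz
    obtain ⟨y', h₃, h₄⟩ := h₂.tauReach hx
    exact ⟨y', h₁.trans_right h₃, h₄⟩
  · obtain ⟨y₁, h₁, h₂⟩ := isRootedBisim.std h hz
    rcases h₂.weakStep hx with ⟨y', h₃, h₄⟩ | ⟨rfl, h₃⟩
    · exact ⟨y', .trans_left h₁.tauReach h₃, h₄⟩
    · exact ⟨y₁, h₁, h₃⟩

theorem trans {x y z : Expr A} (h : RootedBisim x y) (h' : RootedBisim y z) :
    RootedBisim x z := by
  refine ⟨fun x z => ∃ y, RootedBisim x y ∧ RootedBisim y z, ⟨?_, ?_, ?_⟩, y, h, h'⟩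
  · rintro x z ⟨y, h, h'⟩; exact ⟨y, h'.symm, h.symm⟩
  · rintro x z x' α ⟨y, h, h'⟩ hx
    obtain ⟨y', h₁, h₂⟩ := isRootedBisim.std h hx
    obtain ⟨z', h₃, h₄⟩ := h'.weakStep h₁
    exact ⟨z', h₃, h₂.trans h₄⟩
  · rintro x z x' ⟨y, h, h'⟩ hx
    obtain ⟨y', h₁, h₂⟩ := isRootedBisim.delta h hx
    obtain ⟨z', h₃, h₄⟩ := isRootedBisim.delta h' h₁
    exact ⟨z', h₃, y', h₂, h₄⟩

end RootedBisim

/-! ### Canonical expressions for the states of a finite transition system -/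

/-- A finite set of processes that is closed under transitions. -/
structure IsSystem (D : Set (Expr A)) : Prop where
  finite : D.Finite
  closed : ∀ {x γ y}, x ∈ D → (γ, y) ∈ outs x → y ∈ D

namespace IsSystem

variable {D : Set (Expr A)}

theorem tauReach (hD : IsSystem D) {x y : Expr A} (hx : x ∈ D) (h : TauReach x y) : y ∈ D := by
  induction h with
  | refl => exact hx
  | tail _ h ih => exact hD.closed ih h

theorem weakStep (hD : IsSystem D) {x y : Expr A} {α : PAct A} (hx : x ∈ D)
    (h : WeakStep x α y) : y ∈ D := by
  obtain ⟨x₁, x₂, h₁, h₂, h₃⟩ := h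
  exact hD.tauReach (hD.closed (hD.tauReach hx h₁) h₂) h₃

theorem finite_labels (hD : IsSystem D) : {γ | ∃ x ∈ D, ∃ y, (γ, y) ∈ outs x}.Finite := by
  have : {γ | ∃ x ∈ D, ∃ y, (γ, y) ∈ outs x} =
      ⋃ x ∈ D, {γ | γ ∈ (outs x).map Prod.fst} := by
    ext γ; simp
  rw [this]
  exact hD.finite.biUnion fun x _ => List.finite_toSet _

theorem finite_weakSteps (hD : IsSystem D) {x : Expr A} (hx : x ∈ D) :
    {o : Act A × Expr A | ∃ α, o.1 = .std α ∧ WeakStep x α o.2}.Finite := by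
  refine (hD.finite_labels.prod hD.finite).subset ?_
  rintro ⟨_, y⟩ ⟨α, rfl, h⟩
  refine ⟨?_, hD.weakStep hx h⟩
  obtain ⟨x₁, x₂, h₁, h₂, _⟩ := h
  exact ⟨x₁, hD.tauReach hx h₁, x₂, h₂⟩

theorem exists_list_weakSteps (hD : IsSystem D) {x : Expr A} (hx : x ∈ D) :
    ∃ l : List (Act A × Expr A), ∀ γ y, (γ, y) ∈ l ↔ ∃ α, γ = .std α ∧ WeakStep x α y :=
  ⟨(hD.finite_weakSteps hx).toFinset.toList, fun γ y => by simp⟩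

end IsSystem

/-- `K x` is a sum that represents the bisimilarity class of the state `x`. -/
structure IsCanonical (D : Set (Expr A)) (K : Expr A → Expr A) : Prop where
  closed : ∀ {x}, x ∈ D → Closed (K x)
  congr : ∀ {x y}, x ∈ D → y ∈ D → StrictBisim x y → K x = K y
  std : ∀ {x y α}, x ∈ D → WeakStep x α y → (α = .tau → ¬ StrictBisim x y) →
    Below (pre (.std α) (K y)) (K x)
  delta : ∀ {x y}, x ∈ D → DeltaStep x y → Below (pre .delta (K y)) (K x)
  elim : ∀ {x F}, x ∈ D →
    (∀ α y, WeakStep x α y → (α = .tau → ¬ StrictBisim x y) → Below (pre (.std α) (K y)) F) →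
    (∀ x₁ y, x₁ ∈ D → StrictBisim x₁ x → DeltaStep x₁ y → Below (pre .delta (K y)) F) →
    Below (K x) F

/-- Each class is one unknown, with the weak transitions of all members as summands. Silent steps
inside the class are omitted, because a bisimilar state may match them by standing still. Time steps
are collected from every member, since a given one may be unstable. -/
theorem exists_canonical {D : Set (Expr A)} (hD : IsSystem D) : ∃ K, IsCanonical D K := by
  classical
  let s : Setoid D := ⟨fun x y => StrictBisim x.1 y.1,
    ⟨fun x => .refl x.1, fun h => h.symm, fun h h' => h.trans h'⟩⟩
  have : Finite D := hD.finite
  let W : Quotient s → Set (Act A × Quotient s) := fun c => {o | ∃ x y : D, ⟦x⟧ = c ∧ ⟦y⟧ = o.2 ∧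
    ((∃ α, o.1 = .std α ∧ WeakStep x.1 α y.1 ∧ (α = .tau → ¬ StrictBisim x.1 y.1)) ∨
      (o.1 = .delta ∧ DeltaStep x.1 y.1))}
  have hW : ∀ c, (W c).Finite := by
    intro c
    refine (hD.finite_labels.prod (Set.finite_univ (α := Quotient s))).subset ?_
    rintro ⟨γ, c'⟩ ⟨x, y, -, -, ⟨α, e, ⟨x₁, x₂, h₁, h₂, _⟩, _⟩ | ⟨e, h⟩⟩ <;> cases e
    · exact ⟨⟨x₁, hD.tauReach x.2 h₁, x₂, h₂⟩, trivial⟩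
    · exact ⟨⟨x.1, x.2, y.1, h.1⟩, trivial⟩
  obtain ⟨K, hc, -, hK, hE⟩ := exists_solution_of_finite W hW (fun _ => nil) fun _ _ => id
  let K' : Expr A → Expr A := fun x => if h : x ∈ D then K ⟦⟨x, h⟩⟧ else nil
  have eq : ∀ {x} (h : x ∈ D), K' x = K ⟦⟨x, h⟩⟧ := fun h => dif_pos h
  have congr : ∀ {x y}, x ∈ D → y ∈ D → StrictBisim x y → K' x = K' y := by
    intro x y hx hy h
    rw [eq hx, eq hy, Quotient.sound (s := s) (a := ⟨x, hx⟩) (b := ⟨y, hy⟩) h]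
  refine ⟨K', fun h => eq h ▸ hc _, congr, ?_, ?_, ?_⟩
  · intro x y α hx h hb
    have hy := hD.weakStep hx h
    rw [eq hx, eq hy]
    exact hK _ _ _ ⟨⟨x, hx⟩, ⟨y, hy⟩, rfl, rfl, .inl ⟨α, rfl, h, hb⟩⟩
  · intro x y hx h
    have hy := hD.closed hx h.1
    rw [eq hx, eq hy]
    exact hK _ _ _ ⟨⟨x, hx⟩, ⟨y, hy⟩, rfl, rfl, .inr ⟨rfl, h⟩⟩
  · intro x F hx h₁ h₂
    rw [eq hx]
    refine hE _ _ (.nil _) ?_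
    rintro γ _ ⟨x₁, y, hx₁, rfl, ⟨α, e, h, hb⟩ | ⟨e, h⟩⟩ <;> cases e <;>
      have hx₁ : StrictBisim x₁.1 x := Quotient.exact hx₁
    · have hy : K ⟦y⟧ = K' y.1 := (eq y.2).symm
      rw [hy]
      rcases hx₁.weakStep h with ⟨y', h₃, h₄⟩ | ⟨rfl, h₃⟩
      · rw [congr y.2 (hD.weakStep hx h₃) h₄]
        exact h₁ _ _ h₃ fun e h => hb e (hx₁.trans (h.trans h₄.symm))
      · exact (hb rfl (hx₁.trans h₃.symm)).elim
    · have hy : K ⟦y⟧ = K' y.1 := (eq y.2).symm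
      rw [hy]
      exact h₂ _ _ x₁.2 hx₁ h

/-- `R x` is a sum that represents the rooted bisimilarity class of the state `x`. -/
structure IsRootedCanonical (D : Set (Expr A)) (K R : Expr A → Expr A) : Prop where
  congr : ∀ {x y}, x ∈ D → y ∈ D → RootedBisim x y → R x = R y
  std : ∀ {x y α}, x ∈ D → WeakStep x α y → Below (pre (.std α) (K y)) (R x)
  delta : ∀ {x y}, x ∈ D → DeltaStep x y → Below (pre .delta (R y)) (R x)
  elim : ∀ {x F}, x ∈ D → (∀ α y, WeakStep x α y → Below (pre (.std α) (K y)) F) →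
    (∀ y, DeltaStep x y → Below (pre .delta (R y)) F) → Below (R x) F

/-- Only time steps lead to further rooted classes, so only they carry unknowns. The prioritized
part is a closed constant built from `K`, read off at a representative; silent steps inside a strict
class are kept, since at the root they must be matched by a move. -/
theorem exists_rootedCanonical {D : Set (Expr A)} (hD : IsSystem D) {K : Expr A → Expr A}
    (hK : IsCanonical D K) : ∃ R, IsRootedCanonical D K R := by
  classical
  let s : Setoid D := ⟨fun x y => RootedBisim x.1 y.1,
    ⟨fun x => .refl x.1, fun h => h.symm, fun h h' => h.trans h'⟩⟩
  have : Finite D := hD.finite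
  let W : Quotient s → Set (Act A × Quotient s) := fun c =>
    {o | o.1 = .delta ∧ ∃ x y : D, ⟦x⟧ = c ∧ ⟦y⟧ = o.2 ∧ DeltaStep x.1 y.1}
  have hW : ∀ c, (W c).Finite := by
    intro c
    refine (hD.finite_labels.prod (Set.finite_univ (α := Quotient s))).subset ?_
    rintro ⟨γ, c'⟩ ⟨e, x, y, -, -, h⟩
    cases e
    exact ⟨⟨x.1, x.2, y.1, h.1⟩, trivial⟩
  choose l hl using fun x : D => hD.exists_list_weakSteps x.2
  let C : Quotient s → Expr A := fun c => preSum ((l c.out).map fun o => (o.1, K o.2))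
  have hC : ∀ c, Closed (C c) := by
    intro c k hk
    obtain ⟨E, hE, hk⟩ := occurs_sum hk
    simp only [List.mem_map, Prod.exists] at hE
    obtain ⟨_, _, ⟨γ, y, ho, e⟩, rfl⟩ := hE
    cases e
    obtain ⟨α, -, h⟩ := (hl _ _ _).1 ho
    exact hK.closed (hD.weakStep c.out.2 h) k hk
  obtain ⟨R, -, hRC, hR, hE⟩ := exists_solution_of_finite W hW C hC
  let R' : Expr A → Expr A := fun x => if h : x ∈ D then R ⟦⟨x, h⟩⟧ else nil
  have eq : ∀ {x} (h : x ∈ D), R' x = R ⟦⟨x, h⟩⟧ := fun h => dif_pos h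
  have congr : ∀ {x y}, x ∈ D → y ∈ D → RootedBisim x y → R' x = R' y := by
    intro x y hx hy h
    rw [eq hx, eq hy, Quotient.sound (s := s) (a := ⟨x, hx⟩) (b := ⟨y, hy⟩) h]
  have out : ∀ {x} (hx : x ∈ D), RootedBisim (Quotient.out (⟦⟨x, hx⟩⟧ : Quotient s)).1 x :=
    fun hx => Quotient.mk_out (s := s) ⟨_, hx⟩
  refine ⟨R', congr, ?_, ?_, ?_⟩
  · intro x y α hx h
    rw [eq hx]
    refine Below.trans ?_ (hRC _)
    obtain ⟨y', h₁, h₂⟩ := (out hx).symm.weakStep h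
    rw [hK.congr (hD.weakStep hx h) (hD.weakStep (Quotient.out (⟦⟨x, hx⟩⟧ : Quotient s)).2 h₁) h₂]
    exact below_preSum (List.mem_map.2 ⟨(_, y'), (hl _ _ _).2 ⟨α, rfl, h₁⟩, rfl⟩)
  · intro x y hx h
    have hy := hD.closed hx h.1
    rw [eq hx, eq hy]
    exact hR _ _ _ ⟨rfl, ⟨x, hx⟩, ⟨y, hy⟩, rfl, rfl, h⟩
  · intro x F hx h₁ h₂
    rw [eq hx]
    refine hE _ _ (preSum_below fun γ G hG => ?_) ?_
    · obtain ⟨⟨γ', y⟩, ho, e⟩ := List.mem_map.1 hG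
      cases e
      obtain ⟨α, e, h⟩ := (hl _ _ _).1 ho
      cases e
      obtain ⟨y', h₃, h₄⟩ := (out hx).weakStep h
      simp only
      rw [hK.congr (hD.weakStep (Quotient.out (⟦⟨x, hx⟩⟧ : Quotient s)).2 h)
        (hD.weakStep hx h₃) h₄]
      exact h₁ _ _ h₃
    · rintro γ _ ⟨e, x₁, y, hx₁, rfl, h⟩
      cases e
      have hx₁ : RootedBisim x₁.1 x := Quotient.exact hx₁
      obtain ⟨y', h₃, h₄⟩ := isRootedBisim.delta hx₁ h
      have hy : R ⟦y⟧ = R' y.1 := (eq y.2).symm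
      rw [hy, congr y.2 (hD.closed hx h₃.1) h₄]
      exact h₂ _ h₃

/-- Silent prefixes after time prefixes are redundant below a prioritized prefix. -/
theorem pre_plus_delta_tau (α : PAct A) {I : Type*} (f : I → Expr A) (l : List I) (C : Expr A) :
    Provable (pre (.std α) (plus C (sum (l.map fun i => pre .delta (pre .tau (f i))))))
      (pre (.std α) (plus C (sum (l.map fun i => pre .delta (f i))))) := by
  induction l generalizing C with
  | nil => exact .refl _
  | cons i l ih =>
    have e : ∀ C a s : Expr A, Provable (plus C (plus a s)) (plus (plus C s) a) := fun C a s =>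
      (Provable.plus_congr (.refl C) (.A1 a s)).trans (.symm (.A2 C s a))
    have e' : ∀ C a s : Expr A, Provable (plus (plus C s) a) (plus (plus C a) s) := fun C a s =>
      (e C a s).symm.trans (.symm (.A2 C a s))
    set s := sum (l.map fun i => pre .delta (pre .tau (f i)))
    -- `Tau4` for a context whose hole is a single summand removes one τ; the rest of the list is
    -- handled by induction with this summand moved into `C`.
    have h := Provable.Tau4 α (f i) (plus (shift (plus C s)) (var 0))
      ⟨Serial.of_not_occurs (not_occurs_zero_shift _), trivial⟩
    have hi : ∀ G, inst (plus (shift (plus C s)) (var 0)) G = plus (plus C s) G := fun G =>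
      congrArg (fun E => plus E G) (inst_shift (plus C s) G)
    rw [hi, hi] at h
    refine (Provable.pre_congr _ (e _ _ _)).trans (h.trans ?_)
    refine (Provable.pre_congr _ (e' _ _ _)).trans ((ih _).trans (.pre_congr _ ?_))
    exact .A2 _ _ _

/-- Uniqueness of solutions for chains of time steps. -/
theorem delta_solution_unique {I : Type*} [Finite I] (C : I → Expr A) (hC : ∀ i, Closed (C i))
    (l : I → List I) (F G : I → Expr A)
    (hF : ∀ i, Provable (F i)
      (pre .tau (plus (C i) (sum ((l i).map fun j => pre .delta (F j))))))
    (hG : ∀ i, Provable (G i)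
      (pre .tau (plus (C i) (sum ((l i).map fun j => pre .delta (G j)))))) (i : I) :
    Provable (F i) (G i) := by
  classical
  obtain ⟨n, ⟨e⟩⟩ := Finite.exists_equiv_fin I
  let H' : I → Expr A := fun i =>
    pre .tau (plus (C i) (sum ((l i).map fun j => pre .delta (var (e j)))))
  let H : ℕ → Expr A := fun m => if h : m < n then H' (e.symm ⟨m, h⟩) else nil
  let ext : (I → Expr A) → ℕ → Expr A := fun F m => if h : m < n then F (e.symm ⟨m, h⟩) else nil
  have ext_eq : ∀ F i, ext F (e i) = F i := fun F i => by simp [ext]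
  have main : ∀ F : I → Expr A, (∀ i, Provable (F i)
      (pre .tau (plus (C i) (sum ((l i).map fun j => pre .delta (F j)))))) →
      ∀ m < n, Provable (ext F m) (subst (ext F) (H m)) := by
    intro F hF m hm
    have := hF (e.symm ⟨m, hm⟩)
    simp only [H, hm, dif_pos, H', subst, (hC _).subst_eq, subst_sum, List.map_map]
    have e₁ : ext F m = F (e.symm ⟨m, hm⟩) := dif_pos hm
    rw [e₁]
    convert this using 6
    simp only [Function.comp, subst, ext_eq]
  -- The unknowns occur only behind δ, and the constants `C i` are closed, so the system is serial
  -- and strongly guarded.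
  have := solution_unique n H (ext F) (ext G) ?_ ?_ ?_ (main F hF) (main G hG) (e i) (e i).2
  · rwa [ext_eq, ext_eq] at this
  · intro m j
    by_cases hm : m < n
    · simp only [H, hm, dif_pos]
      refine ⟨Serial.of_not_occurs (hC _ j), sum_serial fun E hE => ?_⟩
      obtain ⟨i, -, rfl⟩ := List.mem_map.1 hE
      trivial
    · simp only [H, hm, dif_neg, not_false_eq_true]
      exact id
  · intro m j
    by_cases hm : m < n
    · simp only [H, hm, dif_pos]
      refine .inr ⟨Guarded.of_not_occurs (hC _ j), sum_guarded fun E hE => ?_⟩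
      obtain ⟨i, -, rfl⟩ := List.mem_map.1 hE
      exact .inl (by simp)
    · simp only [H, hm, dif_neg, not_false_eq_true]
      trivial
  · intro m hm k hk
    simp only [H, hm, dif_pos] at hk
    rcases hk with hk | hk
    · exact (hC _ k hk).elim
    · obtain ⟨E, hE, hk⟩ := occurs_sum hk
      obtain ⟨i, -, rfl⟩ := List.mem_map.1 hE
      cases (show k = e i from hk)
      exact (e i).2

section Core

variable {D : Set (Expr A)} {K R : Expr A → Expr A}

/-- After a silent prefix, the canonical expression of a state is determined by its own
transitions. -/
theorem IsCanonical.tau_eq (hD : IsSystem D) (hK : IsCanonical D K) {x : Expr A} (hx : x ∈ D)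
    {B : Expr A} (h₁ : ∀ α y, WeakStep x α y → Below (pre (.std α) (K y)) B)
    (h₂ : ∀ y, DeltaStep x y → Below (pre .delta (K y)) B)
    (h₃ : ∀ F, (∀ α y, WeakStep x α y → Below (pre (.std α) (K y)) F) →
      (∀ y, DeltaStep x y → Below (pre .delta (K y)) F) → Below B F) :
    Provable (pre .tau B) (pre .tau (K x)) := by
  -- If `x` has a silent step within its class, its own sum is already `τ.K x` and `Tau1` merges the
  -- two prefixes. Otherwise the sum equals `K x` itself.
  by_cases hl : ∃ x', WeakStep x .tau x' ∧ StrictBisim x x'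
  · obtain ⟨x', hw, hb⟩ := hl
    have e : Provable B (pre .tau (K x)) := by
      apply Below.antisymm
      · apply h₃
        · intro α y h
          by_cases hy : α = .tau ∧ StrictBisim x y
          · obtain ⟨rfl, hy⟩ := hy
            rw [hK.congr hx (hD.weakStep hx h) hy]
            exact .refl _
          · exact (hK.std hx h fun e h => hy ⟨e, h⟩).trans (.tau _)
        · intro y h
          obtain ⟨z, hz⟩ := hw.exists_tau
          exact (h.2 z hz).elim
      · rw [hK.congr hx (hD.weakStep hx hw) hb]
        exact h₁ _ _ hw
    exact (Provable.pre_congr _ e).trans (.Tau1 _ _)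
  · apply Provable.pre_congr
    apply Below.antisymm
    · exact h₃ _ (fun α y h => hK.std hx h fun e hb => hl ⟨y, e ▸ h, hb⟩)
        fun y h => hK.delta hx h
    · refine hK.elim hx (fun α y h _ => h₁ α y h) fun x₁ y hx₁ hb h => ?_
      -- The member `x₁` is stable, so it could only match a silent step of `x` by standing still;
      -- that step would stay in the class. Hence `x` is stable and must itself perform a time step.
      have hs : ∀ z, (Act.tau, z) ∉ outs x := fun z hz => by
        obtain ⟨x₂, h₄, h₅⟩ := isStrictBisim.tau hb.symm hz
        cases TauReach.eq_of_stable h₄ h.2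
        exact hl ⟨z, .single hz, hb.symm.trans h₅.symm⟩
      obtain ⟨x₂, y', h₄, h₅, h₆⟩ := isStrictBisim.delta hb h
      cases TauReach.eq_of_stable h₄ hs
      rw [hK.congr (hD.closed hx₁ h.1) (hD.closed hx h₅.1) h₆]
      exact h₂ _ h₅

/-- Rooted and unrooted canonical expressions agree below prioritized prefixes. -/
theorem IsRootedCanonical.pre_eq (hD : IsSystem D) (hK : IsCanonical D K)
    (hR : IsRootedCanonical D K R) {x : Expr A} (hx : x ∈ D) (α : PAct A) :
    Provable (pre (.std α) (R x)) (pre (.std α) (K x)) := by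
  classical
  have : Finite D := hD.finite
  choose w hw using fun x : D => hD.exists_list_weakSteps x.2
  let C : D → Expr A := fun x => preSum ((w x).map fun o => (o.1, K o.2))
  have hC : ∀ x, Closed (C x) := by
    intro x k hk
    obtain ⟨E, hE, hk⟩ := occurs_sum hk
    simp only [List.mem_map, Prod.exists] at hE
    obtain ⟨_, _, ⟨γ, y, ho, e⟩, rfl⟩ := hE
    cases e
    obtain ⟨α, -, h⟩ := (hw _ _ _).1 ho
    exact hK.closed (hD.weakStep x.2 h) k hk
  have hCw : ∀ (x : D) α y, WeakStep x.1 α y → Below (pre (.std α) (K y)) (C x) :=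
    fun x α y h => below_preSum (List.mem_map.2 ⟨(_, y), (hw _ _ _).2 ⟨α, rfl, h⟩, rfl⟩)
  have hCe : ∀ (x : D) F, (∀ α y, WeakStep x.1 α y → Below (pre (.std α) (K y)) F) →
      Below (C x) F := by
    refine fun x F h => preSum_below fun γ G hG => ?_
    obtain ⟨⟨γ', y⟩, ho, e⟩ := List.mem_map.1 hG
    cases e
    obtain ⟨α, e, h'⟩ := (hw _ _ _).1 ho
    cases e
    exact h _ _ h'
  let l : D → List D := fun x => (Set.toFinite {y : D | DeltaStep x.1 y.1}).toFinset.toList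
  have hl : ∀ x y, y ∈ l x ↔ DeltaStep x.1 y.1 := fun x y => by simp [l]
  have hle : ∀ (f : Expr A → Expr A) (x : D) F,
      (∀ y, DeltaStep x.1 y → Below (pre .delta (f y)) F) →
      Below (sum ((l x).map fun y => pre .delta (f y.1))) F := by
    refine fun f x F h => sum_below fun E hE => ?_
    obtain ⟨y, hy, rfl⟩ := List.mem_map.1 hE
    exact h _ ((hl _ _).1 hy)
  have hlb : ∀ (f : Expr A → Expr A) (x : D) y, DeltaStep x.1 y →
      Below (pre .delta (f y)) (sum ((l x).map fun y => pre .delta (f y.1))) :=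
    fun f x y h => below_sum
      (List.mem_map.2 ⟨⟨y, hD.closed x.2 h.1⟩, (hl _ _).2 h, rfl⟩)
  -- Both `τ.R` and `τ.K` satisfy `F x = τ.(C x + Σ δ.F y)`: the first by the summands of `R`, the
  -- second by `tau_eq`. In both, `Tau4` supplies the τ behind each δ.
  have main := delta_solution_unique C hC l (fun x => pre .tau (R x.1))
    (fun x => pre .tau (K x.1)) ?_ ?_ ⟨x, hx⟩
  · exact (Provable.Tau1 α _).symm.trans ((Provable.pre_congr _ main).trans (.Tau1 α _))
  · intro x
    refine .trans (.pre_congr _ ?_) (pre_plus_delta_tau _ (fun y : D => R y.1) (l x) (C x)).symm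
    apply Below.antisymm
    · exact hR.elim x.2 (fun α y h => (hCw x α y h).trans (.left _ _))
        fun y h => (hlb R x y h).trans (.right _ _)
    · exact .plus (hCe x _ fun α y h => hR.std x.2 h) (hle R x _ fun y h => hR.delta x.2 h)
  · intro x
    refine .trans ?_ (pre_plus_delta_tau _ (fun y : D => K y.1) (l x) (C x)).symm
    refine (hK.tau_eq hD x.2 (fun α y h => (hCw x α y h).trans (.left _ _))
      (fun y h => (hlb K x y h).trans (.right _ _)) fun F h₁ h₂ => ?_).symm
    exact .plus (hCe x _ h₁) (hle K x _ h₂)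

end Core

/-! ### Basic processes are equal to their canonical expressions -/

theorem Below.pri {E F : Expr A} (h : Below E F) : Below (pri E) (pri F) :=
  (Provable.Pri4 F E).symm.trans (.pri_congr h)

theorem Below.pre_pri {E F : Expr A} {α : PAct A} (h : Below (pre (.std α) E) F) :
    Below (pre (.std α) E) (Expr.pri F) :=
  (Below.of_provable (Provable.Pri2 α E).symm).trans h.pri

section Canonical

variable {D : Set (Expr A)} {K R : Expr A → Expr A}

theorem IsCanonical.pre_below_of_tauReach (hD : IsSystem D) (hK : IsCanonical D K)
    {z y : Expr A} (hz : z ∈ D) (h : TauReach z y) (α : PAct A) :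
    Below (pre (.std α) (K y)) (pre (.std α) (K z)) := by
  rcases WeakStep.of_tauReach h with rfl | h
  · exact .refl _
  · by_cases hb : StrictBisim z y
    · rw [hK.congr hz (hD.weakStep hz h) hb]
      exact .refl _
    · exact (hK.std hz h fun _ => hb).pre_std α

theorem IsCanonical.pre_below_of_weakStep (hD : IsSystem D) (hK : IsCanonical D K)
    {z y : Expr A} (hz : z ∈ D) {α : PAct A} (h : WeakStep z α y) :
    Below (pre (.std α) (K y)) (pre .tau (K z)) := by
  by_cases hb : α = .tau ∧ StrictBisim z y
  · obtain ⟨rfl, hb⟩ := hb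
    rw [hK.congr hz (hD.weakStep hz h) hb]
    exact .refl _
  · exact (hK.std hz h fun e h => hb ⟨e, h⟩).trans (.tau _)

/-- Saturation is derivable: a weak transition is absorbed by the prefix of its first raw step,
through `Tau2` and `Tau3`. -/
theorem IsRootedCanonical.elim_outs (hD : IsSystem D) (hK : IsCanonical D K)
    (hR : IsRootedCanonical D K R) {x F : Expr A} (hx : x ∈ D)
    (h₁ : ∀ α y, (Act.std α, y) ∈ outs x → Below (pre (.std α) (K y)) F)
    (h₂ : ∀ y, DeltaStep x y → Below (pre .delta (R y)) F) : Below (R x) F := by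
  refine hR.elim hx (fun α y h => ?_) h₂
  rcases h.cases_head with ⟨z, hz, h⟩ | ⟨z, hz, h⟩
  · exact (hK.pre_below_of_tauReach hD (hD.closed hx hz) h α).trans (h₁ _ _ hz)
  · exact (hK.pre_below_of_weakStep hD (hD.closed hx hz) h).trans (h₁ _ _ hz)

theorem IsRootedCanonical.pri_elim (hD : IsSystem D) (hK : IsCanonical D K)
    (hR : IsRootedCanonical D K R) {x F : Expr A} (hx : x ∈ D)
    (h : ∀ α y, (Act.std α, y) ∈ outs x → Below (pre (.std α) (K y)) F) :
    Below (pri (R x)) F := by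
  let t : Act A × Expr A → Expr A := fun o =>
    match o.1 with
    | .std α => pre (.std α) (K o.2)
    | .delta => pre .delta (R o.2)
  have h' : Below (R x) (sum ((outs x).map t)) := by
    refine hR.elim_outs hD hK hx (fun α y h => ?_) fun y h => ?_
    · exact below_sum (List.mem_map.2 ⟨_, h, rfl⟩)
    · exact below_sum (List.mem_map.2 ⟨_, h.1, rfl⟩)
  have key : ∀ l : List (Act A × Expr A), (∀ o ∈ l, o ∈ outs x) →
      Below (pri (sum (l.map t))) F := by
    intro l hl
    induction l with
    | nil => exact (Below.of_provable .Pri1).trans (.nil _)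
    | cons o l ih =>
      refine (Below.of_provable (.Pri4 _ _)).trans
        (.plus ?_ (ih fun o ho => hl o (by simp [ho])))
      have ho := hl o (by simp)
      obtain ⟨α | _, y⟩ := o
      · exact (Below.of_provable (.Pri2 _ _)).trans (h _ _ ho)
      · exact (Below.of_provable (.Pri3 _)).trans (.nil _)
  exact h'.pri.trans (key _ fun _ h => h)

/-- The canonical expression of a state is the sum given by any list of its transitions. -/
theorem IsRootedCanonical.eq_list (hD : IsSystem D) (hK : IsCanonical D K)
    (hR : IsRootedCanonical D K R) {x : Expr A} (hx : x ∈ D) (os : List (Act A × Expr A))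
    (ks : List ℕ) (p : ℕ → Expr A) (hp : ∀ k, p k ∈ D)
    (hs : ∀ γ y, (γ, y) ∈ outs x ↔
      (∃ g, (γ, g) ∈ os ∧ y = subst p g) ∨ ∃ k ∈ ks, (γ, y) ∈ outs (p k))
    (ho : ∀ γ g, (γ, g) ∈ os → Provable (subst (fun k => R (p k)) g) (R (subst p g))) :
    Provable (R x) (subst (fun k => R (p k)) (plus (preSum os) (varSum ks))) := by
  have e : subst (fun k => R (p k)) (plus (preSum os) (varSum ks)) =
      plus (sum (os.map fun o => pre o.1 (subst (fun k => R (p k)) o.2)))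
        (sum (ks.map fun k => R (p k))) := by
    simp only [subst, preSum, varSum, subst_sum, List.map_map]; rfl
  rw [e]
  -- A raw time step of an unstable state is not a transition, but its prefix is absorbed by the
  -- silent summand of `R x`.
  have delta : ∀ y, (Act.delta, y) ∈ outs x → Below (pre .delta (R y)) (R x) := by
    intro y hy
    by_cases hst : ∀ z, (Act.tau, z) ∉ outs x
    · exact hR.delta hx ⟨hy, hst⟩
    · push Not at hst
      obtain ⟨z, hz⟩ := hst
      exact Below.delta (hR.std hx (.single hz)) _
  apply Below.antisymm
  · refine hR.elim_outs hD hK hx (fun α y h => ?_) fun y h => ?_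
    · rcases (hs _ _).1 h with ⟨g, hg, rfl⟩ | ⟨k, hk, hy⟩
      · refine (Below.of_provable ?_).trans
          ((below_sum (List.mem_map.2 ⟨_, hg, rfl⟩)).trans (.left _ _))
        exact (hR.pre_eq hD hK (hD.closed hx h) α).symm.trans (.pre_congr _ (ho _ _ hg).symm)
      · exact (hR.std (hp k) (.single hy)).trans
          ((below_sum (List.mem_map.2 ⟨k, hk, rfl⟩)).trans (.right _ _))
    · rcases (hs _ _).1 h.1 with ⟨g, hg, rfl⟩ | ⟨k, hk, hy⟩
      · exact (Below.of_provable (.pre_congr _ (ho _ _ hg).symm)).trans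
          ((below_sum (List.mem_map.2 ⟨_, hg, rfl⟩)).trans (.left _ _))
      · refine (hR.delta (hp k) ⟨hy, fun z hz => ?_⟩).trans
          ((below_sum (List.mem_map.2 ⟨k, hk, rfl⟩)).trans (.right _ _))
        exact h.2 z ((hs _ _).2 (.inr ⟨k, hk, hz⟩))
  · refine .plus (sum_below fun E hE => ?_) (sum_below fun E hE => ?_)
    · obtain ⟨⟨γ, g⟩, hg, rfl⟩ := List.mem_map.1 hE
      have hy := (hs _ _).2 (.inl ⟨g, hg, rfl⟩)
      refine (Below.of_provable (.pre_congr _ (ho _ _ hg))).trans ?_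
      rcases γ with α | _
      · exact (Below.of_provable (hR.pre_eq hD hK (hD.closed hx hy) α)).trans
          (hR.std hx (.single hy))
      · exact delta _ hy
    · obtain ⟨k, hk, rfl⟩ := List.mem_map.1 hE
      refine hR.elim_outs hD hK (hp k) (fun α y h => ?_) fun y h => ?_
      · exact hR.std hx (.single ((hs _ _).2 (.inr ⟨k, hk, h⟩)))
      · exact delta _ ((hs _ _).2 (.inr ⟨k, hk, h.1⟩))

/-- The canonical expression of a state `m` on a silent cycle `L` with exits `T`. -/
theorem IsRootedCanonical.eq_loop (hD : IsSystem D) (hK : IsCanonical D K)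
    (hR : IsRootedCanonical D K R) {m Z : Expr A} (hm : m ∈ D) (L : Expr A → Prop)
    (T : PAct A → Expr A → Prop) (hLm : L m)
    (hL : ∀ z, L z → StrictBisim z m ∧ ∃ z', (Act.tau, z') ∈ outs z)
    (hLT : ∀ z, L z → ∀ α y, (Act.std α, y) ∈ outs z → T α y ∨ (α = .tau ∧ L y))
    (hT : ∀ α y, T α y → ∃ z, TauReach m z ∧ (Act.std α, y) ∈ outs z)
    (hl : ∃ z, WeakStep m .tau z ∧ StrictBisim m z)
    (hZ : ∀ α y, T α y → Below (pre (.std α) (K y)) Z)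
    (hZ' : ∀ F, (∀ α y, T α y → Below (pre (.std α) (K y)) F) → Below Z F) :
    Provable (R m) (pre .tau Z) := by
  -- A silent step into the class of `m` contributes `τ.K m` to `R m`; all other summands are
  -- absorbed, and `m` is too unstable to have time steps.
  have e₁ : Provable (R m) (pre .tau (K m)) := by
    apply Below.antisymm
    · refine hR.elim hm (fun α y h => hK.pre_below_of_weakStep hD hm h) fun y h => ?_
      obtain ⟨z, hz⟩ := (hL m hLm).2
      exact (h.2 z hz).elim
    · obtain ⟨z, hz, hb⟩ := hl
      rw [hK.congr hm (hD.weakStep hm hz) hb]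
      exact hR.std hm hz
  refine e₁.trans (.symm ?_)
  have weak : ∀ α y, T α y → WeakStep m α y := fun α y h => by
    obtain ⟨z, hz, hy⟩ := hT α y h
    exact ⟨z, y, hz, hy, .refl⟩
  have path : ∀ z, TauReach m z → L z ∨ ∃ w, T .tau w ∧ TauReach w z := by
    intro z hz
    induction hz with
    | refl => exact .inl hLm
    | tail _ hz ih =>
      rcases ih with ih | ⟨w, hw, ih⟩
      · rcases hLT _ ih _ _ hz with h | ⟨-, h⟩
        · exact .inr ⟨_, h, .refl⟩
        · exact .inl h
      · exact .inr ⟨w, hw, ih.tail hz⟩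
  -- If some silent exit leads back into the class, then `Z` is `τ.K m` and `Tau1` applies; if none
  -- does, `Z` is `K m`.
  by_cases ha : ∃ w, T .tau w ∧ StrictBisim w m
  · obtain ⟨w, hw, hb⟩ := ha
    have : Provable Z (pre .tau (K m)) := by
      apply Below.antisymm
      · exact hZ' _ fun α y h => hK.pre_below_of_weakStep hD hm (weak α y h)
      · rw [← hK.congr (hD.weakStep hm (weak _ _ hw)) hm hb]
        exact hZ _ _ hw
    exact (Provable.pre_congr _ this).trans (.Tau1 _ _)
  · apply Provable.pre_congr
    apply Below.antisymm
    · refine hZ' _ fun α y h => hK.std hm (weak α y h) ?_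
      rintro rfl hb
      exact ha ⟨y, h, hb.symm⟩
    · refine hK.elim hm (fun α y h hb => ?_) fun x₁ y hx₁ hb h => ?_
      · have htau : α = .tau → Below (pre (.std α) (K y)) Z := by
          rintro rfl
          rcases path y h.tauReach with h | ⟨w, hw, h⟩
          · exact (hb rfl (hL y h).1.symm).elim
          · exact (hK.pre_below_of_tauReach hD (hD.weakStep hm (weak _ _ hw)) h _).trans
              (hZ _ _ hw)
        obtain ⟨x₁, x₂, h₁, h₂, h₃⟩ := h
        rcases path x₁ h₁ with h | ⟨w, hw, h⟩
        · rcases hLT x₁ h α x₂ h₂ with h | ⟨h, -⟩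
          · exact (hK.pre_below_of_tauReach hD (hD.weakStep hm (weak _ _ h)) h₃ _).trans
              (hZ _ _ h)
          · exact htau h
        · exact (hK.pre_below_of_weakStep hD (hD.weakStep hm (weak _ _ hw))
            ⟨x₁, x₂, h, h₂, h₃⟩).trans (hZ _ _ hw)
      -- No time summand arises here. A stable state matching the time step lies off the cycle,
      -- behind a silent exit `w`; but the stable `x₁` can match the path to `w` only by itself,
      -- which would put `w` in the class.
      · obtain ⟨z, y', h₁, h₂, -⟩ := isStrictBisim.delta hb h
        rcases path z h₁ with h' | ⟨w, hw, h'⟩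
        · obtain ⟨z', hz'⟩ := (hL z h').2
          exact (h₂.2 z' hz').elim
        · obtain ⟨x₂, h₃, h₄⟩ := hb.symm.tauReach (weak _ _ hw).tauReach
          cases TauReach.eq_of_stable h₃ h.2
          exact (ha ⟨w, hw, h₄.trans hb⟩).elim

/-- States on a silent cycle are bisimilar. -/
theorem strictBisim_of_loop {m z z' : Expr A} (h : TauReach m z) (h' : TauReach z z')
    (ho : ∀ o ∈ outs m, o ∈ outs z') (hm : ∃ y, (Act.tau, y) ∈ outs m) : StrictBisim z m := by
  have hz : ¬ ∀ y, (Act.tau, y) ∉ outs z := by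
    intro hz
    cases TauReach.eq_of_stable h' hz
    obtain ⟨y, hy⟩ := hm
    exact hz y (ho _ hy)
  -- The state `z'` offers every raw transition of `m`, so `z` and `m` have each other's prioritized
  -- moves as weak moves. Both are unstable, so time steps impose no condition.
  have back : ∀ {α m'}, (Act.std α, m') ∈ outs m → WeakStep z α m' :=
    fun hm' => ⟨z', _, h', ho _ hm', .refl⟩
  have forth : ∀ {α z₁}, (Act.std α, z₁) ∈ outs z → WeakStep m α z₁ :=
    fun hz₁ => ⟨z, _, h, hz₁, .refl⟩
  refine ⟨fun x y => StrictBisim x y ∨ (x = z ∧ y = m) ∨ (x = m ∧ y = z),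
    ⟨?_, ?_, ?_, ?_⟩, .inr (.inl ⟨rfl, rfl⟩)⟩
  · rintro x y (h | h | h)
    · exact .inl h.symm
    · exact .inr (.inr h.symm)
    · exact .inr (.inl h.symm)
  · rintro x y x' (h | ⟨rfl, rfl⟩ | ⟨rfl, rfl⟩) hx
    · obtain ⟨y', h₁, h₂⟩ := isStrictBisim.tau h hx
      exact ⟨y', h₁, .inl h₂⟩
    · exact ⟨x', (forth hx).tauReach, .inl (.refl _)⟩
    · exact ⟨x', (back hx).tauReach, .inl (.refl _)⟩
  · rintro x y x' α (h | ⟨rfl, rfl⟩ | ⟨rfl, rfl⟩) hx hα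
    · obtain ⟨y', h₁, h₂⟩ := isStrictBisim.std h hx hα
      exact ⟨y', h₁, .inl h₂⟩
    · exact ⟨x', forth hx, .inl (.refl _)⟩
    · exact ⟨x', back hx, .inl (.refl _)⟩
  · rintro x y x' (h | ⟨rfl, rfl⟩ | ⟨rfl, rfl⟩) hx
    · obtain ⟨y₁, y', h₁, h₂, h₃⟩ := isStrictBisim.delta h hx
      exact ⟨y₁, y', h₁, h₂, .inl h₃⟩
    · exact (hz hx.2).elim
    · obtain ⟨y, hy⟩ := hm
      exact (hx.2 y hy).elim

theorem scons_comp (R : Expr A → Expr A) (m : Expr A) (p : ℕ → Expr A) :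
    (fun k => R (scons m p k)) = scons (R m) fun k => R (p k) := by
  funext k; cases k <;> rfl

/-- Sequences of raw transitions. -/
def OutReach : Expr A → Expr A → Prop :=
  Relation.ReflTransGen fun e f => ∃ γ, (γ, f) ∈ outs e

theorem TauReach.outReach {e f : Expr A} (h : TauReach e f) : OutReach e f := by
  induction h with
  | refl => exact .refl
  | tail _ h ih => exact ih.tail ⟨_, h⟩

theorem OutReach.mem (hD : IsSystem D) {e f : Expr A} {p : ℕ → Expr A} (h : OutReach e f)
    (he : subst p e ∈ D) : subst p f ∈ D := by
  induction h with
  | refl => exact he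
  | tail _ h ih =>
    obtain ⟨γ, h⟩ := h
    exact hD.closed ih (mem_outs_subst.2 (.inl ⟨_, h, rfl⟩))

/-- The recursion is rewritten with a serial, guarded body, and `R` of the process is shown to solve
the equation of that body. The hypothesis `ih` concerns only proper derivatives of `E`, so it does
not presuppose the equation being proved. -/
theorem IsRootedCanonical.provable_mu (hD : IsSystem D) (hK : IsCanonical D K)
    (hR : IsRootedCanonical D K R) {E : Expr A} (hE : IsBasic E) {p : ℕ → Expr A}
    (hp : ∀ k, p k ∈ D) (hm : subst p (mu E) ∈ D)
    (hm' : subst (scons (subst p (mu E)) p) E ∈ D)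
    (ih : ∀ γ g, (∃ f, OutReach E f ∧ (γ, g) ∈ outs f) →
      Provable (subst (fun k => R (scons (subst p (mu E)) p k)) g)
        (R (subst (scons (subst p (mu E)) p) g))) :
    Provable (subst (fun k => R (p k)) (mu E)) (R (subst p (mu E))) := by
  set m := subst p (mu E) with hm_def
  have hp' : ∀ k, scons m p k ∈ D := by
    rintro (_ | k)
    · exact hm
    · exact hp k
  have outs_m : ∀ γ y, (γ, y) ∈ outs m ↔ (∃ g, (γ, g) ∈ outs E ∧ y = subst (scons m p) g) ∨
      ∃ k, k + 1 ∈ exps E ∧ (γ, y) ∈ outs (p k) := by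
    intro γ y
    rw [hm_def, mem_outs_subst]
    apply or_congr
    · constructor
      · rintro ⟨_, h, rfl⟩
        obtain ⟨g, hg, rfl⟩ := mem_outs_mu.1 h
        exact ⟨g, hg, subst_inst _ _ _⟩
      · rintro ⟨g, hg, rfl⟩
        exact ⟨_, mem_outs_mu.2 ⟨g, hg, rfl⟩, (subst_inst _ _ _).symm⟩
    · simp only [mem_exps_mu]
  have conclude : ∀ E₁ : Expr A, Provable (mu E) (mu E₁) → Serial 0 E₁ → Guarded 0 E₁ →
      Provable (R m) (subst (fun k => R (scons m p k)) E₁) →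
      Provable (subst (fun k => R (p k)) (mu E)) (R m) := by
    intro E₁ h hs hg hR
    refine (h.subst _).trans (.symm ?_)
    refine .Rec2 (hs.subst_upSub _) (hg.subst_upSub _) ?_
    rwa [inst_subst_upSub, ← scons_comp]
  -- Without a silent loop through the variable, its top-level occurrences are the only unguarded
  -- ones, and `Ung1` deletes them.
  by_cases hl : ∃ h, (Act.tau, h) ∈ outs E ∧ WeaklyExposes 0 h
  swap
  · refine conclude (plus (preSum (outs E)) (varSum ((exps E).filter (· ≠ 0)))) ?_ ?_ ?_ ?_
    · have hb := provable_body hE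
      by_cases h0 : 0 ∈ exps E
      · apply mu_congr_of_below
        apply hb.trans
        apply Below.antisymm
        · refine .plus ((Below.left _ _).trans (.right _ _)) (varSum_below fun k hk => ?_)
          by_cases hk0 : k = 0
          · subst hk0; exact .left _ _
          · exact (below_varSum (by simp [hk, hk0])).trans
              ((Below.right _ _).trans (.right _ _))
        · refine .plus ((below_varSum h0).trans (.right _ _))
            (.plus (.left _ _) (varSum_below fun k hk => ?_))
          exact (below_varSum (List.mem_filter.1 hk).1).trans (.right _ _)
      · have : (exps E).filter (· ≠ 0) = exps E := by
          rw [List.filter_eq_self]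
          intro k hk
          refine decide_eq_true ?_
          rintro rfl
          exact h0 hk
        rw [this]
        exact .mu_congr hb
    · refine ⟨sum_serial fun F hF => ?_, sum_serial fun F hF => ?_⟩
      · obtain ⟨o, ho, rfl⟩ := List.mem_map.1 hF
        exact (hE.of_mem_outs ho).serial 0
      · obtain ⟨k, -, rfl⟩ := List.mem_map.1 hF
        trivial
    · refine ⟨sum_guarded fun F hF => ?_, sum_guarded fun F hF => ?_⟩
      · obtain ⟨⟨γ, g⟩, ho, rfl⟩ := List.mem_map.1 hF
        by_cases hγ : γ = .tau
        · subst hγ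
          exact .inr (guarded_of_not_weaklyExposes (fun h => hl ⟨g, ho, h⟩) (hE.of_mem_outs ho))
        · exact .inl hγ
      · obtain ⟨k, hk, rfl⟩ := List.mem_map.1 hF
        have := (List.mem_filter.1 hk).2
        simp only [ne_eq, decide_eq_true_eq] at this
        exact fun e => this e.symm
    · refine hR.eq_list hD hK hm _ _ _ hp' (fun γ y => ?_) fun γ g hg => ih γ g ⟨E, .refl, hg⟩
      rw [outs_m]
      apply or_congr_right
      constructor
      · rintro ⟨k, hk, h⟩
        exact ⟨k + 1, by simp [hk], h⟩
      · rintro ⟨_ | k, hk, h⟩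
        · simp at hk
        · exact ⟨k, (List.mem_filter.1 hk).1, h⟩
  obtain ⟨h, hh, hw⟩ := hl
  obtain ⟨lo, lk, hF, hP⟩ := provable_mu_of_loop hE (.of_isBasic hE .refl) hh hw
  have hwE : WeaklyExposes 0 E := .of_tauReach (.single hh) hw
  have basic : ∀ α g, (α, g) ∈ lo → IsBasic g := fun α g hg => by
    obtain ⟨⟨f, hf, hg⟩, -⟩ := hF.sound α g hg
    exact (hE.of_tauReach hf).of_mem_outs hg
  have reach : ∀ f, TauReach E f → f = E ∨ TauReach m (subst (scons m p) f) := by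
    intro f hf
    rcases Relation.ReflTransGen.cases_head hf with rfl | ⟨h, hh, hf⟩
    · exact .inl rfl
    · exact .inr (.head ((outs_m _ _).2 (.inl ⟨h, hh, rfl⟩)) (TauReach.subst hf _))
  have loop_of : ∀ f h, (Act.tau, h) ∈ outs E → TauReach h f → WeaklyExposes 0 f →
      StrictBisim (subst (scons m p) f) m ∧
        ∃ z', (Act.tau, z') ∈ outs (subst (scons m p) f) := by
    rintro f h hh hf ⟨f', hf', h0⟩
    have hmh : (Act.tau, subst (scons m p) h) ∈ outs m := (outs_m _ _).2 (.inl ⟨h, hh, rfl⟩)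
    have ho : ∀ o ∈ outs m, o ∈ outs (subst (scons m p) f') := fun o ho =>
      mem_outs_subst.2 (.inr ⟨0, h0, ho⟩)
    refine ⟨strictBisim_of_loop (.head hmh (hf.subst _)) (hf'.subst _) ho ⟨_, hmh⟩, ?_⟩
    rcases Relation.ReflTransGen.cases_head (hf'.subst (scons m p)) with e | ⟨z, hz, -⟩
    · rw [e]; exact ⟨_, ho _ hmh⟩
    · exact ⟨z, hz⟩
  have hmh : (Act.tau, subst (scons m p) h) ∈ outs m := (outs_m _ _).2 (.inl ⟨h, hh, rfl⟩)
  -- The collapsed body is guarded because silent exits no longer expose variable 0, and serial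
  -- because only other variables stand under `pri`.
  refine conclude (pre .tau (atomSum lo lk)) hP ?_ ?_ ?_
  · refine ⟨sum_serial fun F hF' => ?_, sum_serial fun F hF' => ?_⟩
    · simp only [List.map_map, List.mem_map] at hF'
      obtain ⟨⟨α, g⟩, ho, rfl⟩ := hF'
      exact (basic α g ho).serial 0
    · obtain ⟨k, hk, rfl⟩ := List.mem_map.1 hF'
      exact fun e => (hF.soundVar k hk).1 (show 0 = k from e).symm
  · refine .inr ⟨sum_guarded fun F hF' => ?_, sum_guarded fun F hF' => ?_⟩
    · simp only [List.map_map, List.mem_map] at hF'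
      obtain ⟨⟨α, g⟩, ho, rfl⟩ := hF'
      by_cases hα : α = .tau
      · exact .inr (guarded_of_not_weaklyExposes ((hF.sound α g ho).2 hα) (basic α g ho))
      · exact .inl fun e => hα (Act.std.inj e)
    · obtain ⟨k, hk, rfl⟩ := List.mem_map.1 hF'
      exact fun e => (hF.soundVar k hk).1 (show 0 = k from e).symm
  · refine hR.eq_loop hD hK hm
      (fun z => z = m ∨ ∃ f h, (Act.tau, h) ∈ outs E ∧ TauReach h f ∧ WeaklyExposes 0 f ∧
        z = subst (scons m p) f)
      (fun α y => (∃ g, (α, g) ∈ lo ∧ y = subst (scons m p) g) ∨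
        ∃ k ∈ lk, (Act.std α, y) ∈ outs (scons m p k)) (.inl rfl) ?_ ?_ ?_ ?_ ?_ ?_
    · rintro z (rfl | ⟨f, h, hh, hf, hw, rfl⟩)
      · exact ⟨.refl _, _, hmh⟩
      · exact loop_of f h hh hf hw
    · have exit_m : ∀ α y, (Act.std α, y) ∈ outs m →
          ((∃ g, (α, g) ∈ lo ∧ y = subst (scons m p) g) ∨
            ∃ k ∈ lk, (Act.std α, y) ∈ outs (scons m p k)) ∨
          (α = .tau ∧ (y = m ∨ ∃ f h, (Act.tau, h) ∈ outs E ∧ TauReach h f ∧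
            WeaklyExposes 0 f ∧ y = subst (scons m p) f)) := by
        intro α y hy
        rcases (outs_m _ _).1 hy with ⟨g, hg, rfl⟩ | ⟨k, hk, hy⟩
        · rcases hF.complete E .refl hwE α g hg with h | ⟨rfl, h⟩
          · exact .inl (.inl ⟨g, h, rfl⟩)
          · exact .inr ⟨rfl, .inr ⟨g, g, hg, .refl, h, rfl⟩⟩
        · exact .inl (.inr ⟨k + 1,
            (hF.completeVar E .refl hwE _ hk).resolve_left (by simp), hy⟩)
      rintro z (rfl | ⟨f, h, hh, hf, hw, rfl⟩) α y hy
      · exact exit_m α y hy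
      · rcases mem_outs_subst.1 hy with ⟨g, hg, rfl⟩ | ⟨k, hk, hy⟩
        · rcases hF.complete f (.head hh hf) hw α g hg with h | ⟨rfl, h'⟩
          · exact .inl (.inl ⟨g, h, rfl⟩)
          · exact .inr ⟨rfl, .inr ⟨g, h, hh, hf.tail hg, h', rfl⟩⟩
        · rcases hF.completeVar f (.head hh hf) hw k hk with rfl | hk
          · exact exit_m α y hy
          · exact .inl (.inr ⟨k, hk, hy⟩)
    · rintro α y (⟨g, hg, rfl⟩ | ⟨k, hk, hy⟩)
      · obtain ⟨⟨f, hf, hg⟩, -⟩ := hF.sound α g hg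
        rcases reach f hf with rfl | hf
        · exact ⟨m, .refl, (outs_m _ _).2 (.inl ⟨g, hg, rfl⟩)⟩
        · exact ⟨_, hf, mem_outs_subst.2 (.inl ⟨g, hg, rfl⟩)⟩
      · obtain ⟨hk0, f, hf, hk⟩ := hF.soundVar k hk
        rcases reach f hf with rfl | hf
        · cases k with
          | zero => exact (hk0 rfl).elim
          | succ k => exact ⟨m, .refl, (outs_m _ _).2 (.inr ⟨k, hk, hy⟩)⟩
        · exact ⟨_, hf, mem_outs_subst.2 (.inr ⟨k, hk, hy⟩)⟩
    · exact ⟨_, .single hmh, (loop_of h h hh .refl hw).1.symm⟩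
    · rw [subst_atomSum]
      rintro α y (⟨g, hg, rfl⟩ | ⟨k, hk, hy⟩)
      · obtain ⟨⟨f, hf, hfg⟩, -⟩ := hF.sound α g hg
        have hD' := OutReach.mem hD (hf.outReach.tail ⟨_, hfg⟩) hm'
        refine (Below.of_provable ((hR.pre_eq hD hK hD' α).symm.trans
          (.pre_congr _ (ih _ g ⟨f, hf.outReach, hfg⟩).symm))).trans (.trans ?_ (.left _ _))
        exact below_preSum (List.mem_map.2 ⟨_, hg, rfl⟩)
      · refine (hR.std (hp' k) (.single hy)).pre_pri.trans (.trans ?_ (.right _ _))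
        exact below_sum (List.mem_map.2 ⟨k, hk, rfl⟩)
    · intro F hF'
      rw [subst_atomSum]
      refine .plus (preSum_below fun γ G hG => ?_) (sum_below fun G hG => ?_)
      · obtain ⟨⟨α, g⟩, hg, e⟩ := List.mem_map.1 hG
        cases e
        obtain ⟨⟨f, hf, hfg⟩, -⟩ := hF.sound α g hg
        have hD' := OutReach.mem hD (hf.outReach.tail ⟨_, hfg⟩) hm'
        exact (Below.of_provable ((Provable.pre_congr _ (ih _ g ⟨f, hf.outReach, hfg⟩)).trans
          (hR.pre_eq hD hK hD' α))).trans (hF' _ _ (.inl ⟨g, hg, rfl⟩))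
      · obtain ⟨k, hk, rfl⟩ := List.mem_map.1 hG
        exact hR.pri_elim hD hK (hp' k) fun α y hy => hF' _ _ (.inr ⟨k, hk, hy⟩)

/-- In a system that is closed under summands and under unfolding of recursions, each basic
process is provably equal to its canonical expression. -/
theorem IsRootedCanonical.provable (hD : IsSystem D)
    (hplus : ∀ E F, plus E F ∈ D → E ∈ D ∧ F ∈ D)
    (hmu : ∀ E, mu E ∈ D → inst E (mu E) ∈ D) (hK : IsCanonical D K)
    (hR : IsRootedCanonical D K R) {E : Expr A} (hE : IsBasic E) {p : ℕ → Expr A}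
    (hp : ∀ k, p k ∈ D) (hED : subst p E ∈ D) {g : Expr A} (hg : OutReach E g) :
    Provable (subst (fun k => R (p k)) g) (R (subst p g)) := by
  have root : ∀ {E : Expr A}, IsBasic E → ∀ {p : ℕ → Expr A}, (∀ k, p k ∈ D) →
      subst p E ∈ D → (∀ γ g, (γ, g) ∈ outs E →
        Provable (subst (fun k => R (p k)) g) (R (subst p g))) →
      Provable (subst (fun k => R (p k)) E) (R (subst p E)) := by
    intro E hE p hp hED h
    refine ((provable_body hE).subst _).trans (.symm ?_)
    exact hR.eq_list hD hK hED _ _ p hp (fun γ y => mem_outs_subst) h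
  -- All raw derivatives of `E` are treated together: for a recursion the hypothesis is needed at
  -- derivatives of the body, in the environment extended by the process itself.
  induction E generalizing p g with
  | var i =>
    rcases Relation.ReflTransGen.cases_head hg with rfl | ⟨g, ⟨γ, hg⟩, _⟩
    · exact .refl _
    · simp [outs] at hg
  | pre γ E ih =>
    have hED' : subst p E ∈ D := hD.closed hED (γ := γ) (by simp [subst, outs])
    have key : ∀ γ' g, (γ', g) ∈ outs (pre γ E) → g = E := by
      intro γ' g hg
      simp only [outs, List.mem_singleton, Prod.mk.injEq] at hg
      exact hg.2
    rcases Relation.ReflTransGen.cases_head hg with rfl | ⟨g, ⟨γ', hg⟩, h⟩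
    · refine root hE hp hED fun γ' g hg => ?_
      cases key _ _ hg
      exact ih hE hp hED' .refl
    · cases key _ _ hg
      exact ih hE hp hED' h
  | plus E F ihE ihF =>
    obtain ⟨hED₁, hED₂⟩ := hplus _ _ hED
    have key : ∀ γ g, (γ, g) ∈ outs (plus E F) → ∀ f, OutReach g f →
        Provable (subst (fun k => R (p k)) f) (R (subst p f)) := by
      intro γ g hg f hf
      rcases List.mem_append.1 hg with hg | hg
      · exact ihE hE.1 hp hED₁ (.head ⟨γ, hg⟩ hf)
      · exact ihF hE.2 hp hED₂ (.head ⟨γ, hg⟩ hf)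
    rcases Relation.ReflTransGen.cases_head hg with rfl | ⟨g, ⟨γ', hg⟩, h⟩
    · exact root hE hp hED fun γ g hg => key γ g hg g .refl
    · exact key _ _ hg _ h
  | mu E ih =>
    have hb : IsBasic E := hE
    have hm' : subst (scons (subst p (mu E)) p) E ∈ D := by
      rw [← inst_subst_upSub]
      exact hmu _ hED
    have hp' : ∀ k, scons (subst p (mu E)) p k ∈ D := by
      rintro (_ | k)
      · exact hED
      · exact hp k
    have hr := hR.provable_mu hD hK hb hp hED hm' fun γ g ⟨f, hf, hg⟩ =>
      ih hb hp' hm' (hf.tail ⟨γ, hg⟩)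
    -- Every derivative of a recursion is the recursion or an instance of a derivative of its body.
    have tails : g = mu E ∨ ∃ g₀, OutReach E g₀ ∧ g = inst g₀ (mu E) := by
      induction hg with
      | refl => exact .inl rfl
      | tail _ hx ih =>
        obtain ⟨γ, hx⟩ := hx
        have start : ∀ {x}, (γ, x) ∈ outs (mu E) →
            ∃ g₀, OutReach E g₀ ∧ x = inst g₀ (mu E) := fun hx => by
          obtain ⟨g₀, h₀, rfl⟩ := mem_outs_mu.1 hx
          exact ⟨g₀, .single ⟨γ, h₀⟩, rfl⟩
        rcases ih with rfl | ⟨f, hf, rfl⟩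
        · exact .inr (start hx)
        · rcases mem_outs_inst.1 hx with ⟨g₀, h₀, rfl⟩ | ⟨-, hx⟩
          · exact .inr ⟨g₀, hf.tail ⟨γ, h₀⟩, rfl⟩
          · exact .inr (start hx)
    rcases tails with rfl | ⟨g₀, hg₀, rfl⟩
    · exact hr
    · rw [subst_inst, subst_inst]
      refine .trans (Provable.subst_congr ?_ g₀) (ih hb hp' hm' hg₀)
      rintro (_ | k)
      · exact hr
      · exact .refl _
  | _ =>
    rcases Relation.ReflTransGen.cases_head hg with rfl | ⟨g, ⟨γ, hg⟩, _⟩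
    · exact root hE hp hED fun γ g hg => by simp [outs] at hg
    · simp [outs] at hg

end Canonical

/-! ### Finite systems of unfoldings -/

/-- Every expression lies in a finite set that is closed under transitions, summands and
unfolding of recursions. -/
theorem exists_finite_unfoldings (E : Expr A) :
    ∃ D : Set (Expr A), E ∈ D ∧ IsSystem D ∧ (∀ F G, plus F G ∈ D → F ∈ D ∧ G ∈ D) ∧
      ∀ F, mu F ∈ D → inst F (mu F) ∈ D := by
  induction E with
  | pre γ E ih =>
    obtain ⟨D, hE, hD, hp, hm⟩ := ih
    refine ⟨insert (pre γ E) D, .inl rfl, ⟨hD.finite.insert _, ?_⟩, ?_, ?_⟩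
    · rintro x γ' y (rfl | hx) hy
      · simp only [outs, List.mem_singleton, Prod.mk.injEq] at hy
        exact .inr (hy.2 ▸ hE)
      · exact .inr (hD.closed hx hy)
    · rintro F G (h | h)
      · cases h
      · exact ⟨.inr (hp F G h).1, .inr (hp F G h).2⟩
    · rintro F (h | h)
      · cases h
      · exact .inr (hm F h)
  | plus E F ihE ihF =>
    obtain ⟨D, hE, hD, hp, hm⟩ := ihE
    obtain ⟨D', hF, hD', hp', hm'⟩ := ihF
    refine ⟨insert (plus E F) (D ∪ D'), .inl rfl,
      ⟨(hD.finite.union hD'.finite).insert _, ?_⟩, ?_, ?_⟩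
    · rintro x γ y (rfl | hx | hx) hy
      · rcases List.mem_append.1 hy with hy | hy
        · exact .inr (.inl (hD.closed hE hy))
        · exact .inr (.inr (hD'.closed hF hy))
      · exact .inr (.inl (hD.closed hx hy))
      · exact .inr (.inr (hD'.closed hx hy))
    · rintro G H (h | h | h)
      · cases h
        exact ⟨.inr (.inl hE), .inr (.inr hF)⟩
      · exact ⟨.inr (.inl (hp G H h).1), .inr (.inl (hp G H h).2)⟩
      · exact ⟨.inr (.inr (hp' G H h).1), .inr (.inr (hp' G H h).2)⟩
    · rintro G (h | h | h)
      · cases h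
      · exact .inr (.inl (hm G h))
      · exact .inr (.inr (hm' G h))
  | mu E ih =>
    obtain ⟨D, hE, hD, hp, hm⟩ := ih
    have hmu : ∀ {γ y}, (γ, y) ∈ outs (mu E) → ∃ g ∈ D, inst g (mu E) = y := by
      intro γ y hy
      obtain ⟨g, hg, rfl⟩ := mem_outs_mu.1 hy
      exact ⟨g, hD.closed hE hg, rfl⟩
    -- Unfolding creates nothing beyond instances of the finitely many states of the body, since the
    -- exposed variable just restarts `mu E`.
    refine ⟨insert (mu E) ((fun g => inst g (mu E)) '' D), .inl rfl,
      ⟨(hD.finite.image _).insert _, ?_⟩, ?_, ?_⟩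
    · rintro x γ y (rfl | ⟨g, hg, rfl⟩) hy
      · exact .inr (hmu hy)
      · rcases mem_outs_inst.1 hy with ⟨g', hg', rfl⟩ | ⟨-, hy⟩
        · exact .inr ⟨g', hD.closed hg hg', rfl⟩
        · exact .inr (hmu hy)
    · rintro F G (h | ⟨g, hg, h⟩)
      · cases h
      · cases g with
        | var i => cases i <;> cases h
        | plus g g' =>
          cases h
          exact ⟨.inr ⟨g, (hp _ _ hg).1, rfl⟩, .inr ⟨g', (hp _ _ hg).2, rfl⟩⟩
        | _ => cases h
    · rintro F (h | ⟨g, hg, h⟩)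
      · cases h
        exact .inr ⟨E, hE, rfl⟩
      · cases g with
        | var i =>
          cases i with
          | zero =>
            cases h
            exact .inr ⟨E, hE, rfl⟩
          | succ i => cases h
        | mu g =>
          cases h
          exact .inr ⟨_, hm _ hg, subst_inst' _ _ _⟩
        | _ => cases h
  | _ =>
    refine ⟨{_}, rfl, ⟨Set.finite_singleton _, ?_⟩, ?_, ?_⟩
    · rintro x γ y rfl hy
      simp [outs] at hy
    · rintro F G h
      cases h
    · rintro F h
      cases h

/-! ### Transitions of basic processes -/

theorem mem_outs_unfold {E : Expr A} {γ : Act A} {G : Expr A} :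
    (γ, G) ∈ outs (inst E (mu E)) ↔ (γ, G) ∈ outs (mu E) := by
  rw [mem_outs_inst, mem_outs_mu]
  exact ⟨fun h => h.elim id And.right, .inl⟩

theorem PStep.mem_outs {x y : Expr A} {α : PAct A} (h : PStep x α y) (hx : IsBasic x) :
    (Act.std α, y) ∈ outs x := by
  induction h with
  | pre => simp [outs]
  | plusL _ ih => exact List.mem_append.2 (.inl (ih hx.1))
  | plusR _ ih => exact List.mem_append.2 (.inr (ih hx.2))
  | mu _ ih => exact mem_outs_unfold.1 (ih (IsBasic.inst hx hx))
  | _ => exact hx.elim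

theorem pStep_subst {E G : Expr A} {α : PAct A} (h : (Act.std α, G) ∈ outs E)
    (σ : ℕ → Expr A) : PStep (subst σ E) α (subst σ G) := by
  induction E generalizing σ G with
  | pre γ E =>
    simp only [outs, List.mem_singleton, Prod.mk.injEq] at h
    obtain ⟨rfl, rfl⟩ := h
    exact .pre _ _
  | plus E F ihE ihF =>
    rcases List.mem_append.1 h with h | h
    · exact .plusL (ihE h σ)
    · exact .plusR (ihF h σ)
  | mu E ih =>
    obtain ⟨G, hG, rfl⟩ := mem_outs_mu.1 h
    refine .mu ?_
    rw [inst_subst_upSub, subst_inst]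
    exact ih hG _
  | _ => simp [outs] at h

theorem pStep_iff {x y : Expr A} {α : PAct A} (hx : IsBasic x) :
    PStep x α y ↔ (Act.std α, y) ∈ outs x := by
  refine ⟨fun h => h.mem_outs hx, fun h => ?_⟩
  have := pStep_subst h var
  rwa [subst_var, subst_var] at this

theorem DStep.deltaStep {x y : Expr A} (h : DStep x y) (hx : IsBasic x) : DeltaStep x y := by
  induction h with
  | pre => simp [DeltaStep, outs]
  | plusL _ hQ ih =>
    refine ⟨List.mem_append.2 (.inl (ih hx.1).1), fun z hz => ?_⟩
    rcases List.mem_append.1 hz with hz | hz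
    · exact (ih hx.1).2 z hz
    · exact hQ ⟨z, (pStep_iff hx.2).2 hz⟩
  | plusR _ hP ih =>
    refine ⟨List.mem_append.2 (.inr (ih hx.2).1), fun z hz => ?_⟩
    rcases List.mem_append.1 hz with hz | hz
    · exact hP ⟨z, (pStep_iff hx.1).2 hz⟩
    · exact (ih hx.2).2 z hz
  | mu _ ih =>
    have := ih (IsBasic.inst hx hx)
    exact ⟨mem_outs_unfold.1 this.1, fun z hz => this.2 z (mem_outs_unfold.2 hz)⟩
  | _ => exact hx.elim

/-- Stability of the whole expression provides the negative premises for choice. The substitution is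
arbitrary because unfolding a recursion extends it. -/
theorem dStep_subst {E G : Expr A} (hE : IsBasic E) (h : (Act.delta, G) ∈ outs E)
    {σ : ℕ → Expr A} (hσ : ∀ k, IsBasic (σ k)) (hs : ∀ z, (Act.tau, z) ∉ outs (subst σ E)) :
    DStep (subst σ E) (subst σ G) := by
  induction E generalizing σ G with
  | pre γ E =>
    simp only [outs, List.mem_singleton, Prod.mk.injEq] at h
    obtain ⟨rfl, rfl⟩ := h
    exact .pre _
  | plus E F ihE ihF =>
    have hsE : ∀ z, (Act.tau, z) ∉ outs (subst σ E) := fun z hz =>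
      hs z (List.mem_append.2 (.inl hz))
    have hsF : ∀ z, (Act.tau, z) ∉ outs (subst σ F) := fun z hz =>
      hs z (List.mem_append.2 (.inr hz))
    rcases List.mem_append.1 h with h | h
    · exact .plusL (ihE hE.1 h hσ hsE) fun ⟨z, hz⟩ => hsF z (hz.mem_outs (hE.2.subst hσ))
    · exact .plusR (ihF hE.2 h hσ hsF) fun ⟨z, hz⟩ => hsE z (hz.mem_outs (hE.1.subst hσ))
  | mu E ih =>
    obtain ⟨G, hG, rfl⟩ := mem_outs_mu.1 h
    have hs' : ∀ z, (Act.tau, z) ∉ outs (subst (scons (subst σ (mu E)) σ) E) := by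
      intro z hz
      rw [← inst_subst_upSub] at hz
      exact hs z (mem_outs_unfold.1 hz)
    refine .mu ?_
    rw [inst_subst_upSub, subst_inst]
    refine ih hE hG ?_ hs'
    rintro (_ | k)
    · exact IsBasic.subst (E := mu E) hE hσ
    · exact hσ k
  | _ => simp [outs] at h

theorem dStep_iff {x y : Expr A} (hx : IsBasic x) : DStep x y ↔ DeltaStep x y := by
  refine ⟨fun h => h.deltaStep hx, fun h => ?_⟩
  have := dStep_subst hx h.1 (σ := var) (fun _ => trivial) (by rw [subst_var]; exact h.2)
  rwa [subst_var, subst_var] at this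

theorem Step.mem_outs {x y : Expr A} {γ : Act A} (h : Step x γ y) (hx : IsBasic x) :
    (γ, y) ∈ outs x := by
  cases γ with
  | std α => exact PStep.mem_outs h hx
  | delta => exact (DStep.deltaStep h hx).1

theorem TauStar.tauReach {x y : Expr A} (h : TauStar x y) (hx : IsBasic x) : TauReach x y := by
  induction h with
  | refl => exact .refl
  | tail _ h ih => exact ih.tail (Step.mem_outs h (hx.of_tauReach ih))

/-! ### Time-deterministic basic processes -/

/-- Basic processes that are time-deterministic. -/
structure IsDetBasic (x : Expr A) : Prop where
  basic : IsBasic x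
  det : TimeDeterministic x

namespace IsDetBasic

theorem step {x y : Expr A} {γ : Act A} (hx : IsDetBasic x) (h : Step x γ y) : IsDetBasic y :=
  ⟨hx.basic.of_mem_outs (h.mem_outs hx.basic), fun R hR => hx.det R (.head ⟨γ, h⟩ hR)⟩

theorem tauStar {x y : Expr A} (hx : IsDetBasic x) (h : TauStar x y) : IsDetBasic y := by
  induction h with
  | refl => exact hx
  | tail _ h ih => exact ih.step h

theorem weak {x y : Expr A} {γ : Act A} (hx : IsDetBasic x) (h : Weak x γ y) : IsDetBasic y := by
  obtain ⟨x₁, x₂, h₁, h₂, h₃⟩ := h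
  exact ((hx.tauStar h₁).step h₂).tauStar h₃

theorem weakStep {x y : Expr A} {α : PAct A} (hx : IsDetBasic x) (h : Weak x (.std α) y) :
    WeakStep x α y := by
  obtain ⟨x₁, x₂, h₁, h₂, h₃⟩ := h
  have hx₁ := hx.tauStar h₁
  exact ⟨x₁, x₂, h₁.tauReach hx.basic, h₂.mem_outs hx₁.basic,
    h₃.tauReach (hx₁.step h₂).basic⟩

/-- A process that can let time pass has no silent transitions. -/
theorem eq_of_tauStar {x x' y : Expr A} (hx : IsDetBasic x) (h : Step x .delta x')
    (hy : TauStar x y) : y = x := by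
  rcases Relation.ReflTransGen.cases_head hy with rfl | ⟨z, hz, -⟩
  · rfl
  · exact ((DStep.deltaStep h hx.basic).2 z (Step.mem_outs hz hx.basic)).elim

end IsDetBasic

/-! ### Weak bisimilarity of time-deterministic processes. -/

theorem isWeakBisim_weakBisimilar : IsWeakBisim (WeakBisimilar (A := A)) := by
  rintro x y ⟨β, hβ, hxy⟩
  refine ⟨fun γ x' h => ?_, fun γ y' h => ?_⟩
  · obtain ⟨y', h₁, h₂⟩ := (hβ x y hxy).1 γ x' h
    exact ⟨y', h₁, β, hβ, h₂⟩
  · obtain ⟨x', h₁, h₂⟩ := (hβ x y hxy).2 γ y' h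
    exact ⟨x', h₁, β, hβ, h₂⟩

namespace WeakBisimilar

theorem symm {x y : Expr A} (h : WeakBisimilar x y) : WeakBisimilar y x := by
  obtain ⟨β, hβ, hxy⟩ := h
  exact ⟨fun u v => β v u, fun u v h => ⟨(hβ v u h).2, (hβ v u h).1⟩, hxy⟩

theorem step {x y x' : Expr A} {γ : Act A} (h : WeakBisimilar x y) (hx : Step x γ x') :
    ∃ y', WeakHat y γ y' ∧ WeakBisimilar x' y' :=
  (isWeakBisim_weakBisimilar x y h).1 γ x' hx

theorem tauStar {x y x' : Expr A} (h : WeakBisimilar x y) (hx : TauStar x x') :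
    ∃ y', TauStar y y' ∧ WeakBisimilar x' y' := by
  induction hx with
  | refl => exact ⟨y, .refl, h⟩
  | tail _ hs ih =>
    obtain ⟨y₁, h₁, h₂⟩ := ih
    obtain ⟨y₂, ⟨hne, -⟩ | ⟨-, h₃⟩, h₄⟩ := h₂.step hs
    · exact (hne rfl).elim
    · exact ⟨y₂, h₁.trans h₃, h₄⟩

theorem delta {x y x' : Expr A} (h : WeakBisimilar x y) (hx : Step x .delta x') :
    ∃ y', Weak y .delta y' ∧ WeakBisimilar x' y' := by
  obtain ⟨y', ⟨-, h₁⟩ | ⟨h₁, -⟩, h₂⟩ := h.step hx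
  · exact ⟨y', h₁, h₂⟩
  · cases h₁

theorem weakHat_of_tauStar {x y z : Expr A} {γ : Act A} (h : TauStar x y) (h' : WeakHat y γ z) :
    WeakHat x γ z := by
  rcases h' with ⟨hγ, y₁, y₂, h₁, h₂, h₃⟩ | ⟨hγ, h'⟩
  · exact .inl ⟨hγ, y₁, y₂, h.trans h₁, h₂, h₃⟩
  · exact .inr ⟨hγ, h.trans h'⟩

/-- Two processes are weakly bisimilar if each of them can silently reach a process that is
weakly bisimilar to the other. -/
theorem of_tauStar {x x' y y' : Expr A} (hx : TauStar x x') (hxy : WeakBisimilar x' y)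
    (hy : TauStar y y') (hyx : WeakBisimilar y' x) : WeakBisimilar x y := by
  refine ⟨fun u v => WeakBisimilar u v ∨ (u = x ∧ v = y), ?_, .inr ⟨rfl, rfl⟩⟩
  rintro u v (h | ⟨rfl, rfl⟩)
  · refine ⟨fun γ u' hu => ?_, fun γ v' hv => ?_⟩
    · obtain ⟨v', h₁, h₂⟩ := h.step hu
      exact ⟨v', h₁, .inl h₂⟩
    · obtain ⟨u', h₁, h₂⟩ := h.symm.step hv
      exact ⟨u', h₁, .inl h₂.symm⟩
  · refine ⟨fun γ u' hu => ?_, fun γ v' hv => ?_⟩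
    · obtain ⟨v', h₁, h₂⟩ := hyx.symm.step hu
      exact ⟨v', weakHat_of_tauStar hy h₁, .inl h₂⟩
    · obtain ⟨u', h₁, h₂⟩ := hxy.symm.step hv
      exact ⟨u', weakHat_of_tauStar hx h₁, .inl h₂.symm⟩

/-- Between time-deterministic processes, time steps are matched by time steps that are not
followed by silent transitions. -/
theorem delta_strict {x y x' : Expr A} (h : WeakBisimilar x y) (hx : IsDetBasic x)
    (hs : Step x .delta x') :
    ∃ y₁ y₂, TauStar y y₁ ∧ Step y₁ .delta y₂ ∧ WeakBisimilar x' y₂ := by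
  obtain ⟨y₃, ⟨y₁, y₂, h₁, h₂, h₃⟩, h₄⟩ := h.delta hs
  -- Being able to let time pass, `x` is stable, so it matches the silent steps to `y₁` by standing
  -- still. By determinism its answer to the time step of `y₁` passes through `x'`. Thus `x'` and
  -- `y₂` each silently reach a state bisimilar to the other.
  obtain ⟨x₁, hx₁, h₅⟩ := h.symm.tauStar h₁
  obtain rfl := hx.eq_of_tauStar hs hx₁
  obtain ⟨x₃, ⟨xa, xb, ha, hb, hc⟩, h₆⟩ := h₅.delta h₂
  obtain rfl := hx.eq_of_tauStar hs ha
  obtain rfl := hx.det _ .refl _ _ hb hs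
  exact ⟨y₁, y₂, h₁, h₂, of_tauStar hc h₆.symm h₃ h₄.symm⟩

/-- Restricting weak bisimilarity to deterministic basic processes gives a strict bisimulation; only
the time clause needs determinism, through `delta_strict`. -/
theorem strictBisim {x y : Expr A} (hx : IsDetBasic x) (hy : IsDetBasic y)
    (h : WeakBisimilar x y) : StrictBisim x y := by
  refine ⟨fun x y => IsDetBasic x ∧ IsDetBasic y ∧ WeakBisimilar x y, ?_, hx, hy, h⟩
  refine ⟨fun ⟨hx, hy, h⟩ => ⟨hy, hx, h.symm⟩, ?_, ?_, ?_⟩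
  · rintro x y x' ⟨hx, hy, h⟩ ho
    have hs : Step x Act.tau x' := (pStep_iff hx.basic).2 ho
    obtain ⟨y', h₁, h₂⟩ := h.tauStar (.single hs)
    exact ⟨y', h₁.tauReach hy.basic, hx.step hs, hy.tauStar h₁, h₂⟩
  · rintro x y x' α ⟨hx, hy, h⟩ ho hα
    have hs : Step x (.std α) x' := (pStep_iff hx.basic).2 ho
    obtain ⟨y', ⟨-, h₁⟩ | ⟨h₁, -⟩, h₂⟩ := h.step hs
    · exact ⟨y', hy.weakStep h₁, hx.step hs, hy.weak h₁, h₂⟩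
    · exact (hα (Act.std.inj h₁)).elim
  · rintro x y x' ⟨hx, hy, h⟩ ho
    have hs : Step x .delta x' := (dStep_iff hx.basic).2 ho
    obtain ⟨y₁, y', h₁, h₂, h₃⟩ := h.delta_strict hx hs
    have hy₁ := hy.tauStar h₁
    exact ⟨y₁, y', h₁.tauReach hy.basic, (dStep_iff hy₁.basic).1 h₂, hx.step hs, hy₁.step h₂, h₃⟩

end WeakBisimilar

theorem TimeCongruent.rootedBisim {x y : Expr A} (hx : IsDetBasic x) (hy : IsDetBasic y)
    (h : TimeCongruent x y) : RootedBisim x y := by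
  obtain ⟨β, hβ, h⟩ := h
  refine ⟨fun x y => IsDetBasic x ∧ IsDetBasic y ∧ (β x y ∨ β y x), ?_, hx, hy, .inl h⟩
  refine ⟨fun ⟨hx, hy, h⟩ => ⟨hy, hx, h.symm⟩, ?_, ?_⟩
  · rintro x y x' α ⟨hx, hy, h⟩ ho
    have hs : Step x (.std α) x' := (pStep_iff hx.basic).2 ho
    have : ∃ y', Weak y (.std α) y' ∧ WeakBisimilar x' y' := by
      rcases h with h | h
      · exact (hβ x y h).1 α x' hs
      · obtain ⟨y', h₁, h₂⟩ := (hβ y x h).2.2.1 α x' hs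
        exact ⟨y', h₁, h₂.symm⟩
    obtain ⟨y', h₁, h₂⟩ := this
    exact ⟨y', hy.weakStep h₁, h₂.strictBisim (hx.step hs) (hy.weak h₁)⟩
  · rintro x y x' ⟨hx, hy, h⟩ ho
    have hs : Step x .delta x' := (dStep_iff hx.basic).2 ho
    have : ∃ y', Step y .delta y' ∧ (β x' y' ∨ β y' x') := by
      rcases h with h | h
      · obtain ⟨y', h₁, h₂⟩ := (hβ x y h).2.1 x' hs
        exact ⟨y', h₁, .inl h₂⟩
      · obtain ⟨y', h₁, h₂⟩ := (hβ y x h).2.2.2 x' hs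
        exact ⟨y', h₁, .inr h₂⟩
    obtain ⟨y', h₁, h₂⟩ := this
    exact ⟨y', (dStep_iff hy.basic).1 h₁, hx.step hs, hy.step h₁, h₂⟩

/-- Both processes are placed in one finite system, taken from the unfoldings of their sum, so that
their canonical expressions come from the same family `R` and are literally equal. -/
theorem RootedBisim.provable {P Q : Expr A} (hPb : IsBasic P) (hPc : Closed P) (hQb : IsBasic Q)
    (hQc : Closed Q) (h : RootedBisim P Q) : Provable P Q := by
  obtain ⟨D, hPD, hD, hp, hm⟩ := exists_finite_unfoldings (plus P Q)
  obtain ⟨hP, hQ⟩ := hp P Q hPD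
  obtain ⟨K, hK⟩ := exists_canonical hD
  obtain ⟨R, hR⟩ := exists_rootedCanonical hD hK
  have key : ∀ {E}, IsBasic E → Closed E → E ∈ D → Provable E (R E) := by
    intro E hb hc hE
    -- A closed expression ignores the environment; `P` is merely some state of `D`.
    have := hR.provable hD hp hm hK hb (p := fun _ => P) (fun _ => hP)
      (by rwa [hc.subst_eq]) .refl
    rwa [hc.subst_eq, hc.subst_eq] at this
  exact (key hPb hPc hP).trans (hR.congr hP hQ h ▸ (key hQb hQc hQ).symm)

end DTCalc

theorem mainTheorem10 {A : Type*} (P Q : DTCalc.Expr A)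
    (hPb : P.IsBasic) (hPc : P.Closed) (hQb : Q.IsBasic) (hQc : Q.Closed)
    (hPt : DTCalc.TimeDeterministic P) (hQt : DTCalc.TimeDeterministic Q)
    (hPQ : DTCalc.TimeCongruent P Q) :
    DTCalc.Provable P Q := by
  exact (hPQ.rootedBisim ⟨hPb, hPt⟩ ⟨hQb, hQt⟩).provable hPb hPc hQb hQc
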